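/- An instance of the unsplittable Euclidean capacitated vehicle routing problem consists of a depot $O$ and $n\ge 0$ terminals $v\in V$, each given by a point of the Euclidean plane with rational coordinates (locations may coincide), and of a rational demand $\mathrm{demand}(v)\in(0,1]$ for each terminal. A tour is a closed walk on $V\cup\{O\}$ that starts and ends at $O$; it covers some of the terminals that it visits, and its cost is its Euclidean length. A feasible solution is a finite collection of tours such that every terminal is covered exactly once, by a single tour, and the total demand of the terminals covered by each tour is at most $1$. The cost of a solution is the sum of the costs of its tours. Theorem. For every $\epsilon>0$ there is a deterministic algorithm that, given any instance in which every terminal has demand at least $\epsilon$, outputs a feasible solution whose cost is at most $(1+\epsilon)$ times the cost of every feasible solution. Its running time is bounded by a polynomial (which may depend on $\epsilon$) in the bit size of the instance, where numbers are written in binary and every elementary operation is charged the bit size of the data that it reads and writes. -/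

import Mathlib

/-! ### The problem -/

namespace CVRP

/-- The point of the Euclidean plane with the given rational coordinates. -/
noncomputable def toPlane (p : ℚ × ℚ) : EuclideanSpace ℝ (Fin 2) :=
  !₂[(p.1 : ℝ), (p.2 : ℝ)]

/-- An instance of the unsplittable Euclidean capacitated vehicle routing problem with `n`
terminals and tour capacity `1`, given by rational data. Distinct terminals may share a
location, and terminals may lie at the depot. -/
structure Instance where
  n : ℕ
  depot : ℚ × ℚ
  loc : Fin n → ℚ × ℚ
  demand : Fin n → ℚ
  demand_pos : ∀ v, 0 < demand v
  demand_le_one : ∀ v, demand v ≤ 1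

/-- A vertex is the depot (`none`) or a terminal (`some v`). -/
abbrev Vertex (n : ℕ) : Type := Option (Fin n)

/-- A tour starts at the depot, visits the vertices of `route` in this order, and returns to the
depot. It covers the terminals in `covered`; it may pass through further ones. -/
structure Tour (n : ℕ) where
  route : List (Vertex n)
  covered : List (Fin n)

/-- A solution is a finite collection of tours. -/
abbrev Solution (n : ℕ) : Type := List (Tour n)

/-- The length of the polygonal path through a list of points. -/
noncomputable def pathLength {X : Type*} [MetricSpace X] : List X → ℝ
  | [] => 0
  | [_] => 0
  | x :: y :: l => dist x y + pathLength (y :: l)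

namespace Instance

variable (I : Instance)

/-- The position of a vertex in the plane. -/
noncomputable def pos : Vertex I.n → EuclideanSpace ℝ (Fin 2)
  | none => toPlane I.depot
  | some v => toPlane (I.loc v)

/-- The length of the closed walk `O, route, O`. -/
noncomputable def tourCost (t : Tour I.n) : ℝ :=
  pathLength ((none :: (t.route ++ [none])).map I.pos)

/-- The total length of all tours. -/
noncomputable def cost (S : Solution I.n) : ℝ := (S.map I.tourCost).sum

/-- Feasibility: a tour covers only terminals that it visits, every terminal is covered exactly
once in the whole collection, and the demand covered by each tour is at most `1`. -/
structure Feasible (S : Solution I.n) : Prop where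
  visits : ∀ t ∈ S, ∀ v ∈ t.covered, some v ∈ t.route
  covers : ∀ v : Fin I.n, (S.flatMap Tour.covered).count v = 1
  capacity : ∀ t ∈ S, (t.covered.map I.demand).sum ≤ 1

/-- `S` is feasible and costs at most `ρ` times as much as every feasible solution. -/
def IsApprox (ρ : ℝ) (S : Solution I.n) : Prop :=
  I.Feasible S ∧ ∀ S' : Solution I.n, I.Feasible S' → I.cost S ≤ ρ * I.cost S'

/-- All terminals are big with respect to `ε`. -/
def AllBig (ε : ℝ) : Prop := ∀ v, ε ≤ (I.demand v : ℝ)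

end Instance

end CVRP

/-! ### The machine model

Deterministic programs on binary trees whose leaves hold rational numbers. Every basic operation
costs the bit size of the tree it reads plus the bit size of the tree it writes, so no value can be
larger than the input plus the time spent, and time is polynomially related to time on a Turing
machine. -/

namespace Machine

/-- Binary trees with rational leaves. -/
inductive Data : Type
  | atom (q : ℚ)
  | node (a b : Data)

namespace Data

/-- The bit size of a tree; numerators and denominators are counted in binary. -/
def size : Data → ℕ
  | atom q => 1 + q.num.natAbs.size + q.den.size
  | node a b => 1 + a.size + b.size

/-- The truth values are `0` and `1`. -/
def ofBool (b : Bool) : Data := atom (if b then 1 else 0)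

/-- Lists, with `0` as the end marker. -/
def ofList : List Data → Data
  | [] => atom 0
  | a :: l => node a (ofList l)

end Data

/-- The basic operations. The arithmetic ones act on a pair of leaves (`floor`: on one leaf). -/
inductive Op : Type
  | id
  | const (d : Data)
  | fst
  | snd
  | isNode
  | add
  | sub
  | mul
  | div
  | floor
  | le

open Data in
/-- The effect of a basic operation; the result is `0` if the argument has the wrong shape. -/
def Op.apply : Op → Data → Data
  | .id, x => x
  | .const d, _ => d
  | .fst, node a _ => a
  | .snd, node _ b => b
  | .isNode, node _ _ => ofBool true
  | .add, node (atom p) (atom q) => atom (p + q)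
  | .sub, node (atom p) (atom q) => atom (p - q)
  | .mul, node (atom p) (atom q) => atom (p * q)
  | .div, node (atom p) (atom q) => atom (p / q)
  | .floor, atom p => atom (⌊p⌋ : ℤ)
  | .le, node (atom p) (atom q) => ofBool (decide (p ≤ q))
  | _, _ => atom 0

/-- Programs: each one maps an input tree to an output tree. -/
inductive Program : Type
  | op (o : Op)
  | seq (f g : Program)
  | pair (f g : Program)
  | ite (c f g : Program)
  | while (c f : Program)

/-- `Run P x y t`: the program `P`, started on `x`, halts with output `y` after time `t`.
A condition holds if its value is not `0`. -/
inductive Run : Program → Data → Data → ℕ → Prop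
  | op (o : Op) (x : Data) :
      Run (.op o) x (o.apply x) (1 + x.size + (o.apply x).size)
  | seq {f g : Program} {x y z : Data} {s t : ℕ} :
      Run f x y s → Run g y z t → Run (.seq f g) x z (1 + s + t)
  | pair {f g : Program} {x y z : Data} {s t : ℕ} :
      Run f x y s → Run g x z t → Run (.pair f g) x (.node y z) (1 + s + t)
  | ite_true {c f g : Program} {x b y : Data} {s t : ℕ} :
      Run c x b s → b ≠ .atom 0 → Run f x y t → Run (.ite c f g) x y (1 + s + t)
  | ite_false {c f g : Program} {x y : Data} {s t : ℕ} :
      Run c x (.atom 0) s → Run g x y t → Run (.ite c f g) x y (1 + s + t)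
  | while_true {c f : Program} {x b y z : Data} {s t u : ℕ} :
      Run c x b s → b ≠ .atom 0 → Run f x y t → Run (.while c f) y z u →
      Run (.while c f) x z (1 + s + t + u)
  | while_false {c f : Program} {x : Data} {s : ℕ} :
      Run c x (.atom 0) s → Run (.while c f) x x (1 + s)

/-- Programs are deterministic: output and running time are determined by the input. -/
theorem Run.deterministic {P : Program} {x y : Data} {t : ℕ} (h : Run P x y t) :
    ∀ {y' : Data} {t' : ℕ}, Run P x y' t' → y = y' ∧ t = t' := by
  induction h with
  | op o x => intro y' t' h'; cases h'; exact ⟨rfl, rfl⟩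
  | seq _ _ ih₁ ih₂ =>
    intro y' t' h'
    cases h' with
    | seq a b =>
      obtain ⟨rfl, rfl⟩ := ih₁ a
      obtain ⟨rfl, rfl⟩ := ih₂ b
      exact ⟨rfl, rfl⟩
  | pair _ _ ih₁ ih₂ =>
    intro y' t' h'
    cases h' with
    | pair a b =>
      obtain ⟨rfl, rfl⟩ := ih₁ a
      obtain ⟨rfl, rfl⟩ := ih₂ b
      exact ⟨rfl, rfl⟩
  | ite_true _ hb _ ih₁ ih₂ =>
    intro y' t' h'
    cases h' with
    | ite_true a _ b =>
      obtain ⟨rfl, rfl⟩ := ih₁ a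
      obtain ⟨rfl, rfl⟩ := ih₂ b
      exact ⟨rfl, rfl⟩
    | ite_false a b => exact absurd (ih₁ a).1 hb
  | ite_false _ _ ih₁ ih₂ =>
    intro y' t' h'
    cases h' with
    | ite_true a hb b => exact absurd (ih₁ a).1.symm hb
    | ite_false a b =>
      obtain ⟨-, rfl⟩ := ih₁ a
      obtain ⟨rfl, rfl⟩ := ih₂ b
      exact ⟨rfl, rfl⟩
  | while_true _ hb _ _ ih₁ ih₂ ih₃ =>
    intro y' t' h'
    cases h' with
    | while_true a _ b c =>
      obtain ⟨rfl, rfl⟩ := ih₁ a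
      obtain ⟨rfl, rfl⟩ := ih₂ b
      obtain ⟨rfl, rfl⟩ := ih₃ c
      exact ⟨rfl, rfl⟩
    | while_false a => exact absurd (ih₁ a).1 hb
  | while_false _ ih₁ =>
    intro y' t' h'
    cases h' with
    | while_true a hb b c => exact absurd (ih₁ a).1.symm hb
    | while_false a =>
      obtain ⟨-, rfl⟩ := ih₁ a
      exact ⟨rfl, rfl⟩

end Machine

/-! ### Polynomial-time approximation algorithms -/

namespace CVRP

open Machine

/-- A point is written as the pair of its coordinates. -/
def encodePoint (p : ℚ × ℚ) : Data := .node (.atom p.1) (.atom p.2)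

/-- An instance is written as its depot followed by the list of its terminals, each of them as
location and demand. -/
def Instance.encode (I : Instance) : Data :=
  .node (encodePoint I.depot)
    (.ofList (List.ofFn fun v => .node (encodePoint (I.loc v)) (.atom (I.demand v))))

/-- The depot is written as `0` and the terminals as `1, …, n`. -/
def encodeVertex {n : ℕ} : Vertex n → Data
  | none => .atom 0
  | some v => .atom ((v : ℕ) + 1 : ℕ)

/-- A tour is written as the list of its stops and the list of the terminals that it covers. -/
def Tour.encode {n : ℕ} (t : Tour n) : Data :=
  .node (.ofList (t.route.map encodeVertex))
    (.ofList (t.covered.map fun v => encodeVertex (some v)))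

/-- A solution is written as the list of its tours. -/
def Solution.encode {n : ℕ} (S : Solution n) : Data := .ofList (S.map Tour.encode)

/-- `A` is a polynomial-time `ρ`-approximation algorithm for the instances with property `P`:
on each of them it halts within a time that is polynomial in the bit size of the
instance, and it outputs a feasible solution of cost at most `ρ` times the optimum. -/
def IsPolyTimeApproxAlgorithm (A : Program) (P : Instance → Prop) (ρ : ℝ) : Prop :=
  ∃ p : Polynomial ℕ, ∀ I : Instance, P I →
    ∃ (S : Solution I.n) (t : ℕ),
      Run A I.encode (Solution.encode S) t ∧ t ≤ p.eval I.encode.size ∧ I.IsApprox ρ S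

end CVRP

/-! Let `k = ⌈1/ε⌉`. A tour covers at most `k` terminals, and each of them forces length at least
twice its distance from the depot. So `2 ∑ rad ≤ k · OPT`, where `rad` is that distance
(`sum_rad_le`). Every modification that costs `O(1/K) ∑ rad`, with `K = 100 k²`, is therefore
affordable.

Scales. A terminal has scale `s` if its maximum norm relative to the depot lies in `[K^s, K^(s+1))`.
For a suitable residue `a` modulo `K`, the terminals whose scale is congruent to `a` carry at most a
fraction `1/K` of `∑ rad` (`exists_shift`) and get tours of their own. The other scales fall into
blocks. Terminals of different blocks differ by at least two scales, so the nearer one is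
negligible, and a tour can be split among blocks cheaply (`sum_tourLength_filter_le`).

Rounding in a block. Each scale carries a grid in which points of one cell are interchangeable up to
a relative error `2/K` (`dist_le_of_keyOf_eq`). In a cell the terminals are ordered by decreasing
demand and cut into fewer than `2K` classes of equal size, up to a remainder. Replacing every
terminal by one from the next class lowers demands, so tours stay within capacity; only the class of
largest demands is left over, and it is served by single tours (`replace_bounds`). A block thus has
a bounded number of types, and a tour is a word of length at most `k` in them, a configuration. It
remains to guess the multiplicity of every configuration: polynomially many guesses, each realized
greedily (`exists_mem_states`).

Every candidate is made feasible, lengths are compared through rational Newton approximations, and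
the best candidate is kept (`totalLength_best_le`). The errors add up in `totalLength_solve_le`.
Polynomial time is proved compositionally: `PolyTime` is closed under the constructions used, where
folds and loops need a bound on the size of their states. -/

namespace Machine

/-! ### Polynomial-time functions: composition, branching, loops and folds -/

open Polynomial

theorem eval_mono (p : ℕ[X]) {m n : ℕ} (h : m ≤ n) : p.eval m ≤ p.eval n := by
  rw [Polynomial.eval_eq_sum, Polynomial.eval_eq_sum]
  exact Finset.sum_le_sum fun i _ => Nat.mul_le_mul_left _ (Nat.pow_le_pow_left h i)

theorem Data.size_pos (d : Data) : 1 ≤ d.size := by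
  cases d <;> simp only [Data.size] <;> omega

/-- The running time bounds the size of the input and of the output. -/
theorem Run.size_le {P : Program} {x y : Data} {t : ℕ} (h : Run P x y t) :
    x.size ≤ t ∧ y.size ≤ t := by
  induction h with
  | pair => simp only [Data.size]; omega
  | _ => omega

/-- Types whose elements are written as trees. -/
class Enc (α : Type) where
  enc : α → Data

open Enc

/-- The bit size of the code of an element. -/
def sz {α : Type} [Enc α] (a : α) : ℕ := (enc a).size

/-- Functions computed by a program in polynomial time. -/
@[fun_prop]
def PolyTime {α β : Type} [Enc α] [Enc β] (f : α → β) : Prop :=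
  ∃ (P : Program) (p : ℕ[X]), ∀ a, ∃ t, Run P (enc a) (enc (f a)) t ∧ t ≤ p.eval (sz a)

instance : Enc ℚ := ⟨.atom⟩
instance : Enc ℤ := ⟨fun z => .atom z⟩
instance : Enc ℕ := ⟨fun n => .atom n⟩
instance : Enc Bool := ⟨.ofBool⟩
instance {α β : Type} [Enc α] [Enc β] : Enc (α × β) := ⟨fun x => .node (enc x.1) (enc x.2)⟩
instance {α : Type} [Enc α] : Enc (List α) := ⟨fun l => .ofList (l.map enc)⟩

section

variable {α β γ δ : Type} [Enc α] [Enc β] [Enc γ] [Enc δ]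

theorem sz_pos (a : α) : 1 ≤ sz a := Data.size_pos _

theorem sz_prod (x : α × β) : sz x = 1 + sz x.1 + sz x.2 := rfl

theorem sz_mk (a : α) (b : β) : sz (a, b) = 1 + sz a + sz b := rfl

theorem sz_nil : sz ([] : List α) = 2 := by
  simp [sz, enc, Data.ofList, Data.size]

theorem sz_cons (a : α) (l : List α) : sz (a :: l) = 1 + sz a + sz l := rfl

theorem sz_bool (b : Bool) : sz b ≤ 3 := by cases b <;> decide

theorem sz_list (l : List α) : sz l = 2 + (l.map fun a => 1 + sz a).sum := by
  induction l with
  | nil => exact sz_nil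
  | cons a l ih => rw [sz_cons, ih, List.map_cons, List.sum_cons]; omega

theorem sz_append (l m : List α) : sz (l ++ m) + 2 = sz l + sz m := by
  simp only [sz_list, List.map_append, List.sum_append]; omega

theorem sz_perm {l m : List α} (h : l.Perm m) : sz l = sz m := by
  rw [sz_list, sz_list, (h.map _).sum_eq]

theorem sz_sublist {l m : List α} (h : l.Sublist m) : sz l ≤ sz m := by
  rw [sz_list, sz_list]
  exact Nat.add_le_add_left ((h.map _).sum_le_sum fun _ _ => Nat.zero_le _) 2

theorem sz_le_of_mem {a : α} {l : List α} (h : a ∈ l) : sz a ≤ sz l := by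
  have := sz_sublist (List.singleton_sublist.2 h)
  rw [sz_cons] at this; omega

theorem length_le_sz (l : List α) : l.length ≤ sz l := by
  induction l with
  | nil => simp
  | cons a l ih => rw [sz_cons, List.length_cons]; omega

namespace PolyTime

theorem exists_sz_le {f : α → β} (hf : PolyTime f) :
    ∃ p : ℕ[X], ∀ a, sz (f a) ≤ p.eval (sz a) := by
  obtain ⟨P, p, h⟩ := hf
  refine ⟨p, fun a => ?_⟩
  obtain ⟨t, ht, htp⟩ := h a
  exact ht.size_le.2.trans htp

/-- A basic operation is charged only for reading and writing, so a bound on the output size is a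
time bound. -/
theorem of_op (o : Op) (f : α → β) (h : ∀ a, o.apply (enc a) = enc (f a)) (p : ℕ[X])
    (hp : ∀ a, sz (f a) ≤ p.eval (sz a)) : PolyTime f := by
  refine ⟨.op o, 1 + X + p, fun a => ⟨_, h a ▸ Run.op o (enc a), ?_⟩⟩
  have := hp a
  simp only [eval_add, eval_one, eval_X]
  unfold sz at *
  omega

@[fun_prop]
theorem id' : PolyTime (fun a : α => a) :=
  of_op .id _ (fun _ => rfl) X (fun a => by simp)

@[fun_prop]
theorem const' (b : β) : PolyTime (fun _ : α => b) :=
  of_op (.const (enc b)) _ (fun _ => rfl) (C (sz b)) (fun a => by simp)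

-- The second program runs in time polynomial in the size of `f a`, and that size is bounded by the
-- time of the first program, which paid for writing it.
@[fun_prop]
theorem comp' {g : β → γ} {f : α → β} (hg : PolyTime g) (hf : PolyTime f) :
    PolyTime (fun a => g (f a)) := by
  obtain ⟨P, p, hP⟩ := hf
  obtain ⟨Q, q, hQ⟩ := hg
  refine ⟨.seq P Q, 1 + p + q.comp p, fun a => ?_⟩
  obtain ⟨s, hs, hsp⟩ := hP a
  obtain ⟨t, ht, htq⟩ := hQ (f a)
  refine ⟨_, hs.seq ht, ?_⟩
  have : q.eval (sz (f a)) ≤ q.eval (p.eval (sz a)) := eval_mono q (hs.size_le.2.trans hsp)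
  simp only [eval_add, eval_one, eval_comp]
  omega

@[fun_prop]
theorem prodMk {f : α → β} {g : α → γ} (hf : PolyTime f) (hg : PolyTime g) :
    PolyTime (fun a => (f a, g a)) := by
  obtain ⟨P, p, hP⟩ := hf
  obtain ⟨Q, q, hQ⟩ := hg
  refine ⟨.pair P Q, 1 + p + q, fun a => ?_⟩
  obtain ⟨s, hs, hsp⟩ := hP a
  obtain ⟨t, ht, htq⟩ := hQ a
  refine ⟨_, hs.pair ht, ?_⟩
  simp only [eval_add, eval_one]
  omega

@[fun_prop]
theorem fst' : PolyTime (fun x : α × β => x.1) :=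
  of_op .fst _ (fun _ => rfl) X (fun a => by simp [sz_prod]; omega)

@[fun_prop]
theorem snd' : PolyTime (fun x : α × β => x.2) :=
  of_op .snd _ (fun _ => rfl) X (fun a => by simp [sz_prod])

theorem ofBool_ne {b : Bool} (h : b = true) : Data.ofBool b ≠ .atom 0 := by
  subst h; simp [Data.ofBool]

@[fun_prop]
theorem cond' {c : α → Bool} {f g : α → β} (hc : PolyTime c) (hf : PolyTime f)
    (hg : PolyTime g) : PolyTime (fun a => bif c a then f a else g a) := by
  obtain ⟨R, r, hR⟩ := hc
  obtain ⟨P, p, hP⟩ := hf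
  obtain ⟨Q, q, hQ⟩ := hg
  refine ⟨.ite R P Q, 1 + r + p + q, fun a => ?_⟩
  obtain ⟨u, hu, hur⟩ := hR a
  obtain ⟨s, hs, hsp⟩ := hP a
  obtain ⟨t, ht, htq⟩ := hQ a
  cases hca : c a
  · rw [hca] at hu
    refine ⟨_, by simpa [hca] using Run.ite_false hu ht, ?_⟩
    simp only [eval_add, eval_one]
    omega
  · rw [hca] at hu
    refine ⟨_, by simpa [hca] using Run.ite_true hu (ofBool_ne rfl) hs, ?_⟩
    simp only [eval_add, eval_one]
    omega

theorem of_eq {f g : α → β} (hf : PolyTime f) (h : ∀ a, f a = g a) : PolyTime g :=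
  funext h ▸ hf

@[fun_prop]
theorem not' {c : α → Bool} (hc : PolyTime c) : PolyTime (fun a => !c a) :=
  of_eq (hc.cond' (const' false) (const' true)) fun a => by cases c a <;> rfl

@[fun_prop]
theorem and' {c d : α → Bool} (hc : PolyTime c) (hd : PolyTime d) :
    PolyTime (fun a => c a && d a) :=
  of_eq (hc.cond' hd (const' false)) fun a => by cases c a <;> rfl

@[fun_prop]
theorem or' {c d : α → Bool} (hc : PolyTime c) (hd : PolyTime d) :
    PolyTime (fun a => c a || d a) :=
  of_eq (hc.cond' (const' true) hd) fun a => by cases c a <;> rfl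

/-- A fold over a list that does not depend on the input. -/
theorem foldl_const {σ : Type} (L : List σ) (step : σ → α → α) (h : ∀ s, PolyTime (step s)) :
    PolyTime (fun a => L.foldl (fun a s => step s a) a) := by
  induction L with
  | nil => exact id'
  | cons s L ih => exact ih.comp' (h s)

theorem iterate_const (f : α → α) (hf : PolyTime f) (n : ℕ) : PolyTime (fun a => f^[n] a) := by
  induction n with
  | zero => exact id'
  | succ n ih => exact ih.comp' hf

/-- Time of a loop all of whose states have bounded size. -/
theorem run_while {R P : Program} {r p : ℕ[X]} {c : α → Bool} {f : α → α}
    (hR : ∀ a, ∃ t, Run R (enc a) (enc (c a)) t ∧ t ≤ r.eval (sz a))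
    (hP : ∀ a, ∃ t, Run P (enc a) (enc (f a)) t ∧ t ≤ p.eval (sz a)) (b m : ℕ) :
    ∀ a : α, (∀ i ≤ m, sz (f^[i] a) ≤ b) → (∀ i < m, c (f^[i] a) = true) →
      c (f^[m] a) = false →
      ∃ t, Run (.while R P) (enc a) (enc (f^[m] a)) t ∧
        t ≤ (m + 1) * (1 + r.eval b + p.eval b) := by
  induction m with
  | zero =>
    intro a hb _ hc
    obtain ⟨t, ht, htr⟩ := hR a
    have h0 := eval_mono r (hb 0 le_rfl)
    rw [Function.iterate_zero_apply] at *
    rw [hc] at ht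
    refine ⟨_, .while_false ht, ?_⟩
    omega
  | succ m ih =>
    intro a hb ht hc
    obtain ⟨u, hu, hur⟩ := hR a
    obtain ⟨v, hv, hvp⟩ := hP a
    have h0 := hb 0 (Nat.zero_le _)
    have h1 := ht 0 (Nat.succ_pos _)
    rw [Function.iterate_zero_apply] at h0 h1
    obtain ⟨w, hw, hwb⟩ := ih (f a)
      (fun i hi => by simpa using hb (i + 1) (by omega))
      (fun i hi => by simpa using ht (i + 1) (by omega)) (by simpa using hc)
    rw [h1] at hu
    refine ⟨_, .while_true hu (ofBool_ne rfl) hv hw, ?_⟩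
    have := eval_mono r h0
    have := eval_mono p h0
    rw [Nat.add_mul (m + 1)]
    omega

/-- The bound `B` on all intermediate states is essential: a polynomial-time body may double the
size in each round, as repeated squaring does. -/
theorem while' {c : α → Bool} {f : α → α} (hc : PolyTime c) (hf : PolyTime f) (n : α → ℕ)
    (N B : ℕ[X]) (hn : ∀ a, n a ≤ N.eval (sz a))
    (hB : ∀ a, ∀ i ≤ n a, sz (f^[i] a) ≤ B.eval (sz a))
    (ht : ∀ a, ∀ i < n a, c (f^[i] a) = true) (hfin : ∀ a, c (f^[n a] a) = false) :
    PolyTime (fun a => f^[n a] a) := by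
  obtain ⟨R, r, hR⟩ := hc
  obtain ⟨P, p, hP⟩ := hf
  refine ⟨.while R P, (N + 1) * (1 + r.comp B + p.comp B), fun a => ?_⟩
  obtain ⟨t, h1, h2⟩ := run_while hR hP (B.eval (sz a)) (n a) a (hB a) (ht a) (hfin a)
  refine ⟨t, h1, h2.trans ?_⟩
  simp only [eval_mul, eval_add, eval_one, eval_comp]
  exact Nat.mul_le_mul_right _ (Nat.add_le_add_right (hn a) 1)

@[fun_prop]
theorem cons' {f : α → β} {g : α → List β} (hf : PolyTime f) (hg : PolyTime g) :
    PolyTime (fun a => f a :: g a) :=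
  hf.prodMk hg

/-- Case distinction on a list. -/
theorem listCases {f : γ → β} {g : γ × α × List α → β} (hf : PolyTime f) (hg : PolyTime g)
    {h : γ × List α → β} (h0 : ∀ c, h (c, []) = f c)
    (h1 : ∀ c a l, h (c, a :: l) = g (c, a, l)) : PolyTime h := by
  obtain ⟨P, p, hP⟩ := hf
  obtain ⟨Q, q, hQ⟩ := hg
  -- The end marker `0` is a leaf, so `isNode` on the second component tells the two cases apart.
  refine ⟨.ite (.seq (.op .snd) (.op .isNode)) (.seq (.pair (.op .fst)
    (.pair (.seq (.op .snd) (.op .fst)) (.seq (.op .snd) (.op .snd)))) Q)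
    (.seq (.op .fst) P), 50 + 20 * X + p + q, ?_⟩
  rintro ⟨c, _ | ⟨a, l⟩⟩
  · obtain ⟨s, hs, hsp⟩ := hP c
    refine ⟨_, .ite_false (.seq (.op _ _) (.op _ _)) (.seq (.op _ _) (h0 c ▸ hs)), ?_⟩
    have h := eval_mono p (show sz c ≤ sz (c, ([] : List α)) by rw [sz_mk]; omega)
    rw [sz_mk, sz_nil] at h ⊢
    simp [enc, Op.apply, Data.ofList, Data.size]
    simp [sz] at *
    omega
  · obtain ⟨s, hs, hsp⟩ := hQ (c, a, l)
    refine ⟨_, .ite_true (.seq (.op _ _) (.op _ _)) (by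
      simp [enc, Op.apply, Data.ofList, Data.ofBool]) (.seq (.pair (.op _ _)
        (.pair (.seq (.op _ _) (.op _ _)) (.seq (.op _ _) (.op _ _)))) (h1 c a l ▸ hs)), ?_⟩
    have h := eval_mono q (show sz (c, a, l) ≤ sz (c, a :: l) by
      simp only [sz_mk, sz_cons]; omega)
    simp only [eval_add, eval_mul, eval_X, eval_ofNat]
    generalize eval (sz (c, a :: l)) p = p' at *
    generalize eval (sz (c, a :: l)) q = q' at *
    simp only [sz_mk, sz_cons] at *
    simp [enc, Op.apply, Data.ofList, Data.size, Data.ofBool]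
    simp [sz, enc] at *
    omega

/-- A fold is polynomial if its step is and if the size of its result is polynomially bounded. -/
theorem foldl' {step : γ → β → α → β}
    (hstep : PolyTime fun x : γ × β × α => step x.1 x.2.1 x.2.2) (B : ℕ[X])
    (hB : ∀ (c : γ) (b : β) (l : List α),
      sz (l.foldl (step c) b) ≤ B.eval (sz c + sz b + sz l))
    {c : δ → γ} {b : δ → β} {l : δ → List α} (hc : PolyTime c) (hb : PolyTime b)
    (hl : PolyTime l) : PolyTime fun d => (l d).foldl (step (c d)) (b d) := by
  let F : (γ × β) × List α → (γ × β) × List α := fun x =>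
    match x.2 with
    | [] => x
    | a :: l => ((x.1.1, step x.1.1 x.1.2 a), l)
  have hF : PolyTime F := by
    refine listCases (f := fun c => (c, []))
      (g := fun y : (γ × β) × α × List α => ((y.1.1, step y.1.1 y.1.2 y.2.1), y.2.2))
      (by fun_prop) ?_ (fun _ => rfl) (fun _ _ _ => rfl)
    have : PolyTime fun y : (γ × β) × α × List α => step y.1.1 y.1.2 y.2.1 :=
      hstep.comp' (f := fun y : (γ × β) × α × List α => (y.1.1, y.1.2, y.2.1)) (by fun_prop)
    fun_prop
  let c' : (γ × β) × List α → Bool := fun x => !x.2.isEmpty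
  have hc' : PolyTime c' :=
    listCases (f := fun _ => false) (g := fun _ => true) (by fun_prop) (by fun_prop)
      (fun _ => rfl) (fun _ _ _ => rfl)
  -- An exhausted list is a fixed point of `F`, so this holds for every `i`.
  have hFi : ∀ i x, F^[i] x =
      ((x.1.1, (x.2.take i).foldl (step x.1.1) x.1.2), x.2.drop i) := by
    intro i
    induction i with
    | zero => intro x; simp
    | succ i ih =>
      rintro ⟨⟨c, b⟩, _ | ⟨a, l⟩⟩
      · rw [Function.iterate_succ_apply, ih]; simp [F]
      · rw [Function.iterate_succ_apply, ih]; simp [F]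
  have key : PolyTime (fun x => F^[x.2.length] x) := by
    refine while' hc' hF (fun x => x.2.length) X (2 + 2 * X + B.comp (3 * X)) ?_ ?_ ?_ ?_
    · rintro ⟨⟨c, b⟩, l⟩
      have := length_le_sz l
      simp only [eval_X, sz_mk]; omega
    · rintro ⟨⟨c, b⟩, l⟩ i -
      rw [hFi]
      have h1 := hB c b (l.take i)
      have h2 := sz_sublist (List.drop_sublist i l)
      have h3 := sz_sublist (List.take_sublist i l)
      simp only [sz_mk, eval_add, eval_mul, eval_X, eval_comp, eval_ofNat] at *
      have h4 := eval_mono B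
        (show sz c + sz b + sz (l.take i) ≤ 3 * (1 + (1 + sz c + sz b) + sz l) by omega)
      omega
    · rintro ⟨⟨c, b⟩, l⟩ i hi
      rw [hFi]
      simpa [c'] using hi
    · rintro ⟨⟨c, b⟩, l⟩
      rw [hFi]
      simp [c']
  have key2 := key.comp' ((hc.prodMk hb).prodMk hl)
  have key3 := (snd' (α := γ) (β := β)).comp' (fst'.comp' key2)
  refine of_eq key3 fun d => ?_
  rw [hFi]; simp

/-- A fold whose step increases the size by an amount that does not depend on the accumulator. -/
theorem foldl_add {step : γ → β → α → β}
    (hstep : PolyTime fun x : γ × β × α => step x.1 x.2.1 x.2.2) (B : ℕ[X])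
    (hB : ∀ c b a, sz (step c b a) ≤ sz b + B.eval (sz c + sz a))
    {c : δ → γ} {b : δ → β} {l : δ → List α} (hc : PolyTime c) (hb : PolyTime b)
    (hl : PolyTime l) : PolyTime fun d => (l d).foldl (step (c d)) (b d) := by
  refine foldl' hstep (X + X * B) ?_ hc hb hl
  intro c b l
  have : sz (l.foldl (step c) b) ≤ sz b + l.length * B.eval (sz c + sz l) := by
    induction l generalizing b with
    | nil => simp
    | cons a l ih =>
      have h1 := ih (step c b a)
      have h2 := hB c b a
      have h3 := eval_mono B (show sz c + sz a ≤ sz c + sz (a :: l) by rw [sz_cons]; omega)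
      have h4 := Nat.mul_le_mul_left l.length
        (eval_mono B (show sz c + sz l ≤ sz c + sz (a :: l) by rw [sz_cons]; omega))
      rw [List.foldl_cons, List.length_cons, Nat.add_mul]
      omega
  have h2 := length_le_sz l
  have h3 := Nat.mul_le_mul (show l.length ≤ sz c + sz b + sz l by omega)
    (eval_mono B (show sz c + sz l ≤ sz c + sz b + sz l by omega))
  simp only [eval_add, eval_mul, eval_X]
  omega

@[fun_prop]
theorem reverse' {l : δ → List α} (hl : PolyTime l) : PolyTime fun d => (l d).reverse := by
  -- The step needs no parameter; the constant `0` fills that slot here and in later folds.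
  have := foldl_add (γ := ℕ) (step := fun _ (b : List α) a => a :: b) (by fun_prop) (1 + X)
    (fun c b a => by simp only [sz_cons, eval_add, eval_one, eval_X]; omega)
    (const' 0) (const' []) hl
  refine of_eq this fun d => ?_
  rw [List.foldl_flip_cons_eq_append']; simp

@[fun_prop]
theorem append' {l m : δ → List α} (hl : PolyTime l) (hm : PolyTime m) :
    PolyTime fun d => l d ++ m d := by
  have := foldl_add (γ := ℕ) (step := fun _ (b : List α) a => a :: b) (by fun_prop) (1 + X)
    (fun c b a => by simp only [sz_cons, eval_add, eval_one, eval_X]; omega)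
    (const' 0) hm hl.reverse'
  refine of_eq this fun d => ?_
  rw [List.foldl_flip_cons_eq_append']; simp

@[fun_prop]
theorem flatten' {l : δ → List (List α)} (hl : PolyTime l) : PolyTime fun d => (l d).flatten := by
  have := foldl_add (γ := ℕ) (step := fun _ (b : List α) a => b ++ a) (by fun_prop) (1 + X)
    (fun c b a => by
      have := sz_append b a
      simp only [eval_add, eval_one, eval_X]; omega)
    (const' 0) (const' []) hl
  refine of_eq this fun d => ?_
  suffices h : ∀ (L : List (List α)) b, L.foldl (fun b a => b ++ a) b = b ++ L.flatten from
    (h _ _).trans (List.nil_append _)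
  intro L
  induction L with
  | nil => simp
  | cons a L ih => intro b; simp [ih]

-- The fold builds its result by prepending, hence it runs over the reversed list.
@[fun_prop]
theorem map' {g : δ → α → β} {l : δ → List α} (hg : PolyTime fun x : δ × α => g x.1 x.2)
    (hl : PolyTime l) : PolyTime fun d => (l d).map (g d) := by
  obtain ⟨p, hp⟩ := hg.exists_sz_le
  have := foldl_add (step := fun c (b : List β) a => g c a :: b) (by
      have := hg.comp' (f := fun x : δ × List β × α => (x.1, x.2.2)) (by fun_prop)
      fun_prop) (1 + p.comp (1 + X))
    (fun c b a => by
      have : sz (g c a) ≤ _ := hp (c, a)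
      rw [sz_mk, Nat.add_assoc] at this
      simp only [sz_cons, eval_add, eval_one, eval_X, eval_comp]; omega)
    id' (const' []) hl.reverse'
  refine of_eq this fun d => ?_
  rw [List.foldl_reverse]
  induction l d with
  | nil => rfl
  | cons a l ih => simp [ih]

@[fun_prop]
theorem flatMap' {g : δ → α → List β} {l : δ → List α} (hg : PolyTime fun x : δ × α => g x.1 x.2)
    (hl : PolyTime l) : PolyTime fun d => (l d).flatMap (g d) :=
  of_eq (map' hg hl).flatten' fun _ => (List.flatMap_def).symm

@[fun_prop]
theorem filter' {g : δ → α → Bool} {l : δ → List α} (hg : PolyTime fun x : δ × α => g x.1 x.2)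
    (hl : PolyTime l) : PolyTime fun d => (l d).filter (g d) := by
  have h : PolyTime fun d => (l d).flatMap fun a => bif g d a then [a] else [] :=
    by fun_prop
  refine of_eq h fun d => ?_
  induction l d with
  | nil => rfl
  | cons a l ih => rw [List.flatMap_cons, ih, List.filter_cons]; cases g d a <;> simp

end PolyTime

end

end Machine

/-! ### Bit sizes in rational arithmetic -/

namespace Machine

open Polynomial Enc

theorem sz_rat (q : ℚ) : sz q = 1 + q.num.natAbs.size + q.den.size := rfl

theorem sz_int (z : ℤ) : sz z = 2 + z.natAbs.size := by
  change 1 + ((z : ℚ).num.natAbs.size) + (z : ℚ).den.size = _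
  simp; omega

theorem sz_nat (n : ℕ) : sz n = 2 + n.size := by
  change 1 + ((n : ℚ).num.natAbs.size) + (n : ℚ).den.size = _
  simp; omega

theorem size_mul_le (a b : ℕ) : (a * b).size ≤ a.size + b.size := by
  rw [Nat.size_le, pow_add]
  exact Nat.mul_lt_mul'' (Nat.lt_size_self a) (Nat.lt_size_self b)

theorem size_add_le (a b : ℕ) : (a + b).size ≤ max a.size b.size + 1 := by
  rw [Nat.size_le, pow_succ]
  have h1 := (Nat.lt_size_self a).trans_le
    (Nat.pow_le_pow_right two_pos (le_max_left a.size b.size))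
  have h2 := (Nat.lt_size_self b).trans_le
    (Nat.pow_le_pow_right two_pos (le_max_right a.size b.size))
  omega

theorem size_le_self (n : ℕ) : n.size ≤ n := Nat.size_le.2 Nat.lt_two_pow_self

/-- Reduction to lowest terms only shrinks numerator and denominator, so sizes may be estimated on
unreduced fractions. -/
theorem num_den_le_of_eq_div {q : ℚ} {a b : ℤ} (hb : b ≠ 0) (h : q = (a : ℚ) / b) :
    q.num.natAbs.size ≤ a.natAbs.size ∧ q.den.size ≤ b.natAbs.size := by
  rw [← Rat.divInt_eq_div] at h
  constructor
  · apply Nat.size_le_size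
    rcases eq_or_ne a 0 with rfl | ha
    · simp [h]
    · exact Nat.le_of_dvd (Int.natAbs_pos.2 ha) (Int.natAbs_dvd_natAbs.2 (h ▸ Rat.num_dvd a hb))
  · apply Nat.size_le_size
    have := Rat.den_dvd a b
    rw [← h] at this
    exact Nat.le_of_dvd (Int.natAbs_pos.2 hb) (Int.natCast_dvd.1 this)

theorem size_rat_add (p q : ℚ) :
    (p + q).num.natAbs.size ≤
      max (p.num.natAbs.size + q.den.size) (q.num.natAbs.size + p.den.size) + 1 ∧
    (p + q).den.size ≤ p.den.size + q.den.size := by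
  have hp : (p.den : ℚ) ≠ 0 := by simp
  have hq : (q.den : ℚ) ≠ 0 := by simp
  have h : p + q = ((p.num * q.den + q.num * p.den : ℤ) : ℚ) / ((p.den * q.den : ℤ) : ℚ) := by
    conv_lhs => rw [← Rat.num_div_den p, ← Rat.num_div_den q, div_add_div _ _ hp hq]
    push_cast
    ring
  obtain ⟨h1, h2⟩ := num_den_le_of_eq_div (by positivity) h
  refine ⟨h1.trans ?_, h2.trans ?_⟩
  · refine (Nat.size_le_size (Int.natAbs_add_le _ _)).trans ((size_add_le _ _).trans ?_)
    rw [Int.natAbs_mul, Int.natAbs_mul, Int.natAbs_natCast, Int.natAbs_natCast]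
    have := size_mul_le p.num.natAbs q.den
    have := size_mul_le q.num.natAbs p.den
    omega
  · rw [Int.natAbs_mul, Int.natAbs_natCast, Int.natAbs_natCast]
    exact size_mul_le _ _

theorem sz_rat_add (p q : ℚ) : sz (p + q) ≤ 2 * (sz p + sz q) := by
  have := size_rat_add p q
  simp only [sz_rat]
  omega

theorem sz_rat_neg (p : ℚ) : sz (-p) = sz p := by simp [sz_rat]

theorem sz_rat_mul (p q : ℚ) : sz (p * q) ≤ sz p + sz q := by
  have h : p * q = ((p.num * q.num : ℤ) : ℚ) / ((p.den * q.den : ℤ) : ℚ) := by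
    conv_lhs => rw [← Rat.num_div_den p, ← Rat.num_div_den q]
    push_cast
    rw [div_mul_div_comm]
  obtain ⟨h1, h2⟩ := num_den_le_of_eq_div (by positivity) h
  rw [Int.natAbs_mul] at h1 h2
  have := size_mul_le p.num.natAbs q.num.natAbs
  have := size_mul_le p.den q.den
  simp only [sz_rat, Int.natAbs_natCast] at *
  omega

theorem sz_rat_inv (p : ℚ) : sz p⁻¹ ≤ sz p + 1 := by
  rcases eq_or_ne p 0 with rfl | hp
  · simp
  · have h : p⁻¹ = ((p.den : ℤ) : ℚ) / ((p.num : ℤ) : ℚ) := by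
      conv_lhs => rw [← Rat.num_div_den p, inv_div]
      simp
    obtain ⟨h1, h2⟩ := num_den_le_of_eq_div (by simpa using hp) h
    simp only [sz_rat, Int.natAbs_natCast] at *
    omega

theorem sz_rat_div (p q : ℚ) : sz (p / q) ≤ sz p + sz q + 1 := by
  have := sz_rat_mul p q⁻¹
  have := sz_rat_inv q
  rw [div_eq_mul_inv]
  omega

theorem sz_floor (q : ℚ) : sz ⌊q⌋ ≤ sz q + 1 := by
  rw [sz_int, sz_rat, Rat.floor_def']
  have := Nat.size_le_size (Int.natAbs_ediv_le_natAbs q.num q.den)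
  omega

theorem sz_rat_natCast (n : ℕ) : sz (n : ℚ) = sz n := rfl

/-- The order of the rational numbers as a function. -/
def leB (p q : ℚ) : Bool := decide (p ≤ q)

/-- Equality of rational numbers as a function. -/
def eqB (p q : ℚ) : Bool := leB p q && leB q p

@[simp] theorem leB_iff {p q : ℚ} : leB p q = true ↔ p ≤ q := by simp [leB]

@[simp] theorem eqB_iff {p q : ℚ} : eqB p q = true ↔ p = q := by
  rw [eqB, Bool.and_eq_true, leB_iff, leB_iff, le_antisymm_iff]

namespace PolyTime

variable {α β γ δ : Type} [Enc α] [Enc β] [Enc γ] [Enc δ]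

@[fun_prop]
theorem add' {f g : α → ℚ} (hf : PolyTime f) (hg : PolyTime g) : PolyTime fun a => f a + g a := by
  have : PolyTime fun x : ℚ × ℚ => x.1 + x.2 :=
    of_op .add _ (fun _ => rfl) (2 * X) fun a => by
      have := sz_rat_add a.1 a.2
      simp only [eval_mul, eval_ofNat, eval_X, sz_prod]; omega
  exact this.comp' (hf.prodMk hg)

@[fun_prop]
theorem sub' {f g : α → ℚ} (hf : PolyTime f) (hg : PolyTime g) : PolyTime fun a => f a - g a := by
  have : PolyTime fun x : ℚ × ℚ => x.1 - x.2 :=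
    of_op .sub _ (fun _ => rfl) (2 * X) fun a => by
      have := sz_rat_add a.1 (-a.2)
      rw [sz_rat_neg, ← sub_eq_add_neg] at this
      simp only [eval_mul, eval_ofNat, eval_X, sz_prod]; omega
  exact this.comp' (hf.prodMk hg)

@[fun_prop]
theorem neg' {f : α → ℚ} (hf : PolyTime f) : PolyTime fun a => -f a :=
  of_eq ((const' 0).sub' hf) fun _ => zero_sub _

@[fun_prop]
theorem mul' {f g : α → ℚ} (hf : PolyTime f) (hg : PolyTime g) : PolyTime fun a => f a * g a := by
  have : PolyTime fun x : ℚ × ℚ => x.1 * x.2 :=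
    of_op .mul _ (fun _ => rfl) X fun a => by
      have := sz_rat_mul a.1 a.2
      simp only [eval_X, sz_prod]; omega
  exact this.comp' (hf.prodMk hg)

@[fun_prop]
theorem div' {f g : α → ℚ} (hf : PolyTime f) (hg : PolyTime g) : PolyTime fun a => f a / g a := by
  have : PolyTime fun x : ℚ × ℚ => x.1 / x.2 :=
    of_op .div _ (fun _ => rfl) X fun a => by
      have := sz_rat_div a.1 a.2
      simp only [eval_X, sz_prod]; omega
  exact this.comp' (hf.prodMk hg)

@[fun_prop]
theorem floor' {f : α → ℚ} (hf : PolyTime f) : PolyTime fun a => ⌊f a⌋ := by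
  have : PolyTime fun x : ℚ => ⌊x⌋ :=
    of_op .floor _ (fun _ => rfl) (X + 1) fun a => by
      have := sz_floor a
      simp only [eval_X, eval_add, eval_one]; omega
  exact this.comp' hf

@[fun_prop]
theorem leB' {f g : α → ℚ} (hf : PolyTime f) (hg : PolyTime g) :
    PolyTime fun a => leB (f a) (g a) := by
  have : PolyTime fun x : ℚ × ℚ => leB x.1 x.2 :=
    of_op .le _ (fun _ => rfl) 3 fun a => by
      simpa using sz_bool _
  exact this.comp' (hf.prodMk hg)

@[fun_prop]
theorem eqB' {f g : α → ℚ} (hf : PolyTime f) (hg : PolyTime g) :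
    PolyTime fun a => eqB (f a) (g a) := by
  unfold eqB; fun_prop

-- An integer and its rational cast have the same code, so casts cost nothing and integer arithmetic
-- is inherited from `ℚ`.
@[fun_prop]
theorem intCast' {f : α → ℤ} (hf : PolyTime f) : PolyTime fun a => (f a : ℚ) := hf

@[fun_prop]
theorem natCast' {f : α → ℕ} (hf : PolyTime f) : PolyTime fun a => (f a : ℚ) := hf

theorem of_intCast {f : α → ℤ} (hf : PolyTime fun a => (f a : ℚ)) : PolyTime f := hf

theorem of_natCast {f : α → ℕ} (hf : PolyTime fun a => (f a : ℚ)) : PolyTime f := hf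

@[fun_prop]
theorem int_add' {f g : α → ℤ} (hf : PolyTime f) (hg : PolyTime g) :
    PolyTime fun a => f a + g a :=
  of_intCast (by push_cast; fun_prop)

@[fun_prop]
theorem int_sub' {f g : α → ℤ} (hf : PolyTime f) (hg : PolyTime g) :
    PolyTime fun a => f a - g a :=
  of_intCast (by push_cast; fun_prop)

@[fun_prop]
theorem int_mul' {f g : α → ℤ} (hf : PolyTime f) (hg : PolyTime g) :
    PolyTime fun a => f a * g a :=
  of_intCast (by push_cast; fun_prop)

theorem int_div_natCast {f : α → ℤ} (hf : PolyTime f) (n : ℕ) : PolyTime fun a => f a / (n : ℤ) :=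
  of_eq (f := fun a => ⌊(f a : ℚ) / (n : ℚ)⌋) (by fun_prop)
    fun _ => Rat.floor_intCast_div_natCast _ _

theorem int_mod_natCast {f : α → ℤ} (hf : PolyTime f) (n : ℕ) : PolyTime fun a => f a % (n : ℤ) :=
  of_eq (hf.int_sub' ((const' (n : ℤ)).int_mul' (hf.int_div_natCast n)))
    fun _ => (Int.emod_def _ _).symm

@[fun_prop]
theorem nat_add' {f g : α → ℕ} (hf : PolyTime f) (hg : PolyTime g) :
    PolyTime fun a => f a + g a :=
  of_natCast (by push_cast; fun_prop)

@[fun_prop]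
theorem nat_div' {f g : α → ℕ} (hf : PolyTime f) (hg : PolyTime g) :
    PolyTime fun a => f a / g a := by
  have : PolyTime fun a => ⌊(f a : ℚ) / (g a : ℚ)⌋ := by fun_prop
  refine of_natCast (of_eq this.intCast' fun a => ?_)
  have := Rat.floor_intCast_div_natCast (f a : ℤ) (g a)
  push_cast at this
  rw [this]
  norm_cast

@[fun_prop]
theorem length' {l : δ → List α} (hl : PolyTime l) : PolyTime fun d => (l d).length := by
  have := foldl' (γ := ℕ) (step := fun _ (b : ℕ) (_ : α) => b + 1) (by fun_prop) (2 + 2 * X)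
    (fun c b l => by
      have h : ∀ (l : List α) b, l.foldl (fun (b : ℕ) _ => b + 1) b = b + l.length := by
        intro l
        induction l with
        | nil => simp
        | cons a l ih => intro b; rw [List.foldl_cons, ih, List.length_cons]; omega
      rw [h, sz_nat (b + _)]
      have h0 := sz_nat b
      have h1 := size_add_le b l.length
      have h2 := size_le_self l.length
      have h3 := length_le_sz l
      have h4 := sz_pos c
      simp only [eval_mul, eval_ofNat, eval_X, eval_add]
      omega)
    (const' 0) (const' 0) hl
  refine of_eq this fun d => ?_
  simp

/-- Iterating `sz_rat_add` would double the bound with every summand. Tracking the maximum of the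
sizes of numerator and denominator instead, each summand adds at most its own size. -/
theorem sz_foldl_add (l : List ℚ) (b : ℚ) :
    (l.foldl (· + ·) b).num.natAbs.size ≤ max b.num.natAbs.size b.den.size + sz l ∧
      (l.foldl (· + ·) b).den.size ≤ max b.num.natAbs.size b.den.size + sz l := by
  induction l generalizing b with
  | nil => simp; omega
  | cons a l ih =>
    have h1 := size_rat_add b a
    have h2 := ih (b + a)
    rw [List.foldl_cons, sz_cons]
    have h3 := sz_rat a
    omega

@[fun_prop]
theorem sum' {l : δ → List ℚ} (hl : PolyTime l) : PolyTime fun d => (l d).sum := by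
  have := foldl' (γ := ℕ) (step := fun _ (b : ℚ) a => b + a) (by fun_prop) (2 + 2 * X)
    (fun c b l => by
      have h := sz_foldl_add l b
      have h2 := sz_rat b
      rw [sz_rat]
      have h4 := sz_pos c
      simp only [eval_mul, eval_ofNat, eval_X, eval_add]
      omega)
    (const' 0) (const' 0) hl
  refine of_eq this fun d => ?_
  exact List.sum_eq_foldl.symm

end PolyTime

end Machine

/-! ### Further closure properties -/

namespace Machine

open Polynomial Enc

namespace PolyTime

variable {α β γ δ : Type} [Enc α] [Enc β] [Enc γ] [Enc δ]

@[fun_prop]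
theorem max' {f g : α → ℚ} (hf : PolyTime f) (hg : PolyTime g) :
    PolyTime fun a => max (f a) (g a) :=
  of_eq (f := fun a => bif leB (f a) (g a) then g a else f a) (by fun_prop) fun a => by
    by_cases h : f a ≤ g a
    · simp [leB, h]
    · simp [leB, h, (not_le.1 h).le]

@[fun_prop]
theorem abs' {f : α → ℚ} (hf : PolyTime f) : PolyTime fun a => |f a| :=
  of_eq (f := fun a => max (f a) (-f a)) (by fun_prop) fun _ => rfl

@[fun_prop]
theorem nat_max' {f g : α → ℕ} (hf : PolyTime f) (hg : PolyTime g) :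
    PolyTime fun a => max (f a) (g a) :=
  of_natCast (by push_cast; fun_prop)

/-- The list belongs to the program, so this is a composition of a fixed number of maps and needs no
size bound. -/
theorem foldr_const {σ : Type} (L : List σ) (step : σ → α → α) (h : ∀ s, PolyTime (step s)) :
    PolyTime (fun a => L.foldr step a) := by
  induction L with
  | nil => exact id'
  | cons s L ih => exact (h s).comp' ih

theorem map_const {σ : Type} (L : List σ) (f : σ → α → β) (h : ∀ s, PolyTime (f s)) :
    PolyTime (fun a => L.map fun s => f s a) := by
  induction L with
  | nil => exact const' []
  | cons s L ih => exact (h s).cons' ih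

/-- Folding an index-free step, together with the list of all intermediate states. -/
theorem iterates' {f : β → β} (hf : PolyTime f) (B : ℕ[X])
    (hB : ∀ n b, sz (f^[n] b) ≤ B.eval (n + sz b)) {b : δ → β} {l : δ → List α}
    (hb : PolyTime b) (hl : PolyTime l) :
    PolyTime fun d => (l d).foldl (fun (s : β × List β) _ => (f s.1, s.1 :: s.2)) (b d, []) := by
  refine foldl' (γ := ℕ) (step := fun _ (s : β × List β) _ => (f s.1, s.1 :: s.2)) (by fun_prop)
    (1 + X + B + X * (1 + B)) ?_ (const' 0) (hb.prodMk (const' [])) hl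
  rintro c ⟨b, m⟩ l
  have h : ∀ (l : List α) b m T, (∀ i ≤ l.length, sz (f^[i] b) ≤ T) →
      sz (l.foldl (fun (s : β × List β) _ => (f s.1, s.1 :: s.2)) (b, m)) ≤
        1 + T + sz m + l.length * (1 + T) := by
    intro l
    induction l with
    | nil =>
      intro b m T h
      have := h 0 (Nat.zero_le _)
      simp only [List.foldl_nil, sz_mk, Function.iterate_zero_apply] at *
      omega
    | cons a l ih =>
      intro b m T h
      have h1 := ih (f b) (b :: m) T (fun i hi => by
        rw [← Function.iterate_succ_apply]; exact h (i + 1) (by simpa using hi))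
      have h0 := h 0 (Nat.zero_le _)
      rw [Function.iterate_zero_apply] at h0
      rw [List.foldl_cons, List.length_cons, Nat.add_mul]
      rw [sz_cons] at h1
      refine h1.trans ?_
      omega
  set N := sz c + sz (b, m) + sz l with hN
  have hlN := length_le_sz l
  rw [sz_mk] at hN
  have h1 := h l b m (B.eval N) (fun i hi => (hB i b).trans (eval_mono B (by omega)))
  have h2 := Nat.mul_le_mul_right (1 + B.eval N) (show l.length ≤ N by omega)
  simp only [eval_add, eval_mul, eval_X, eval_one]
  omega

end PolyTime

end Machine

/-! ### Terminals, and rescaling by powers of `K` -/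

namespace CVRP

open Machine Polynomial Enc

/-- Index, position relative to the depot, and demand of a terminal. -/
abbrev Item := ℕ × (ℚ × ℚ) × ℚ

/-- Scale and position of the grid cell that contains a point. -/
abbrev Key := ℤ × ℤ × ℤ

/-- Cell, and class of the demand within this cell. -/
abbrev Typ := Key × ℕ

/-- A terminal with its type. -/
abbrev TItem := Typ × Item

/-- Unlike the Euclidean norm it is rational; the two agree up to a factor `2`. -/
def maxNorm (p : ℚ × ℚ) : ℚ := max |p.1| |p.2|

@[fun_prop]
theorem polyTime_maxNorm : PolyTime maxNorm := by unfold maxNorm; fun_prop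

/-- Decreasing demand, with ties broken by the index, so that terminals of equal demand also get
different ranks. -/
def before (w v : Item) : Bool :=
  !leB w.2.2 v.2.2 || (eqB w.2.2 v.2.2 && !leB v.1 w.1)

@[fun_prop]
theorem polyTime_before {α : Type} [Enc α] {f g : α → Item} (hf : PolyTime f) (hg : PolyTime g) :
    PolyTime fun a => before (f a) (g a) := by unfold before; fun_prop

def keyEq (x y : Key) : Bool := eqB x.1 y.1 && (eqB x.2.1 y.2.1 && eqB x.2.2 y.2.2)

@[fun_prop]
theorem polyTime_keyEq {α : Type} [Enc α] {f g : α → Key} (hf : PolyTime f) (hg : PolyTime g) :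
    PolyTime fun a => keyEq (f a) (g a) := by unfold keyEq; fun_prop

theorem keyEq_iff {x y : Key} : keyEq x y = true ↔ x = y := by
  rw [keyEq, Bool.and_eq_true, Bool.and_eq_true, eqB_iff, eqB_iff, eqB_iff, Prod.ext_iff,
    Prod.ext_iff]
  norm_cast

def typEq (x y : Typ) : Bool := keyEq x.1 y.1 && eqB x.2 y.2

@[fun_prop]
theorem polyTime_typEq {α : Type} [Enc α] {f g : α → Typ} (hf : PolyTime f) (hg : PolyTime g) :
    PolyTime fun a => typEq (f a) (g a) := by unfold typEq; fun_prop

theorem typEq_iff {x y : Typ} : typEq x y = true ↔ x = y := by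
  rw [typEq, Bool.and_eq_true, keyEq_iff, eqB_iff, Nat.cast_inj]
  exact Prod.ext_iff.symm

/-- The terminals with their indices, starting with `1`, in reverse order. -/
def enum {α : Type} (l : List α) : List (ℕ × α) :=
  l.foldl (fun acc x => (acc.length + 1, x) :: acc) []

/-- The index that is written depends on the accumulator, so `foldl_add` does not apply; indices are
bounded through the length of the list. -/
theorem polyTime_enum {α : Type} [Enc α] : PolyTime (enum : List α → List (ℕ × α)) := by
  refine PolyTime.foldl' (γ := ℕ) (step := fun _ (acc : List (ℕ × α)) x => (acc.length + 1, x) :: acc)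
    (by fun_prop) (5 * X + 2 * X * X) ?_ (PolyTime.const' 0) (PolyTime.const' []) PolyTime.id'
  intro c b l
  have h : ∀ (l : List α) (b : List (ℕ × α)) T, b.length + l.length ≤ T →
      sz (l.foldl (fun acc x => (acc.length + 1, x) :: acc) b) ≤
        sz b + sz l + l.length * (4 + T) := by
    intro l
    induction l with
    | nil => intro b T _; simp
    | cons a l ih =>
      intro b T h
      rw [List.length_cons] at h
      have h1 := ih ((b.length + 1, a) :: b) T (by rw [List.length_cons]; omega)
      have h2 := size_le_self (b.length + 1)
      rw [List.foldl_cons, List.length_cons, Nat.add_mul, sz_cons]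
      rw [sz_cons, sz_mk, sz_nat] at h1
      omega
  set N := sz c + sz b + sz l with hN
  have hlN := length_le_sz l
  have hbN := length_le_sz b
  have h1 := h l b (2 * N) (by omega)
  have h2 := Nat.mul_le_mul_right (4 + 2 * N) (show l.length ≤ N by omega)
  have h3 : N * (4 + 2 * N) = 4 * N + 2 * N * N := by ring
  simp only [eval_add, eval_mul, eval_X, eval_ofNat]
  omega

/-- Division and multiplication by `K` bring a point towards the annulus `1 ≤ |p| < K`. -/
def rescaleStep (K : ℕ) (s : ℤ × ℚ × ℚ) : ℤ × ℚ × ℚ :=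
  bif leB K (maxNorm s.2) then (s.1 + 1, s.2.1 / K, s.2.2 / K)
  else (s.1 - 1, s.2.1 * K, s.2.2 * K)

/-- The zero vector would never reach the annulus and is excluded from the loop. -/
def rescaleCond (K : ℕ) (s : ℤ × ℚ × ℚ) : Bool :=
  !leB (maxNorm s.2) 0 && (leB K (maxNorm s.2) || !leB 1 (maxNorm s.2))

/-- Each step moves the logarithm by one towards `0`. As `Int.log K 0 = 0`, a terminal at the depot
is left alone. -/
def rescaleCount (K : ℕ) (s : ℤ × ℚ × ℚ) : ℕ := (Int.log K (maxNorm s.2)).natAbs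

def rescale (K : ℕ) (s : ℤ × ℚ × ℚ) : ℤ × ℚ × ℚ := (rescaleStep K)^[rescaleCount K s] s

theorem maxNorm_nonneg (p : ℚ × ℚ) : 0 ≤ maxNorm p := le_max_of_le_left (abs_nonneg _)

theorem maxNorm_mul (p : ℚ × ℚ) {c : ℚ} (hc : 0 ≤ c) : maxNorm (p.1 * c, p.2 * c) = maxNorm p * c := by
  simp only [maxNorm, abs_mul, abs_of_nonneg hc]
  exact (max_mul_of_nonneg _ _ hc).symm

theorem maxNorm_div (p : ℚ × ℚ) {c : ℚ} (hc : 0 ≤ c) : maxNorm (p.1 / c, p.2 / c) = maxNorm p / c := by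
  simpa [div_eq_mul_inv] using maxNorm_mul p (inv_nonneg.2 hc)

theorem log_mul_base {K : ℕ} (hK : 1 < K) {m : ℚ} (hm : 0 < m) :
    Int.log K (m * K) = Int.log K m + 1 := by
  have hK0 : (0 : ℚ) < K := by positivity
  refine eq_of_forall_le_iff fun x => ?_
  rw [← Int.zpow_le_iff_le_log hK (by positivity), ← sub_le_iff_le_add,
    ← Int.zpow_le_iff_le_log hK hm, zpow_sub_one₀ hK0.ne', ← div_eq_mul_inv, div_le_iff₀ hK0]

theorem log_div_base {K : ℕ} (hK : 1 < K) {m : ℚ} (hm : 0 < m) :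
    Int.log K (m / K) = Int.log K m - 1 := by
  have hK0 : (0 : ℚ) < K := by positivity
  have := log_mul_base hK (div_pos hm hK0)
  rw [div_mul_cancel₀ _ hK0.ne'] at this
  omega

theorem maxNorm_rescaleStep {K : ℕ} (s : ℤ × ℚ × ℚ) :
    maxNorm (rescaleStep K s).2 = bif leB K (maxNorm s.2) then maxNorm s.2 / K
      else maxNorm s.2 * K := by
  unfold rescaleStep
  cases leB K (maxNorm s.2)
  · exact maxNorm_mul _ (Nat.cast_nonneg K)
  · exact maxNorm_div _ (Nat.cast_nonneg K)

theorem rescaleCond_iff {K : ℕ} (hK : 1 < K) (s : ℤ × ℚ × ℚ) :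
    rescaleCond K s = true ↔ 0 < rescaleCount K s := by
  rw [rescaleCount, Int.natAbs_pos, rescaleCond]
  simp only [Bool.and_eq_true, Bool.or_eq_true, Bool.not_eq_true', ← Bool.not_eq_true, leB_iff,
    not_le]
  rcases (maxNorm_nonneg s.2).eq_or_lt with h | h
  · simp [← h]
  · have h1 := Int.zpow_le_iff_le_log (x := 1) hK h
    have h2 := Int.lt_zpow_iff_log_lt (x := 0) hK h
    simp only [zpow_one, zpow_zero] at h1 h2
    simp only [h, true_and, h1, h2]
    omega

theorem rescaleCount_rescaleStep {K : ℕ} (hK : 1 < K) {s : ℤ × ℚ × ℚ} (hs : 0 < rescaleCount K s) :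
    rescaleCount K (rescaleStep K s) + 1 = rescaleCount K s := by
  have hc := (rescaleCond_iff hK s).2 hs
  rw [rescaleCond] at hc
  simp only [Bool.and_eq_true, Bool.or_eq_true, Bool.not_eq_true', ← Bool.not_eq_true, leB_iff,
    not_le] at hc
  obtain ⟨h0, h⟩ := hc
  unfold rescaleCount at *
  rw [maxNorm_rescaleStep]
  by_cases hle : (K : ℚ) ≤ maxNorm s.2
  · rw [leB_iff.2 hle, cond_true, log_div_base hK h0]
    have := (Int.zpow_le_iff_le_log (x := 1) hK h0).1 (by simpa using hle)
    omega
  · rw [Bool.eq_false_iff.2 (mt leB_iff.1 hle), cond_false, log_mul_base hK h0]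
    have := (Int.lt_zpow_iff_log_lt (x := 0) hK h0).1 (by simpa using h.resolve_left hle)
    omega

theorem rescaleCount_iterate {K : ℕ} (hK : 1 < K) (s : ℤ × ℚ × ℚ) {i : ℕ} (hi : i ≤ rescaleCount K s) :
    rescaleCount K ((rescaleStep K)^[i] s) + i = rescaleCount K s := by
  induction i with
  | zero => rfl
  | succ i ih =>
    have h := ih (by omega)
    rw [Function.iterate_succ_apply']
    have := rescaleCount_rescaleStep hK (s := (rescaleStep K)^[i] s) (by omega)
    omega

/-- Numerator and denominator lie below `2` to their bit sizes, and `2 ≤ K`. Hence the rescaling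
loop is short even for coordinates of exponential magnitude. -/
theorem log_le_size {K : ℕ} (hK : 1 < K) {q : ℚ} (hq : 0 ≤ q) : (Int.log K q).natAbs ≤ sz q := by
  rcases hq.eq_or_lt with rfl | hq
  · simp
  have hK' : (2 : ℚ) ≤ K := by exact_mod_cast hK
  have hn : (q.num.natAbs : ℚ) = q.num := by
    rw [← Int.cast_natCast, Int.natCast_natAbs, abs_of_nonneg (Rat.num_nonneg.2 hq.le)]
  have hq' := Rat.num_div_den q
  have hd : (1 : ℚ) ≤ q.den := by exact_mod_cast q.den_pos
  have hd0 : (0 : ℚ) < q.den := by linarith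
  have hn1 : (1 : ℚ) ≤ q.num := by exact_mod_cast Rat.num_pos.2 hq
  have pow_le : ∀ n : ℕ, (n : ℚ) < (K : ℚ) ^ n.size := fun n => by
    calc (n : ℚ) < (2 : ℚ) ^ n.size := by exact_mod_cast Nat.lt_size_self n
      _ ≤ (K : ℚ) ^ n.size := by gcongr
  have h1 : Int.log K q < (q.num.natAbs.size : ℤ) := by
    rw [← Int.lt_zpow_iff_log_lt hK hq, zpow_natCast]
    refine lt_of_le_of_lt ?_ (pow_le _)
    rw [hn, ← hq']
    refine (div_le_self (by linarith) hd).trans (le_of_eq ?_)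
    rw [hq']
  have h2 : -(q.den.size : ℤ) ≤ Int.log K q := by
    rw [← Int.zpow_le_iff_le_log hK hq, zpow_neg, zpow_natCast]
    calc ((K : ℚ) ^ q.den.size)⁻¹ ≤ (q.den : ℚ)⁻¹ := inv_anti₀ hd0 (pow_le _).le
      _ ≤ q.num / q.den := by rw [inv_eq_one_div]; gcongr
      _ = q := hq'
  rw [sz_rat]
  omega

theorem rescaleCount_le {K : ℕ} (hK : 1 < K) (s : ℤ × ℚ × ℚ) : rescaleCount K s ≤ sz s := by
  have habs : ∀ q : ℚ, sz |q| = sz q := fun q => by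
    rcases abs_choice q with h | h <;> rw [h]
    exact sz_rat_neg q
  have h := log_le_size hK (maxNorm_nonneg s.2)
  unfold rescaleCount
  have h1 : sz (maxNorm s.2) ≤ sz s := by
    rw [maxNorm, sz_prod, sz_prod]
    rcases max_choice |s.2.1| |s.2.2| with h | h <;> rw [h, habs] <;> omega
  omega

theorem sz_int_add_one (z : ℤ) : sz (z + 1) ≤ sz z + 1 := by
  rw [sz_int, sz_int]
  have h1 := Nat.size_le_size (Int.natAbs_add_le z 1)
  have h2 : (z.natAbs + 1).size ≤ z.natAbs.size + 1 := by
    rw [Nat.size_le, pow_succ]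
    have := Nat.lt_size_self z.natAbs
    have := Nat.one_le_two_pow (n := z.natAbs.size)
    omega
  simp only [Int.natAbs_one] at h1
  omega

theorem sz_int_neg (z : ℤ) : sz (-z) = sz z := by simp [sz_int]

theorem sz_int_sub_one (z : ℤ) : sz (z - 1) ≤ sz z + 1 := by
  have := sz_int_add_one (-z)
  rwa [show -z + 1 = -(z - 1) by ring, sz_int_neg, sz_int_neg] at this

/-- The growth is additive, so polynomially many steps keep the state polynomial. -/
theorem sz_rescaleStep (K : ℕ) (s : ℤ × ℚ × ℚ) : sz (rescaleStep K s) ≤ sz s + (2 * sz K + 3) := by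
  unfold rescaleStep
  have h1 := sz_int_add_one s.1
  have h2 := sz_int_sub_one s.1
  have h3 := sz_rat_div s.2.1 K
  have h4 := sz_rat_div s.2.2 K
  have h5 := sz_rat_mul s.2.1 K
  have h6 := sz_rat_mul s.2.2 K
  rw [sz_rat_natCast] at h3 h4 h5 h6
  cases leB K (maxNorm s.2) <;> simp only [cond_true, cond_false, sz_prod] <;> omega

theorem polyTime_rescale {K : ℕ} (hK : 1 < K) : PolyTime (rescale K) := by
  have hc : PolyTime (rescaleCond K) := by unfold rescaleCond; fun_prop
  have hf : PolyTime (rescaleStep K) := by unfold rescaleStep; fun_prop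
  refine PolyTime.while' hc hf (rescaleCount K) X (X + X * C (2 * sz K + 3)) ?_ ?_ ?_ ?_
  · intro s
    simpa using rescaleCount_le hK s
  · intro s i hi
    have h1 := rescaleCount_le hK s
    have h2 : ∀ i, sz ((rescaleStep K)^[i] s) ≤ sz s + i * (2 * sz K + 3) := by
      intro i
      induction i with
      | zero => simp
      | succ i ih =>
        rw [Function.iterate_succ_apply', Nat.add_mul]
        have := sz_rescaleStep K ((rescaleStep K)^[i] s)
        omega
    refine (h2 i).trans ?_
    simp only [eval_add, eval_mul, eval_X, eval_C]
    gcongr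
    exact hi.trans h1
  · intro s i hi
    rw [rescaleCond_iff hK]
    have := rescaleCount_iterate hK s hi.le
    omega
  · intro s
    rw [← Bool.not_eq_true, rescaleCond_iff hK]
    have := rescaleCount_iterate hK s le_rfl
    omega

/-- Each step preserves the product of the vector with `K` to the power of the scale, and the
remaining count drops to `0`, which means that the logarithm of the norm is `0`. -/
theorem rescale_spec {K : ℕ} (hK : 1 < K) (p : ℚ × ℚ) :
    p.1 = (rescale K (0, p)).2.1 * (K : ℚ) ^ (rescale K (0, p)).1 ∧
    p.2 = (rescale K (0, p)).2.2 * (K : ℚ) ^ (rescale K (0, p)).1 ∧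
    (maxNorm p ≠ 0 → 1 ≤ maxNorm (rescale K (0, p)).2 ∧ maxNorm (rescale K (0, p)).2 < K) := by
  have hK0 : (K : ℚ) ≠ 0 := by positivity
  have h : ∀ i, p.1 = ((rescaleStep K)^[i] (0, p)).2.1 * (K : ℚ) ^ ((rescaleStep K)^[i] (0, p)).1 ∧
      p.2 = ((rescaleStep K)^[i] (0, p)).2.2 * (K : ℚ) ^ ((rescaleStep K)^[i] (0, p)).1 := by
    intro i
    induction i with
    | zero => simp
    | succ i ih =>
      rw [Function.iterate_succ_apply']
      generalize (rescaleStep K)^[i] (0, p) = s at *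
      unfold rescaleStep
      cases leB K (maxNorm s.2) <;> simp only [cond_true, cond_false]
      · rw [zpow_sub_one₀ hK0, mul_assoc, mul_assoc, mul_left_comm (K : ℚ), mul_inv_cancel₀ hK0,
          mul_one]
        exact ih
      · rw [zpow_add_one₀ hK0, div_mul_eq_mul_div, div_mul_eq_mul_div, ← mul_assoc, ← mul_assoc,
          mul_div_cancel_right₀ _ hK0, mul_div_cancel_right₀ _ hK0]
        exact ih
  refine ⟨(h _).1, (h _).2, fun hp => ?_⟩
  have h1 := rescaleCount_iterate hK (0, p) le_rfl
  rw [← rescale] at h1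
  have h2 : rescaleCount K (rescale K (0, p)) = 0 := by omega
  rw [rescaleCount, Int.natAbs_eq_zero] at h2
  have h3 : 0 < maxNorm (rescale K (0, p)).2 := by
    refine (maxNorm_nonneg _).lt_of_ne' fun h0 => hp ?_
    have h4 : maxNorm p = maxNorm (rescale K (0, p)).2 * (K : ℚ) ^ (rescale K (0, p)).1 := by
      rw [← maxNorm_mul _ (by positivity), rescale, ← (h _).1, ← (h _).2]
    rw [h4, h0, zero_mul]
  have h5 := (Int.zpow_le_iff_le_log (x := 0) hK h3).2 h2.ge
  have h6 := (Int.lt_zpow_iff_log_lt (x := 1) hK h3).2 (by omega)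
  simpa using And.intro h5 h6

end CVRP

/-! ### The algorithm and its running time -/

namespace CVRP

open Machine Polynomial Enc

/-- The cell of a point: its scale and the position in a grid that is fine at this scale. -/
def keyOf (K : ℕ) (p : ℚ × ℚ) : Key :=
  ((rescale K (0, p)).1, ⌊(rescale K (0, p)).2.1 * K⌋, ⌊(rescale K (0, p)).2.2 * K⌋)

theorem polyTime_keyOf {K : ℕ} (hK : 1 < K) : PolyTime (keyOf K) := by
  have := polyTime_rescale hK
  unfold keyOf; fun_prop

/-- The terminals of an instance with their positions relative to the depot. -/
def items (x : (ℚ × ℚ) × List ((ℚ × ℚ) × ℚ)) : List Item :=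
  (enum x.2).map fun e => (e.1, (e.2.1.1 - x.1.1, e.2.1.2 - x.1.2), e.2.2)

theorem polyTime_items : PolyTime items := by
  have := polyTime_enum (α := (ℚ × ℚ) × ℚ)
  unfold items; fun_prop

/-- The number of terminals that come before `v` in its cell. -/
def rank (L : List (Key × Item)) (v : Key × Item) : ℕ :=
  (L.filter fun w => keyEq w.1 v.1 && before w.2 v.2).length

/-- The size of the demand classes in the cell `κ`, unless it is `0`. -/
def classSize (K : ℕ) (L : List (Key × Item)) (κ : Key) : ℕ :=
  (L.filter fun w => keyEq w.1 κ).length / K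

/-- A cell with fewer than `K` terminals has class size `0`; the maximum with `1` then makes every
terminal a class of its own. -/
def classify (K : ℕ) (l : List Item) : List TItem :=
  (l.map fun v => (keyOf K v.2.1, v)).map fun v =>
    ((v.1, rank (l.map fun v => (keyOf K v.2.1, v)) v /
      max (classSize K (l.map fun v => (keyOf K v.2.1, v)) v.1) 1), v.2)

theorem polyTime_classify {K : ℕ} (hK : 1 < K) : PolyTime (classify K) := by
  have := polyTime_keyOf hK
  unfold classify rank classSize; fun_prop

/-- The type of a terminal relative to the block of scales that contains it. -/
def relType (K a : ℕ) (v : TItem) : Typ := (((v.1.1.1 - a) % K, v.1.1.2), v.1.2)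

/-- The block of scales that contains a terminal. -/
def blockOf (K a : ℕ) (v : TItem) : ℤ := (v.1.1.1 - a) / K

theorem polyTime_relType (K a : ℕ) : PolyTime (relType K a) := by
  have : PolyTime fun v : TItem => (v.1.1.1 - (a : ℤ)) % (K : ℤ) :=
    PolyTime.int_mod_natCast (by fun_prop) K
  unfold relType; fun_prop

theorem polyTime_blockOf (K a : ℕ) : PolyTime (blockOf K a) :=
  PolyTime.int_div_natCast (by fun_prop) K

section Enumeration

variable {β : Type} (ty : β → Typ)

/-- Move an element of type `τ` from the first list to the second. -/
def popStep (τ : Typ) (s : List β × List β) : List β × List β :=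
  match s.1.filter fun v => typEq (ty v) τ with
  | [] => s
  | v :: vs => (vs ++ s.1.filter fun v => !typEq (ty v) τ, v :: s.2)

/-- Remove elements with the types given by a configuration. -/
def takeTour (c : List Typ) (rem : List β) : List β × List β :=
  c.foldr (popStep ty) (rem, [])

/-- Remove one tour and put it into the list of tours. -/
def addTour (c : List Typ) (s : List β × List (List β)) : List β × List (List β) :=
  ((takeTour ty c s.1).1, (takeTour ty c s.1).2 :: s.2)

/-- The states that result from adding at most `l.length` tours with configuration `c`. -/
def addTours (c : List Typ) (l : List β) (s : List β × List (List β)) :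
    List (List β × List (List β)) :=
  let r := l.foldl (fun (r : (List β × List (List β)) × List (List β × List (List β))) _ =>
    (addTour ty c r.1, r.1 :: r.2)) (s, [])
  r.1 :: r.2

/-- All ways to choose tours with the configurations in `Cs`. -/
def states (Cs : List (List Typ)) (l : List β) : List (List β × List (List β)) :=
  (Cs.foldl (fun (s : List β × List (List β × List (List β))) c =>
    (s.1, s.2.flatMap (addTours ty c s.1))) (l, [(l, [])])).2

variable {ty}

theorem polyTime_popStep [Enc β] (hty : PolyTime ty) (τ : Typ) : PolyTime (popStep ty τ) := by
  have : PolyTime fun x : (List β × List β) × List β =>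
      match x.2 with
      | [] => x.1
      | v :: vs => (vs ++ x.1.1.filter fun v => !typEq (ty v) τ, v :: x.1.2) :=
    PolyTime.listCases (f := fun s => s) (g := fun y : (List β × List β) × β × List β =>
      (y.2.2 ++ y.1.1.filter fun v => !typEq (ty v) τ, y.2.1 :: y.1.2)) (by fun_prop)
      (by fun_prop) (fun _ => rfl) (fun _ _ _ => rfl)
  exact this.comp' (f := fun s : List β × List β => (s, s.1.filter fun v => typEq (ty v) τ))
    (by fun_prop)

theorem polyTime_takeTour [Enc β] (hty : PolyTime ty) (c : List Typ) : PolyTime (takeTour ty c) := by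
  have := PolyTime.foldr_const c (popStep ty) (polyTime_popStep hty)
  unfold takeTour; fun_prop

theorem polyTime_addTour [Enc β] (hty : PolyTime ty) (c : List Typ) : PolyTime (addTour ty c) := by
  have := polyTime_takeTour hty c
  unfold addTour; fun_prop

theorem popStep_perm (τ : Typ) (s : List β × List β) :
    ((popStep ty τ s).2 ++ (popStep ty τ s).1).Perm (s.2 ++ s.1) := by
  have h := List.filter_append_perm (fun v => typEq (ty v) τ) s.1
  unfold popStep
  cases hf : s.1.filter fun v => typEq (ty v) τ with
  | nil => exact .refl _
  | cons v vs =>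
    rw [hf] at h
    refine .trans ?_ (h.append_left s.2)
    simp only [List.cons_append]
    exact List.perm_middle.symm

theorem takeTour_perm (c : List Typ) (rem : List β) :
    ((takeTour ty c rem).2 ++ (takeTour ty c rem).1).Perm rem := by
  induction c with
  | nil => exact .refl _
  | cons τ c ih => exact (popStep_perm τ _).trans ih

theorem sz_takeTour_le [Enc β] (c : List Typ) (rem : List β) : sz (takeTour ty c rem).1 ≤ sz rem := by
  have h1 := sz_perm (takeTour_perm (ty := ty) c rem)
  have h2 := sz_append (takeTour ty c rem).2 (takeTour ty c rem).1
  have h3 := sz_list (takeTour ty c rem).2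
  omega

/-- Tours only remove elements from the remainder. So the remainder never grows, and every new tour
obeys the size bound evaluated at the initial one. -/
theorem polyTime_addTours [Enc β] (hty : PolyTime ty) (c : List Typ) :
    PolyTime fun x : List β × (List β × List (List β)) => addTours ty c x.1 x.2 := by
  have h := polyTime_addTour hty c
  obtain ⟨p, hp⟩ := (polyTime_takeTour hty c).exists_sz_le
  have h1 : ∀ n (s : List β × List (List β)), sz ((addTour ty c)^[n] s).1 ≤ sz s.1 ∧
      sz ((addTour ty c)^[n] s) ≤ sz s + n * (1 + p.eval (sz s.1)) := by
    intro n s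
    induction n with
    | zero => simp
    | succ n ih =>
      rw [Function.iterate_succ_apply', Nat.add_mul]
      generalize (addTour ty c)^[n] s = r at *
      have h2 := hp r.1
      have h3 := sz_takeTour_le (ty := ty) c r.1
      have h4 := eval_mono p ih.1
      simp only [sz_prod] at h2
      simp only [addTour, sz_prod, sz_cons] at *
      omega
  have := PolyTime.iterates' h (X + X * (1 + p)) (fun n s => by
    have h2 := (h1 n s).2
    have h3 := eval_mono p (show sz s.1 ≤ n + sz s by rw [sz_prod]; omega)
    have h4 := Nat.mul_le_mul (show n ≤ n + sz s by omega) (Nat.add_le_add_left h3 1)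
    simp only [eval_add, eval_mul, eval_X, eval_one]
    omega) (b := fun x : List β × (List β × List (List β)) => x.2) (l := fun x => x.1)
    (by fun_prop) (by fun_prop)
  unfold addTours
  fun_prop

/-- The list `Cs` is part of the program, so this is a fixed number of polynomial stages; each
multiplies the number of states by at most the number of elements plus one. -/
theorem polyTime_states [Enc β] (hty : PolyTime ty) (Cs : List (List Typ)) :
    PolyTime fun l : List β => states ty Cs l := by
  have := PolyTime.foldl_const Cs (fun c (s : List β × List (List β × List (List β))) =>
    (s.1, s.2.flatMap (addTours ty c s.1))) (fun c => by
      have := polyTime_addTours hty c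
      fun_prop)
  unfold states
  fun_prop

end Enumeration

section Cost

/-- An approximation of the length of a vector from above, by Newton's method. -/
def approxNorm (K : ℕ) (p : ℚ × ℚ) : ℚ :=
  ((fun x : ℚ × ℚ => (x.1, (x.2 + x.1 / x.2) / 2))^[K]
    (p.1 * p.1 + p.2 * p.2, |p.1| + |p.2|)).2

theorem polyTime_approxNorm (K : ℕ) : PolyTime (approxNorm K) := by
  have := PolyTime.iterate_const (fun x : ℚ × ℚ => (x.1, (x.2 + x.1 / x.2) / 2)) (by fun_prop) K
  unfold approxNorm; fun_prop

/-- The approximate lengths of the segments of a path from `p` through the points of a list. -/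
def legs (K : ℕ) (p : ℚ × ℚ) (l : List (ℚ × ℚ)) : List ℚ :=
  (l.foldl (fun (s : (ℚ × ℚ) × List ℚ) q =>
    (q, approxNorm K (q.1 - s.1.1, q.2 - s.1.2) :: s.2)) (p, [])).2

theorem polyTime_legs (K : ℕ) (p : ℚ × ℚ) : PolyTime (legs K p) := by
  have h := polyTime_approxNorm K
  let f : (ℚ × ℚ) × (ℚ × ℚ) → ℚ := fun x => approxNorm K (x.2.1 - x.1.1, x.2.2 - x.1.2)
  have hf : PolyTime f := by fun_prop
  obtain ⟨B, hB⟩ := hf.exists_sz_le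
  have := PolyTime.foldl' (γ := ℕ) (step := fun _ (s : (ℚ × ℚ) × List ℚ) (q : ℚ × ℚ) =>
    (q, f (s.1, q) :: s.2)) (by fun_prop) (1 + 2 * X + X * (1 + B.comp (1 + 2 * X))) (by
      rintro c ⟨p, m⟩ l
      have h : ∀ (l : List (ℚ × ℚ)) (p : ℚ × ℚ) (m : List ℚ) T, sz p ≤ T → sz l ≤ T →
          sz (l.foldl (fun (s : (ℚ × ℚ) × List ℚ) (q : ℚ × ℚ) => (q, f (s.1, q) :: s.2)) (p, m)) ≤
            1 + T + sz m + l.length * (1 + B.eval (1 + 2 * T)) := by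
        intro l
        induction l with
        | nil => intro p m T hp _; simp only [List.foldl_nil, sz_mk]; omega
        | cons q l ih =>
          intro p m T hp hl
          rw [sz_cons] at hl
          have h1 := ih q (f (p, q) :: m) T (by omega) (by omega)
          have h2 := hB (p, q)
          have h3 := eval_mono B (show sz (p, q) ≤ 1 + 2 * T by rw [sz_mk]; omega)
          rw [List.foldl_cons, List.length_cons, Nat.add_mul]
          rw [sz_cons] at h1
          refine h1.trans ?_
          omega
      set N := sz c + sz (p, m) + sz l with hN
      rw [sz_mk] at hN
      have h1 := h l p m N (by omega) (by omega)
      have h2 := length_le_sz l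
      have h3 := Nat.mul_le_mul_right (1 + B.eval (1 + 2 * N)) (show l.length ≤ N by omega)
      simp only [eval_add, eval_mul, eval_X, eval_one, eval_comp, eval_ofNat]
      omega)
    (PolyTime.const' 0) (PolyTime.const' (p, [])) PolyTime.id'
  exact PolyTime.snd'.comp' this

/-- The approximate cost of a collection of tours. -/
def approxCost (K : ℕ) (S : List (List TItem)) : ℚ :=
  (S.flatMap fun t => legs K (0, 0) (t.map (fun v => v.2.2.1) ++ [(0, 0)])).sum

theorem polyTime_approxCost (K : ℕ) : PolyTime (approxCost K) := by
  have := polyTime_legs K (0, 0)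
  unfold approxCost; fun_prop

/-- A collection of tours of least approximate cost. -/
def best (K : ℕ) (S : List (List TItem)) (L : List (List (List TItem))) : List (List TItem) :=
  L.foldl (fun S T => bif leB (approxCost K S) (approxCost K T) then S else T) S

theorem best_mem (K : ℕ) (S : List (List TItem)) (L : List (List (List TItem))) :
    best K S L = S ∨ best K S L ∈ L := by
  induction L generalizing S with
  | nil => exact .inl rfl
  | cons T L ih =>
    rcases ih (bif leB (approxCost K S) (approxCost K T) then S else T) with h | h
    · have h' : best K S (T :: L) = _ := h
      rw [h']
      cases leB (approxCost K S) (approxCost K T) <;> simp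
    · exact .inr (List.mem_cons_of_mem _ h)

theorem approxCost_best_le (K : ℕ) (S : List (List TItem)) (L : List (List (List TItem))) :
    approxCost K (best K S L) ≤ approxCost K S ∧
      ∀ T ∈ L, approxCost K (best K S L) ≤ approxCost K T := by
  induction L generalizing S with
  | nil => exact ⟨le_rfl, by simp⟩
  | cons T L ih =>
    have h := ih (bif leB (approxCost K S) (approxCost K T) then S else T)
    have h' : best K S (T :: L) =
      best K (bif leB (approxCost K S) (approxCost K T) then S else T) L := rfl
    rw [h', List.forall_mem_cons]
    by_cases hle : approxCost K S ≤ approxCost K T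
    · rw [leB_iff.2 hle, cond_true] at h ⊢
      exact ⟨h.1, h.1.trans hle, h.2⟩
    · rw [Bool.eq_false_iff.2 (mt leB_iff.1 hle), cond_false] at h ⊢
      exact ⟨h.1.trans (not_le.1 hle).le, h.1, h.2⟩

/-- The accumulator is always one of the given candidates, which bounds its size. -/
theorem polyTime_best {α : Type} [Enc α] (K : ℕ) {S : α → List (List TItem)}
    {L : α → List (List (List TItem))} (hS : PolyTime S) (hL : PolyTime L) :
    PolyTime fun a => best K (S a) (L a) := by
  have := polyTime_approxCost K
  refine PolyTime.foldl' (γ := ℕ) (step := fun _ S T =>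
    bif leB (approxCost K S) (approxCost K T) then S else T) (by fun_prop) X ?_
    (PolyTime.const' 0) hS hL
  intro c S L
  rw [eval_X]
  rcases best_mem K S L with h | h
  · rw [← best, h]; omega
  · rw [← best]
    have := sz_le_of_mem h
    omega

end Cost

/-- Split a tour that exceeds the capacity. -/
def splitTour (t : List TItem) : List (List TItem) :=
  bif leB (t.map fun v => v.2.2.2).sum 1 then [t] else t.map fun v => [v]

/-- Complete a partial solution by tours with one terminal. -/
def finish (s : List TItem × List (List TItem)) : List (List TItem) :=
  s.2.flatMap splitTour ++ s.1.map fun v => [v]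

theorem polyTime_finish : PolyTime finish := by unfold finish splitTour; fun_prop

/-- Approximate solution for terminals in one block of scales. -/
def solveBlock (K a : ℕ) (Cs : List (List Typ)) (l : List TItem) : List (List TItem) :=
  best K (l.map fun v => [v]) ((states (relType K a) Cs l).map finish)

theorem polyTime_solveBlock (K a : ℕ) (Cs : List (List Typ)) : PolyTime (solveBlock K a Cs) := by
  have := polyTime_finish
  have := polyTime_states (polyTime_relType K a) Cs
  exact polyTime_best K (by fun_prop) (by fun_prop)

/-- The distinct elements of a list. -/
def distinct (l : List ℤ) : List ℤ :=
  l.foldl (fun b (z : ℤ) => bif leB (b.filter fun y : ℤ => eqB y z).length 0 then z :: b else b) []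

theorem polyTime_distinct : PolyTime distinct :=
  PolyTime.foldl_add (γ := ℕ) (step := fun _ (b : List ℤ) (z : ℤ) =>
    bif leB (b.filter fun y : ℤ => eqB y z).length 0 then z :: b else b) (by fun_prop) (1 + X)
    (fun c b z => by
      simp only [eval_add, eval_X, eval_one]
      cases leB (b.filter fun y : ℤ => eqB y z).length 0 <;>
        simp only [cond_true, cond_false, sz_cons] <;> omega)
    (PolyTime.const' 0) (PolyTime.const' []) PolyTime.id'

/-- Whether the scale of a terminal separates blocks. -/
def separates (K a : ℕ) (v : TItem) : Bool := eqB (relType K a v).1.1 0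

theorem polyTime_separates (K a : ℕ) : PolyTime (separates K a) := by
  have : PolyTime fun v : TItem => (v.1.1.1 - (a : ℤ)) % (K : ℤ) :=
    PolyTime.int_mod_natCast (by fun_prop) K
  exact PolyTime.eqB' this.intCast' (PolyTime.const' 0)

/-- Serve the terminals at the separating scales by tours of their own, and solve the blocks. -/
def solveShift (K a : ℕ) (Cs : List (List Typ)) (l : List TItem) : List (List TItem) :=
  ((l.filter fun v => separates K a v).map fun v => [v]) ++
    (distinct ((l.filter fun v => !separates K a v).map (blockOf K a))).flatMap fun g : ℤ =>
      solveBlock K a Cs (l.filter fun v => !separates K a v && eqB (blockOf K a v) g)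

theorem polyTime_solveShift (K a : ℕ) (Cs : List (List Typ)) : PolyTime (solveShift K a Cs) := by
  have := polyTime_distinct
  have := polyTime_blockOf K a
  have := polyTime_separates K a
  have := polyTime_solveBlock K a Cs
  unfold solveShift
  fun_prop

def solve (K : ℕ) (Cs : List (List Typ)) (l : List TItem) : List (List TItem) :=
  best K (l.map fun v => [v]) ((List.range K).map fun a => solveShift K a Cs l)

theorem polyTime_solve (K : ℕ) (Cs : List (List Typ)) : PolyTime (solve K Cs) :=
  polyTime_best K (by fun_prop)
    (PolyTime.map_const _ (fun a l => solveShift K a Cs l) fun a => polyTime_solveShift K a Cs)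

/-- The algorithm: each tour visits exactly the terminals that it covers. -/
def algorithm (K : ℕ) (Cs : List (List Typ)) (x : (ℚ × ℚ) × List ((ℚ × ℚ) × ℚ)) :
    List (List ℕ × List ℕ) :=
  (solve K Cs (classify K (items x))).map fun t => (t.map fun v => v.2.1, t.map fun v => v.2.1)

theorem polyTime_algorithm {K : ℕ} (hK : 1 < K) (Cs : List (List Typ)) :
    PolyTime (algorithm K Cs) := by
  have := polyTime_solve K Cs
  have := polyTime_classify hK
  have := polyTime_items
  unfold algorithm
  fun_prop

end CVRP

/-! ### Walks under shortcuts and replacement of stops -/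

namespace CVRP

section Walk

variable {E : Type*} [MetricSpace E]

/-- The length of the walk from `x` to `z` through the points of `l`. -/
noncomputable def walk (x : E) (l : List E) (z : E) : ℝ := pathLength (x :: (l ++ [z]))

theorem walk_nil (x z : E) : walk x [] z = dist x z := by simp [walk, pathLength]

theorem walk_cons (x a : E) (l : List E) (z : E) :
    walk x (a :: l) z = dist x a + walk a l z := rfl

theorem walk_le_dist_add (x y : E) (l : List E) (z : E) : walk x l z ≤ dist x y + walk y l z := by
  cases l with
  | nil => simpa [walk_nil] using dist_triangle x y z
  | cons a l =>
    rw [walk_cons, walk_cons]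
    linarith [dist_triangle x y a]

/-- Skipping stops is a shortcut by the triangle inequality. -/
theorem walk_sublist {l m : List E} (h : l.Sublist m) (x z : E) : walk x l z ≤ walk x m z := by
  induction h generalizing x with
  | slnil => exact le_rfl
  | cons a _ ih =>
    rw [walk_cons]
    exact (walk_le_dist_add x a _ z).trans (by linarith [ih a])
  | cons_cons a _ ih =>
    rw [walk_cons, walk_cons]
    linarith [ih a]

theorem two_mul_dist_le_walk {a : E} {l : List E} (h : a ∈ l) (x : E) :
    2 * dist x a ≤ walk x l x := by
  have := walk_sublist (List.singleton_sublist.2 h) x x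
  rw [walk_cons, walk_nil, dist_comm a x] at this
  linarith

theorem walk_nonneg (x z : E) (l : List E) : 0 ≤ walk x l z := by
  have := walk_sublist (List.nil_sublist l) x z
  rw [walk_nil] at this
  exact dist_nonneg.trans this

/-- Compare with the walk that returns to `z` after every stop. -/
theorem walk_le_dist_add_sum (x z : E) (l : List E) :
    walk x l z ≤ dist x z + (l.map fun a => 2 * dist z a).sum := by
  induction l generalizing x with
  | nil => simp [walk_nil]
  | cons a l ih =>
    rw [walk_cons, List.map_cons, List.sum_cons]
    have h1 := ih a
    have h2 := dist_triangle x z a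
    rw [dist_comm a z] at h1
    linarith

/-- Replacing stops by nearby ones, and omitting some. -/
theorem walk_replace_le {α ρ : Type*} (pos : α → E) (ty : α → ρ) (f : α → Option ρ) (e : α → ℝ)
    (z : E) (t : List α) (he : ∀ u ∈ t, 0 ≤ e u) :
    ∀ (w : List α), (∀ u ∈ t, ∀ v ∈ w, f u = some (ty v) → dist (pos v) (pos u) ≤ e u) →
      w.map ty = t.filterMap f → ∀ x y,
      walk x (w.map pos) z ≤ dist x y + walk y (t.map pos) z + (t.map fun u => 2 * e u).sum := by
  -- The distance between the current positions `x` and `y` of the two walks is carried along. A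
  -- replaced stop costs its displacement twice, on arrival and on departure.
  induction t with
  | nil =>
    intro w _ h x y
    have : w = [] := by simpa using h
    subst this
    simpa using walk_le_dist_add x y [] z
  | cons u t ih =>
    intro w hw h x y
    have he0 := he u List.mem_cons_self
    have ih' := ih (fun u hu => he u (List.mem_cons_of_mem _ hu))
    simp only [List.map_cons, List.sum_cons, walk_cons]
    cases hf : f u with
    | none =>
      rw [List.filterMap_cons_none hf] at h
      have h1 := ih' w (fun u hu => hw u (List.mem_cons_of_mem _ hu)) h x (pos u)
      have h2 := dist_triangle x y (pos u)
      linarith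
    | some r =>
      rw [List.filterMap_cons_some hf] at h
      cases w with
      | nil => simp at h
      | cons v w =>
        rw [List.map_cons, List.cons_eq_cons] at h
        have h1 := ih' w (fun u hu v hv => hw u (List.mem_cons_of_mem _ hu) v
          (List.mem_cons_of_mem _ hv)) h.2 (pos v) (pos u)
        have h2 := hw u List.mem_cons_self v List.mem_cons_self (by rw [hf, h.1])
        have h3 := dist_triangle4 x y (pos u) (pos v)
        rw [dist_comm (pos u) (pos v)] at h3
        rw [List.map_cons, walk_cons]
        linarith

end Walk

/-- The counterpart of `walk_replace_le` for demands: omitted stops only help, and the others are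
replaced by smaller ones. -/
theorem sum_replace_le {α ρ : Type*} (ty : α → ρ) (f : α → Option ρ) (dem : α → ℚ)
    (t : List α) (h0 : ∀ u ∈ t, 0 ≤ dem u) :
    ∀ (w : List α), (∀ u ∈ t, ∀ v ∈ w, f u = some (ty v) → dem v ≤ dem u) →
      w.map ty = t.filterMap f → (w.map dem).sum ≤ (t.map dem).sum := by
  induction t with
  | nil =>
    intro w _ h
    have : w = [] := by simpa using h
    simp [this]
  | cons u t ih =>
    intro w hw h
    have he0 := h0 u List.mem_cons_self
    have ih' := ih (fun u hu => h0 u (List.mem_cons_of_mem _ hu))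
    simp only [List.map_cons, List.sum_cons]
    cases hf : f u with
    | none =>
      rw [List.filterMap_cons_none hf] at h
      have h1 := ih' w (fun u hu => hw u (List.mem_cons_of_mem _ hu)) h
      linarith
    | some r =>
      rw [List.filterMap_cons_some hf] at h
      cases w with
      | nil => simp at h
      | cons v w =>
        rw [List.map_cons, List.cons_eq_cons] at h
        have h1 := ih' w (fun u hu v hv => hw u (List.mem_cons_of_mem _ hu) v
          (List.mem_cons_of_mem _ hv)) h.2
        have h2 := hw u List.mem_cons_self v List.mem_cons_self (by rw [hf, h.1])
        rw [List.map_cons, List.sum_cons]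
        linarith

/-! ### Accuracy of the approximate lengths -/

section Approx

theorem dist_toPlane (p q : ℚ × ℚ) :
    dist (toPlane p) (toPlane q) = √(((p.1 - q.1 : ℚ) : ℝ) ^ 2 + ((p.2 - q.2 : ℚ) : ℝ) ^ 2) := by
  rw [EuclideanSpace.dist_eq]
  simp [toPlane, Real.dist_eq, sq_abs]

/-- The new iterate is the mean of `r` and `s² / r`, at least `s` by the inequality of the means. As
`s² / r ≤ s`, the excess over `s` is at least halved. -/
theorem newton_step_bounds {s r e : ℝ} (hs : 0 ≤ s) (h1 : s ≤ r) (h2 : r ≤ (1 + e) * s) :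
    s ≤ (r + s ^ 2 / r) / 2 ∧ (r + s ^ 2 / r) / 2 ≤ (1 + e / 2) * s := by
  -- If `r = 0` then `s = 0`, and division by zero keeps the iterate at `0`.
  rcases (hs.trans h1).eq_or_lt with h | hr
  · have : s = 0 := by linarith
    subst h; subst this; simp
  · have h3 : s ^ 2 / r * r = s ^ 2 := div_mul_cancel₀ _ hr.ne'
    have h4 : s ^ 2 / r ≤ s := by
      rw [div_le_iff₀ hr]; nlinarith
    refine ⟨?_, by linarith⟩
    have h5 : 2 * s - r ≤ s ^ 2 / r := by
      rw [le_div_iff₀ hr]; nlinarith [sq_nonneg (s - r)]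
    linarith

theorem approxNorm_bounds (K : ℕ) (p : ℚ × ℚ) :
    √((p.1 : ℝ) ^ 2 + (p.2 : ℝ) ^ 2) ≤ (approxNorm K p : ℝ) ∧
      (approxNorm K p : ℝ) ≤ (1 + (1 / 2) ^ K) * √((p.1 : ℝ) ^ 2 + (p.2 : ℝ) ^ 2) := by
  set s := √((p.1 : ℝ) ^ 2 + (p.2 : ℝ) ^ 2) with hs
  have hs2 : s ^ 2 = (p.1 : ℝ) ^ 2 + (p.2 : ℝ) ^ 2 := Real.sq_sqrt (by positivity)
  have hs0 : 0 ≤ s := Real.sqrt_nonneg _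
  have key : ∀ n, ((fun x : ℚ × ℚ => (x.1, (x.2 + x.1 / x.2) / 2))^[n]
      (p.1 * p.1 + p.2 * p.2, |p.1| + |p.2|)).1 = p.1 * p.1 + p.2 * p.2 ∧
      s ≤ (approxNorm n p : ℝ) ∧ (approxNorm n p : ℝ) ≤ (1 + (1 / 2) ^ n) * s := by
    intro n
    induction n with
    | zero =>
      -- The start `|x| + |y|` is at most twice the norm, a relative error of `1 = (1/2)^0`.
      refine ⟨rfl, ?_⟩
      have h1 : (approxNorm 0 p : ℝ) = |(p.1 : ℝ)| + |(p.2 : ℝ)| := by simp [approxNorm]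
      rw [h1]
      have ha := abs_nonneg (p.1 : ℝ)
      have hb := abs_nonneg (p.2 : ℝ)
      have h3 := sq_abs (p.1 : ℝ)
      have h4 := sq_abs (p.2 : ℝ)
      constructor
      · refine abs_le_of_sq_le_sq' ?_ (by positivity) |>.2
        nlinarith [mul_nonneg ha hb]
      · norm_num
        refine abs_le_of_sq_le_sq' ?_ (by positivity) |>.2
        nlinarith [sq_nonneg (|(p.1 : ℝ)| - |(p.2 : ℝ)|)]
    | succ n ih =>
      obtain ⟨h0, h1, h2⟩ := ih
      unfold approxNorm at *
      rw [Function.iterate_succ_apply']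
      refine ⟨h0, ?_⟩
      simp only [h0]
      push_cast
      rw [← pow_two (p.1 : ℝ), ← pow_two (p.2 : ℝ), ← hs2, pow_succ ((1 : ℝ) / 2) n, ← div_eq_mul_one_div]
      exact newton_step_bounds hs0 h1 h2
  exact (key K).2

theorem legs_sum_bounds (K : ℕ) (l : List (ℚ × ℚ)) (p z : ℚ × ℚ) :
    walk (toPlane p) (l.map toPlane) (toPlane z) ≤ ((legs K p (l ++ [z])).sum : ℝ) ∧
      ((legs K p (l ++ [z])).sum : ℝ) ≤
        (1 + (1 / 2) ^ K) * walk (toPlane p) (l.map toPlane) (toPlane z) := by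
  have h : ∀ (l : List (ℚ × ℚ)) (p : ℚ × ℚ) (m : List ℚ),
      (l.foldl (fun (s : (ℚ × ℚ) × List ℚ) q =>
        (q, approxNorm K (q.1 - s.1.1, q.2 - s.1.2) :: s.2)) (p, m)).2.sum =
      m.sum + (legs K p l).sum := by
    intro l
    induction l with
    | nil => intro p m; simp [legs]
    | cons q l ih =>
      intro p m
      rw [legs, List.foldl_cons, List.foldl_cons, ih, ih]
      simp only [List.sum_cons, List.sum_nil]
      ring
  have h1 : ∀ q (l : List (ℚ × ℚ)) p, (legs K p (q :: l)).sum =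
      approxNorm K (q.1 - p.1, q.2 - p.2) + (legs K q l).sum := by
    intro q l p
    rw [legs, List.foldl_cons, h]
    simp
  have hd : ∀ p q : ℚ × ℚ, dist (toPlane p) (toPlane q) ≤
      (approxNorm K (q.1 - p.1, q.2 - p.2) : ℝ) ∧ (approxNorm K (q.1 - p.1, q.2 - p.2) : ℝ) ≤
      (1 + (1 / 2) ^ K) * dist (toPlane p) (toPlane q) := by
    intro p q
    rw [dist_comm, dist_toPlane]
    exact approxNorm_bounds K (q.1 - p.1, q.2 - p.2)
  induction l generalizing p with
  | nil =>
    have := hd p z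
    rw [List.nil_append, h1, List.map_nil, walk_nil]
    simpa [legs] using this
  | cons a l ih =>
    have h2 := hd p a
    have h3 := ih a
    rw [List.cons_append, h1, List.map_cons, walk_cons]
    rw [Rat.cast_add, mul_add]
    exact ⟨add_le_add h2.1 h3.1, add_le_add h2.2 h3.2⟩

/-- The position of a terminal relative to the depot. -/
noncomputable def itemPos (v : TItem) : EuclideanSpace ℝ (Fin 2) := toPlane v.2.2.1

/-- The length of the tour through the given terminals. -/
noncomputable def tourLength (t : List TItem) : ℝ :=
  walk (toPlane (0, 0)) (t.map itemPos) (toPlane (0, 0))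

/-- The total length of the tours. -/
noncomputable def totalLength (S : List (List TItem)) : ℝ := (S.map tourLength).sum

theorem approxCost_bounds (K : ℕ) (S : List (List TItem)) :
    totalLength S ≤ (approxCost K S : ℝ) ∧
      (approxCost K S : ℝ) ≤ (1 + (1 / 2) ^ K) * totalLength S := by
  induction S with
  | nil => simp [totalLength, approxCost]
  | cons t S ih =>
    have h := legs_sum_bounds K (t.map fun v => v.2.2.1) (0, 0) (0, 0)
    rw [List.map_map] at h
    have h1 : totalLength (t :: S) = tourLength t + totalLength S := by
      simp [totalLength]
    have h2 : approxCost K (t :: S) =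
        (legs K (0, 0) (t.map (fun v => v.2.2.1) ++ [(0, 0)])).sum + approxCost K S := by
      simp [approxCost]
    rw [h1, h2, Rat.cast_add, mul_add]
    exact ⟨add_le_add h.1 ih.1, add_le_add h.2 ih.2⟩

end Approx

end CVRP

/-! ### Realizing configurations by enumerated states -/

namespace CVRP

open Machine

section Enumeration

variable {β : Type} {ty : β → Typ}

theorem popStep_types {τ : Typ} {s : List β × List β} (h : τ ∈ s.1.map ty) :
    (popStep ty τ s).2.map ty = τ :: s.2.map ty := by
  obtain ⟨v, hv, rfl⟩ := List.mem_map.1 h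
  have hv' : v ∈ s.1.filter fun w => typEq (ty w) (ty v) :=
    List.mem_filter.2 ⟨hv, typEq_iff.2 rfl⟩
  unfold popStep
  cases hf : s.1.filter fun w => typEq (ty w) (ty v) with
  | nil => rw [hf] at hv'; simp at hv'
  | cons u us =>
    have hu : u ∈ s.1.filter fun w => typEq (ty w) (ty v) := by rw [hf]; exact List.mem_cons_self
    rw [List.mem_filter, typEq_iff] at hu
    simp [hu.2]

/-- Only types matter for what can still be removed, so the greedy choice never gets stuck. -/
theorem takeTour_types {c r : List Typ} {rem : List β} (h : (c ++ r).Perm (rem.map ty)) :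
    (takeTour ty c rem).2.map ty = c := by
  induction c generalizing r with
  | nil => rfl
  | cons τ c ih =>
    -- The right fold removes `τ` last, so for the tail `c` it still counts among the leftover
    -- types.
    have h1 := ih (r := τ :: r) (List.perm_middle.trans h)
    have h2 := (takeTour_perm (ty := ty) c rem).map ty
    rw [List.map_append, h1] at h2
    have h3 : (c ++ (takeTour ty c rem).1.map ty).Perm (c ++ τ :: r) :=
      h2.trans (h.symm.trans List.perm_middle.symm)
    rw [List.perm_append_left_iff] at h3
    have h4 := popStep_types (h3.mem_iff.2 List.mem_cons_self)
    rw [h1] at h4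
    exact h4

theorem takeTour_rest {c r : List Typ} {rem : List β} (h : (c ++ r).Perm (rem.map ty)) :
    r.Perm ((takeTour ty c rem).1.map ty) := by
  have h2 := (takeTour_perm (ty := ty) c rem).map ty
  rw [List.map_append, takeTour_types h] at h2
  exact (List.perm_append_left_iff c).1 (h.trans h2.symm)

variable (ty) in
/-- Add tours with the given configurations one after the other. -/
def runTours (cs : List (List Typ)) (s : List β × List (List β)) : List β × List (List β) :=
  cs.foldl (fun s c => addTour ty c s) s

theorem runTours_types {cs : List (List Typ)} {r : List Typ} {s : List β × List (List β)}
    (h : (cs.flatten ++ r).Perm (s.1.map ty)) :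
    (runTours ty cs s).2.map (List.map ty) = cs.reverse ++ s.2.map (List.map ty) := by
  induction cs generalizing s with
  | nil => rfl
  | cons c cs ih =>
    rw [List.flatten_cons, List.append_assoc] at h
    have h1 := ih (s := addTour ty c s) (takeTour_rest h)
    have h2 : runTours ty (c :: cs) s = runTours ty cs (addTour ty c s) := rfl
    rw [h2, h1, addTour, List.map_cons, takeTour_types h]
    simp

theorem runTours_perm (cs : List (List Typ)) (s : List β × List (List β)) :
    ((runTours ty cs s).2.flatten ++ (runTours ty cs s).1).Perm (s.2.flatten ++ s.1) := by
  induction cs generalizing s with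
  | nil => exact .refl _
  | cons c cs ih =>
    refine (ih (addTour ty c s)).trans ?_
    have h := takeTour_perm (ty := ty) c s.1
    simp only [addTour, List.flatten_cons]
    refine .trans ?_ (h.append_left s.2.flatten)
    rw [← List.append_assoc s.2.flatten]
    exact List.perm_append_comm.append_right _

theorem runTours_replicate (c : List Typ) (n : ℕ) (s : List β × List (List β)) :
    runTours ty (List.replicate n c) s = (addTour ty c)^[n] s := by
  induction n generalizing s with
  | zero => rfl
  | succ n ih => exact ih _

theorem runTours_append (cs ds : List (List Typ)) (s : List β × List (List β)) :
    runTours ty (cs ++ ds) s = runTours ty ds (runTours ty cs s) := List.foldl_append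

theorem mem_addTours {c : List Typ} {l : List β} {s x : List β × List (List β)} :
    x ∈ addTours ty c l s ↔ ∃ i ≤ l.length, x = (addTour ty c)^[i] s := by
  have h : ∀ (l : List β) s m, x ∈
      (let r := l.foldl (fun (r : (List β × List (List β)) × List (List β × List (List β))) _ =>
        (addTour ty c r.1, r.1 :: r.2)) (s, m); r.1 :: r.2) ↔
      x ∈ m ∨ ∃ i ≤ l.length, x = (addTour ty c)^[i] s := by
    intro l
    induction l with
    | nil => intro s m; simp [or_comm]
    | cons a l ih =>
      intro s m
      rw [List.foldl_cons]
      refine (ih _ _).trans ?_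
      rw [List.mem_cons]
      constructor
      · rintro ((h | h) | ⟨i, hi, h⟩)
        · exact .inr ⟨0, Nat.zero_le _, h⟩
        · exact .inl h
        · exact .inr ⟨i + 1, by simpa using hi, h⟩
      · rintro (h | ⟨i, hi, h⟩)
        · exact .inl (.inr h)
        · cases i with
          | zero => exact .inl (.inl h)
          | succ i => exact .inr ⟨i, by simpa using hi, h⟩
  exact (h l s []).trans (by simp)

/-- A state amounts to a multiplicity for every configuration, which is what makes the enumeration
exhaustive up to the order of the tours. -/
theorem mem_states {Cs : List (List Typ)} {l : List β} {x : List β × List (List β)} :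
    x ∈ states ty Cs l ↔ ∃ ns : List ℕ, ns.length = Cs.length ∧ (∀ n ∈ ns, n ≤ l.length) ∧
      x = runTours ty (List.zipWith List.replicate ns Cs).flatten (l, []) := by
  have h : ∀ (Cs : List (List Typ)) (m : List (List β × List (List β))), x ∈
      (Cs.foldl (fun (s : List β × List (List β × List (List β))) c =>
        (s.1, s.2.flatMap (addTours ty c s.1))) (l, m)).2 ↔
      ∃ s ∈ m, ∃ ns : List ℕ, ns.length = Cs.length ∧ (∀ n ∈ ns, n ≤ l.length) ∧
      x = runTours ty (List.zipWith List.replicate ns Cs).flatten s := by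
    intro Cs
    induction Cs with
    | nil => intro m; simp [runTours]
    | cons c Cs ih =>
      intro m
      rw [List.foldl_cons, ih]
      constructor
      · rintro ⟨s, hs, ns, h1, h2, h3⟩
        obtain ⟨r, hr, hrs⟩ := List.mem_flatMap.1 hs
        obtain ⟨i, hi, rfl⟩ := mem_addTours.1 hrs
        refine ⟨r, hr, i :: ns, by simpa using h1, by simpa using ⟨hi, h2⟩, ?_⟩
        rw [h3, List.zipWith_cons_cons, List.flatten_cons, runTours_append, runTours_replicate]
      · rintro ⟨s, hs, _ | ⟨i, ns⟩, h1, h2, h3⟩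
        · simp at h1
        · rw [List.forall_mem_cons] at h2
          refine ⟨_, List.mem_flatMap.2 ⟨s, hs, mem_addTours.2 ⟨i, h2.1, rfl⟩⟩, ns,
            by simpa using h1, h2.2, ?_⟩
          rw [h3, List.zipWith_cons_cons, List.flatten_cons, runTours_append, runTours_replicate]
  exact (h Cs [(l, [])]).trans (by simp)

theorem states_perm {Cs : List (List Typ)} {l : List β} {x : List β × List (List β)}
    (h : x ∈ states ty Cs l) : (x.2.flatten ++ x.1).Perm l := by
  obtain ⟨ns, -, -, rfl⟩ := mem_states.1 h
  simpa using runTours_perm (ty := ty) (List.zipWith List.replicate ns Cs).flatten (l, [])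

/-- Every list of configurations that fits to the given elements is realized by some state. -/
theorem exists_mem_states {Cs : List (List Typ)} (hCs : Cs.Nodup) {l : List β}
    {cs : List (List Typ)} (hcs : ∀ c ∈ cs, c ∈ Cs) (hlen : cs.length ≤ l.length) {r : List Typ}
    (h : (cs.flatten ++ r).Perm (l.map ty)) :
    ∃ x ∈ states ty Cs l, (x.2.map (List.map ty)).Perm cs := by
  -- The multiplicity of `c` is its number of occurrences in `cs`; as `Cs` has no duplicates,
  -- nothing is counted twice.
  have hperm : (List.zipWith List.replicate (Cs.map fun c => cs.count c) Cs).flatten.Perm cs := by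
    rw [List.perm_iff_count]
    intro d
    have h1 : List.zipWith List.replicate (Cs.map fun c => cs.count c) Cs =
        Cs.map fun c => List.replicate (cs.count c) c := by
      clear hCs hcs
      induction Cs with
      | nil => rfl
      | cons c Cs ih => simp [ih]
    rw [h1, List.count_flatten, List.map_map]
    by_cases hd : d ∈ Cs
    · obtain ⟨A, B, rfl⟩ := List.append_of_mem hd
      have hA : ∀ c ∈ A ++ B, c ≠ d := by
        rintro c hc rfl
        exact (List.nodup_middle.1 hCs).notMem hc
      have h2 : ∀ L : List (List Typ), (∀ c ∈ L, c ≠ d) →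
          (L.map (List.count d ∘ fun c => List.replicate (cs.count c) c)).sum = 0 := by
        intro L hL
        rw [List.sum_eq_zero_iff]
        intro x hx
        obtain ⟨c, hc, rfl⟩ := List.mem_map.1 hx
        simp [List.count_replicate, hL c hc]
      rw [List.map_append, List.map_cons, List.sum_append, List.sum_cons,
        h2 A fun c hc => hA c (List.mem_append_left _ hc),
        h2 B fun c hc => hA c (List.mem_append_right _ hc)]
      simp
    · rw [List.count_eq_zero_of_not_mem (fun hm => hd (hcs d hm)), List.sum_eq_zero_iff]
      intro x hx
      obtain ⟨c, hc, rfl⟩ := List.mem_map.1 hx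
      have : c ≠ d := fun h => hd (h ▸ hc)
      simp [List.count_replicate, this]
  refine ⟨_, mem_states.2 ⟨Cs.map fun c => cs.count c, by simp, ?_, rfl⟩, ?_⟩
  · intro n hn
    obtain ⟨c, -, rfl⟩ := List.mem_map.1 hn
    exact List.count_le_length.trans hlen
  · rw [runTours_types (r := r) ((hperm.flatten.append_right r).trans h)]
    simpa using (List.reverse_perm _).trans hperm

end Enumeration

end CVRP

/-! ### Rounding demands by shifting classes -/

namespace CVRP

/-- Equal multisets of labels give a matching of `W` with `P`, along which the sums are compared
term by term. -/
theorem sum_le_sum_of_map_perm {α β γ : Type*} {f : α → γ} {g : β → γ} {a : α → ℝ} {b : β → ℝ}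
    {W : List α} {P : List β} (h : (W.map f).Perm (P.map g))
    (hab : ∀ w ∈ W, ∀ p ∈ P, f w = g p → a w ≤ b p) : (W.map a).sum ≤ (P.map b).sum := by
  induction W generalizing P with
  | nil =>
    have : P = [] := by simpa using h
    simp [this]
  | cons w W ih =>
    obtain ⟨p, hp, hpw⟩ := List.mem_map.1 (h.mem_iff.1 List.mem_cons_self)
    obtain ⟨A, B, rfl⟩ := List.append_of_mem hp
    have h1 : (W.map f).Perm ((A ++ B).map g) := by
      have h2 : (f w :: W.map f).Perm (f w :: (A ++ B).map g) := by
        refine h.trans ?_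
        rw [List.map_append, List.map_cons, hpw, List.map_append]
        exact List.perm_middle
      exact h2.cons_inv
    have h3 := ih h1 fun w hw p hp => hab w (List.mem_cons_of_mem _ hw) p (by
      rw [List.mem_append] at hp
      rw [List.mem_append, List.mem_cons]
      tauto)
    have h4 := hab w List.mem_cons_self p hp hpw.symm
    simp only [List.map_cons, List.sum_cons, List.map_append, List.sum_append] at *
    linarith

section Shift

variable {α κ : Type*} (key : α → κ) (rk : α → ℕ) (s : κ → ℕ) (G : List α)

open Classical in
/-- The element whose rank exceeds that of `u` by the size of the classes in its cell. -/
noncomputable def shiftItem (u : α) : Option α :=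
  if h : ∃ w ∈ G, key w = key u ∧ rk w = rk u + s (key u) then some h.choose else none

variable {key rk s G}

theorem shiftItem_spec {u w : α} (h : shiftItem key rk s G u = some w) :
    w ∈ G ∧ key w = key u ∧ rk w = rk u + s (key u) := by
  unfold shiftItem at h
  split_ifs at h with hex
  rw [← Option.some.inj h]
  exact hex.choose_spec

/-- The ranks in a cell form an initial segment of `ℕ` without repetition. Raising ranks by the
class size therefore hits each element exactly once, apart from those of rank below the class size.
-/
theorem shiftItem_perm (hG : G.Nodup)
    (hinj : ∀ u ∈ G, ∀ w ∈ G, key u = key w → rk u = rk w → u = w)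
    (hdown : ∀ v ∈ G, ∀ n < rk v, ∃ u ∈ G, key u = key v ∧ rk u = n) :
    (G.filterMap (shiftItem key rk s G) ++ G.filter fun w => rk w < s (key w)).Perm G := by
  have hnodup : (G.filterMap (shiftItem key rk s G)).Nodup := by
    have h1 : G.Pairwise fun a b => a ∈ G ∧ b ∈ G ∧ a ≠ b := List.Pairwise.and_mem.1 hG
    refine List.Pairwise.filterMap _ ?_ h1
    rintro a a' ⟨ha, ha', hne⟩ b hb b' hb' rfl
    obtain ⟨-, h2, h3⟩ := shiftItem_spec hb
    obtain ⟨-, h4, h5⟩ := shiftItem_spec hb'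
    have hk : key a = key a' := h2.symm.trans h4
    refine hne (hinj a ha a' ha' hk ?_)
    rw [hk] at h3
    omega
  rw [List.perm_ext_iff_of_nodup _ hG]
  · intro w
    simp only [List.mem_append, List.mem_filterMap, List.mem_filter, decide_eq_true_eq]
    constructor
    · rintro (⟨u, -, hu⟩ | ⟨hw, -⟩)
      · exact (shiftItem_spec hu).1
      · exact hw
    · intro hw
      by_cases hlt : rk w < s (key w)
      · exact .inr ⟨hw, hlt⟩
      · left
        have hex : ∃ u ∈ G, key u = key w ∧ rk u + s (key w) = rk w := by
          -- For class size `0` the shift is the identity, and `hdown`, which needs a strictly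
          -- smaller rank, does not apply.
          by_cases h0 : s (key w) = 0
          · exact ⟨w, hw, rfl, by omega⟩
          · obtain ⟨u, hu, h1, h2⟩ := hdown w hw (rk w - s (key w)) (by omega)
            exact ⟨u, hu, h1, by omega⟩
        obtain ⟨u, hu, h1, h2⟩ := hex
        refine ⟨u, hu, ?_⟩
        have hex' : ∃ w ∈ G, key w = key u ∧ rk w = rk u + s (key u) :=
          ⟨w, hw, h1.symm, by rw [h1]; exact h2.symm⟩
        have h3 : shiftItem key rk s G u = some hex'.choose := dif_pos hex'
        rw [h3]
        obtain ⟨h4, h5, h6⟩ := hex'.choose_spec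
        rw [hinj _ h4 w hw (h5.trans h1) (by rw [h6, h1, h2])]
  · rw [List.nodup_append]
    refine ⟨hnodup, hG.filter _, ?_⟩
    rintro w hw w' hw' rfl
    obtain ⟨u, -, hu⟩ := List.mem_filterMap.1 hw
    obtain ⟨-, h1, h2⟩ := shiftItem_spec hu
    have h3 : rk w < s (key w) := by simpa using (List.mem_filter.1 hw').2
    rw [h1] at h3
    omega

/-- The elements of lowest rank in each cell contribute little. -/
theorem sum_lowRank_le [DecidableEq κ] (hG : G.Nodup) {K : ℕ}
    (hinj : ∀ u ∈ G, ∀ w ∈ G, key u = key w → rk u = rk w → u = w)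
    (hs : ∀ v ∈ G, s (key v) * K ≤ (G.filter fun w => key w = key v).length)
    {d : α → ℝ} (hd0 : ∀ v, 0 ≤ d v) {b : ℝ} (hb : 0 ≤ b)
    (hd : ∀ u ∈ G, ∀ w ∈ G, key u = key w → d w ≤ b * d u) :
    K * ((G.filter fun w => rk w < s (key w)).map d).sum ≤ b * (G.map d).sum := by
  classical
  have hGf : ∀ (p : α → Prop) [DecidablePred p], ((G.filter fun w => p w).map d).sum =
      ∑ w ∈ G.toFinset with p w, d w := by
    intro p _
    rw [← List.sum_toFinset d (hG.filter _), List.toFinset_filter]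
    simp
  rw [hGf, ← List.sum_toFinset d hG]
  rw [← Finset.sum_fiberwise_of_maps_to (s := G.toFinset) (t := G.toFinset.image key) (g := key)
    (fun x hx => Finset.mem_image_of_mem _ hx) d,
    ← Finset.sum_fiberwise_of_maps_to (t := G.toFinset.image key) (g := key) (fun x hx =>
      Finset.mem_image_of_mem _ (Finset.mem_filter.1 hx).1) d, Finset.mul_sum, Finset.mul_sum]
  -- In one cell, at most `s` elements have low rank while at least `s * K` exist, all with `d`
  -- comparable up to the factor `b`. Both sides are compared after multiplication by `s`; if `s =
  -- 0`, none has low rank.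
  refine Finset.sum_le_sum fun k hk => ?_
  obtain ⟨v, hv, rfl⟩ := Finset.mem_image.1 hk
  have hvG := List.mem_toFinset.1 hv
  set A := {w ∈ G.toFinset | key w = key v} with hA
  set B := {w ∈ {w ∈ G.toFinset | rk w < s (key w)} | key w = key v} with hB
  have hmemA : ∀ {w}, w ∈ A ↔ w ∈ G ∧ key w = key v := by simp [hA]
  have hmemB : ∀ {w}, w ∈ B ↔ (w ∈ G ∧ rk w < s (key w)) ∧ key w = key v := by simp [hB]
  have hcardA : s (key v) * K ≤ A.card := by
    refine (hs v hvG).trans (le_of_eq ?_)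
    rw [← List.toFinset_card_of_nodup (hG.filter _), List.toFinset_filter]
    simp [hA]
  have hcardB : B.card ≤ s (key v) := by
    rw [← Finset.card_range (s (key v))]
    refine Finset.card_le_card_of_injOn rk ?_ ?_
    · intro w hw
      have := hmemB.1 hw
      rw [this.2] at this
      simpa using this.1.2
    · intro u hu w hw h
      have h1 := hmemB.1 hu
      have h2 := hmemB.1 hw
      exact hinj u h1.1.1 w h2.1.1 (h1.2.trans h2.2.symm) h
  have hD : 0 ≤ ∑ w ∈ A, d w := Finset.sum_nonneg fun w _ => hd0 w
  have hw : ∀ w ∈ B, (s (key v) : ℝ) * (K * d w) ≤ b * ∑ u ∈ A, d u := by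
    intro w hw
    have h1 := hmemB.1 hw
    have h2 : (A.card : ℝ) * d w ≤ ∑ u ∈ A, b * d u := by
      rw [← nsmul_eq_mul]
      refine Finset.card_nsmul_le_sum _ _ _ fun u hu => ?_
      have h3 := hmemA.1 hu
      exact hd u h3.1 w h1.1.1 (h3.2.trans h1.2.symm)
    rw [← Finset.mul_sum] at h2
    refine le_trans ?_ h2
    rw [← mul_assoc]
    exact mul_le_mul_of_nonneg_right (by exact_mod_cast hcardA) (hd0 w)
  rcases Nat.eq_zero_or_pos (s (key v)) with h0 | hpos
  · have : B = ∅ := Finset.card_eq_zero.1 (by omega)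
    rw [this]
    simpa using mul_nonneg hb hD
  · have hpos' : (0 : ℝ) < s (key v) := by exact_mod_cast hpos
    have h1 : (s (key v) : ℝ) * (K * ∑ w ∈ B, d w) ≤ s (key v) * (b * ∑ u ∈ A, d u) := by
      calc (s (key v) : ℝ) * (K * ∑ w ∈ B, d w) = ∑ w ∈ B, (s (key v) : ℝ) * (K * d w) := by
            rw [Finset.mul_sum, Finset.mul_sum]
        _ ≤ ∑ w ∈ B, b * ∑ u ∈ A, d u := Finset.sum_le_sum hw
        _ = B.card * (b * ∑ u ∈ A, d u) := by rw [Finset.sum_const, nsmul_eq_mul]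
        _ ≤ s (key v) * (b * ∑ u ∈ A, d u) :=
            mul_le_mul_of_nonneg_right (by exact_mod_cast hcardB) (mul_nonneg hb hD)
    exact le_of_mul_le_mul_left h1 hpos'

variable {ρ : Type*}

/-- The types of the elements that replace those of a tour. -/
noncomputable def conf (key : α → κ) (rk : α → ℕ) (s : κ → ℕ) (G : List α) (ty : α → ρ)
    (t : List α) : List ρ :=
  t.filterMap fun u => (shiftItem key rk s G u).map ty

/-- This is the fitting condition of `exists_mem_states`: the shifted tours and the elements of
lowest rank together use every type as often as it occurs. -/
theorem conf_flatten_perm (hG : G.Nodup)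
    (hinj : ∀ u ∈ G, ∀ w ∈ G, key u = key w → rk u = rk w → u = w)
    (hdown : ∀ v ∈ G, ∀ n < rk v, ∃ u ∈ G, key u = key v ∧ rk u = n) (ty : α → ρ)
    {Pi : List (List α)} (hPi : Pi.flatten.Perm G) :
    ((Pi.map (conf key rk s G ty)).flatten ++
      (G.filter fun w => rk w < s (key w)).map ty).Perm (G.map ty) := by
  have h1 : (Pi.map (conf key rk s G ty)).flatten =
      (Pi.flatten.filterMap (shiftItem key rk s G)).map ty := by
    rw [List.map_filterMap, List.filterMap_flatten]
    rfl
  rw [h1]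
  refine .trans ?_ ((shiftItem_perm (s := s) hG hinj hdown).map ty)
  rw [List.map_append]
  exact ((hPi.filterMap _).map ty).append_right _

variable {E : Type*} [MetricSpace E]

/-- `W` is any realization of the shifted tours, known only up to types, and `R` is the remainder.
Types determine the cell, hence the position up to `δ`, and the class, hence a demand not above the
original one. So lengths, capacities and the remainder are controlled although the actual elements
are unknown. -/
theorem replace_bounds [DecidableEq κ] (hG : G.Nodup) {K : ℕ}
    (hinj : ∀ u ∈ G, ∀ w ∈ G, key u = key w → rk u = rk w → u = w)
    (hdown : ∀ v ∈ G, ∀ n < rk v, ∃ u ∈ G, key u = key v ∧ rk u = n)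
    (hs : ∀ v ∈ G, s (key v) * K ≤ (G.filter fun w => key w = key v).length)
    {ty : α → ρ} (hty : ∀ u ∈ G, ∀ w ∈ G, ty u = ty w → key u = key w ∧
      rk u / max (s (key u)) 1 = rk w / max (s (key w)) 1)
    {Pi W : List (List α)} {R : List α} (hPi : Pi.flatten.Perm G) (hWR : (W.flatten ++ R).Perm G)
    (hW : (W.map (List.map ty)).Perm (Pi.map (conf key rk s G ty)))
    {O : E} {pos : α → E} {δ : ℝ} (hδ : 0 ≤ δ)
    (hdist : ∀ u ∈ G, ∀ w ∈ G, key u = key w → dist (pos w) (pos u) ≤ δ * dist O (pos u))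
    {dem : α → ℚ} (hdem0 : ∀ u ∈ G, 0 ≤ dem u)
    (hdem : ∀ u ∈ G, ∀ w ∈ G, key u = key w → rk u ≤ rk w → dem w ≤ dem u)
    (hcap : ∀ t ∈ Pi, (t.map dem).sum ≤ 1) :
    (W.map fun t => walk O (t.map pos) O).sum ≤ (Pi.map fun t => walk O (t.map pos) O).sum +
        2 * δ * (G.map fun v => dist O (pos v)).sum ∧
      (∀ t ∈ W, (t.map dem).sum ≤ 1) ∧
      K * (R.map fun v => dist O (pos v)).sum ≤
        (1 + δ) ^ 2 * (G.map fun v => dist O (pos v)).sum := by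
  classical
  have hPG : ∀ t ∈ Pi, ∀ u ∈ t, u ∈ G := fun t ht u hu =>
    hPi.mem_iff.1 (List.mem_flatten_of_mem ht hu)
  have hWG : ∀ t ∈ W, ∀ u ∈ t, u ∈ G := fun t ht u hu =>
    hWR.mem_iff.1 (List.mem_append_left _ (List.mem_flatten_of_mem ht hu))
  -- If the class size is positive, the element `v` obtained from `u` lies exactly one class length
  -- higher, so `u` precedes the whole class of `v`, which contains `w`. If it is `0`, classes are
  -- single ranks and the three ranks agree.
  have hkey : ∀ u ∈ G, ∀ w ∈ G, (shiftItem key rk s G u).map ty = some (ty w) →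
      key u = key w ∧ rk u ≤ rk w := by
    intro u hu w hw h
    obtain ⟨v, hv, hvw⟩ := Option.map_eq_some_iff.1 h
    obtain ⟨hvG, h1, h2⟩ := shiftItem_spec hv
    obtain ⟨h3, h4⟩ := hty v hvG w hw hvw
    refine ⟨h1.symm.trans h3, ?_⟩
    rw [← h3, h1] at h4
    set m := max (s (key u)) 1 with hm
    have h5 := Nat.div_add_mod (rk v) m
    have h6 := Nat.div_add_mod (rk w) m
    have h7 := Nat.mod_lt (rk v) (show m > 0 by omega)
    rw [h4] at h5
    omega
  refine ⟨?_, ?_, ?_⟩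
  · have h1 := sum_le_sum_of_map_perm (a := fun t => walk O (t.map pos) O)
      (b := fun t => walk O (t.map pos) O + (t.map fun u => 2 * (δ * dist O (pos u))).sum) hW
      (by
        intro w hw t ht h
        have := walk_replace_le pos ty (fun u => (shiftItem key rk s G u).map ty)
          (fun u => δ * dist O (pos u)) O t (fun u _ => by positivity) w
          (fun u hu v hv huv => hdist u (hPG t ht u hu) v (hWG w hw v hv)
            (hkey u (hPG t ht u hu) v (hWG w hw v hv) huv).1) h O O
        simpa using this)
    refine h1.trans (le_of_eq ?_)
    rw [List.sum_map_add]
    congr 1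
    have h2 : (Pi.map fun t => (t.map fun u => 2 * (δ * dist O (pos u))).sum) =
        (Pi.map (List.map fun u => 2 * (δ * dist O (pos u)))).map List.sum := by
      rw [List.map_map]; rfl
    rw [h2, ← List.sum_flatten, ← List.map_flatten, (hPi.map _).sum_eq, ← List.sum_map_mul_left]
    simp only [mul_assoc]
  · intro w hw
    have h1 : w.map ty ∈ Pi.map (conf key rk s G ty) := hW.mem_iff.1 (List.mem_map_of_mem hw)
    obtain ⟨t, ht, htw⟩ := List.mem_map.1 h1
    refine (sum_replace_le ty (fun u => (shiftItem key rk s G u).map ty) dem t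
      (fun u hu => hdem0 u (hPG t ht u hu)) w (fun u hu v hv huv => ?_) htw.symm).trans
      (hcap t ht)
    have := hkey u (hPG t ht u hu) v (hWG w hw v hv) huv
    exact hdem u (hPG t ht u hu) v (hWG w hw v hv) this.1 this.2
  · have hR : (R.map ty).Perm ((G.filter fun w => rk w < s (key w)).map ty) := by
      have h1 := conf_flatten_perm (s := s) hG hinj hdown ty hPi
      have h2 := hWR.map ty
      rw [List.map_append, List.map_flatten] at h2
      exact (List.perm_append_left_iff _).1
        ((hW.flatten.symm.append_right _).trans (h2.trans h1.symm))
    -- This factor `1 + δ` enters twice: when `R` is compared with the elements of lowest rank, and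
    -- when those are compared with their whole cells.
    have hd : ∀ u ∈ G, ∀ w ∈ G, key u = key w →
        dist O (pos w) ≤ (1 + δ) * dist O (pos u) := by
      intro u hu w hw h
      have h1 := hdist u hu w hw h
      have h2 := dist_triangle O (pos u) (pos w)
      rw [dist_comm (pos u)] at h2
      linarith
    have h1 := sum_le_sum_of_map_perm (a := fun v => dist O (pos v))
      (b := fun v => (1 + δ) * dist O (pos v)) hR (by
        intro v hv u hu h
        have hvG := hWR.mem_iff.1 (List.mem_append_right _ hv)
        have huG := (List.mem_filter.1 hu).1
        exact hd u huG v hvG (hty v hvG u huG h).1.symm)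
    rw [List.sum_map_mul_left] at h1
    have h2 := sum_lowRank_le (s := s) hG hinj hs (d := fun v => dist O (pos v))
      (fun v => dist_nonneg) (b := 1 + δ) (by linarith) hd
    have hK' : (0 : ℝ) ≤ K := by positivity
    calc _ ≤ (K : ℝ) * ((1 + δ) * _) := mul_le_mul_of_nonneg_left h1 hK'
      _ = (1 + δ) * (K * _) := by ring
      _ ≤ (1 + δ) * ((1 + δ) * _) := mul_le_mul_of_nonneg_left h2 (by linarith)
      _ = _ := by ring

end Shift

end CVRP

/-! ### Geometry of cells and scales -/

namespace CVRP

open Machine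

section Geometry

theorem maxNorm_le_dist (p q : ℚ × ℚ) :
    (maxNorm (p.1 - q.1, p.2 - q.2) : ℝ) ≤ dist (toPlane p) (toPlane q) := by
  rw [dist_toPlane, maxNorm, Rat.cast_max, Rat.cast_abs, Rat.cast_abs]
  exact max_le (Real.abs_le_sqrt (by nlinarith [sq_nonneg ((p.2 - q.2 : ℚ) : ℝ)]))
    (Real.abs_le_sqrt (by nlinarith [sq_nonneg ((p.1 - q.1 : ℚ) : ℝ)]))

theorem dist_le_maxNorm (p q : ℚ × ℚ) :
    dist (toPlane p) (toPlane q) ≤ 2 * (maxNorm (p.1 - q.1, p.2 - q.2) : ℝ) := by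
  rw [dist_toPlane]
  have h0 : (0 : ℝ) ≤ maxNorm (p.1 - q.1, p.2 - q.2) := by exact_mod_cast maxNorm_nonneg _
  have h1 : |((p.1 - q.1 : ℚ) : ℝ)| ≤ maxNorm (p.1 - q.1, p.2 - q.2) := by
    exact_mod_cast le_max_left _ _
  have h2 : |((p.2 - q.2 : ℚ) : ℝ)| ≤ maxNorm (p.1 - q.1, p.2 - q.2) := by
    exact_mod_cast le_max_right _ _
  have h3 := sq_le_sq' (abs_le.1 h1).1 (abs_le.1 h1).2
  have h4 := sq_le_sq' (abs_le.1 h2).1 (abs_le.1 h2).2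
  rw [Real.sqrt_le_left (by positivity)]
  nlinarith

theorem maxNorm_neg (p : ℚ × ℚ) : maxNorm (0 - p.1, 0 - p.2) = maxNorm p := by
  simp [maxNorm]

theorem maxNorm_le_dist_zero (p : ℚ × ℚ) :
    (maxNorm p : ℝ) ≤ dist (toPlane (0, 0)) (toPlane p) := by
  have := maxNorm_le_dist (0, 0) p
  rwa [maxNorm_neg] at this

theorem dist_zero_le_maxNorm (p : ℚ × ℚ) :
    dist (toPlane (0, 0)) (toPlane p) ≤ 2 * (maxNorm p : ℝ) := by
  have := dist_le_maxNorm (0, 0) p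
  rwa [maxNorm_neg] at this

theorem maxNorm_eq_zero {p : ℚ × ℚ} : maxNorm p = 0 ↔ p = (0, 0) := by
  constructor
  · intro h
    have h1 : |p.1| ≤ 0 := h ▸ le_max_left _ _
    have h2 : |p.2| ≤ 0 := h ▸ le_max_right _ _
    exact Prod.ext (abs_nonpos_iff.1 h1) (abs_nonpos_iff.1 h2)
  · rintro rfl
    simp [maxNorm]

theorem maxNorm_eq_rescale {K : ℕ} (hK : 1 < K) (p : ℚ × ℚ) :
    maxNorm p = maxNorm (rescale K (0, p)).2 * (K : ℚ) ^ (keyOf K p).1 := by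
  obtain ⟨h1, h2, -⟩ := rescale_spec hK p
  rw [← maxNorm_mul _ (by positivity)]
  change maxNorm (p.1, p.2) = _
  conv_lhs => rw [h1, h2]
  rfl

theorem scale_bounds {K : ℕ} (hK : 1 < K) {p : ℚ × ℚ} (hp : maxNorm p ≠ 0) :
    (K : ℚ) ^ (keyOf K p).1 ≤ maxNorm p ∧ maxNorm p < (K : ℚ) ^ ((keyOf K p).1 + 1) := by
  obtain ⟨-, -, h3⟩ := rescale_spec hK p
  have h4 := h3 hp
  have hK0 : (0 : ℚ) < K := by positivity
  have hpos : (0 : ℚ) < (K : ℚ) ^ (keyOf K p).1 := by positivity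
  rw [zpow_add_one₀ hK0.ne', mul_comm _ (K : ℚ), maxNorm_eq_rescale hK p]
  constructor <;> nlinarith

/-- At scale `s` the grid has mesh `K^s / K`, and `K^s` is at most the norm of `q` unless `q` is the
depot. The factor `2` compares maximum and Euclidean norm. -/
theorem dist_le_of_keyOf_eq {K : ℕ} (hK : 1 < K) {p q : ℚ × ℚ} (h : keyOf K p = keyOf K q) :
    dist (toPlane p) (toPlane q) ≤ 2 / K * dist (toPlane (0, 0)) (toPlane q) := by
  obtain ⟨hp1, hp2, hp3⟩ := rescale_spec hK p
  obtain ⟨hq1, hq2, hq3⟩ := rescale_spec hK q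
  have hK1 : (1 : ℚ) < K := by exact_mod_cast hK
  have hK0 : (0 : ℚ) < K := by positivity
  have hK0' : (0 : ℝ) < K := by positivity
  have hk1 : (rescale K (0, p)).1 = (rescale K (0, q)).1 := congrArg (fun x : Key => x.1) h
  have hk2 : ⌊(rescale K (0, p)).2.1 * K⌋ = ⌊(rescale K (0, q)).2.1 * K⌋ :=
    congrArg (fun x : Key => x.2.1) h
  have hk3 : ⌊(rescale K (0, p)).2.2 * K⌋ = ⌊(rescale K (0, q)).2.2 * K⌋ :=
    congrArg (fun x : Key => x.2.2) h
  have h1 := Int.abs_sub_lt_one_of_floor_eq_floor hk2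
  have h2 := Int.abs_sub_lt_one_of_floor_eq_floor hk3
  rw [← sub_mul, abs_mul, abs_of_pos hK0, ← lt_div_iff₀ hK0] at h1 h2
  -- The depot is alone in its cell: its rescaled coordinates vanish, while any other point has one
  -- of absolute value at least `1`, more than the mesh `1 / K`.
  have hq0 : q = (0, 0) → p = (0, 0) := by
    intro hq
    by_contra hp
    have h3 := (hp3 (mt maxNorm_eq_zero.1 hp)).1
    have hz : ((K : ℚ) ^ (rescale K (0, q)).1) ≠ 0 := by positivity
    have h4 : (rescale K (0, q)).2.1 = 0 := by
      refine (mul_eq_zero.1 (hq1.symm.trans ?_)).resolve_right hz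
      rw [hq]
    have h5 : (rescale K (0, q)).2.2 = 0 := by
      refine (mul_eq_zero.1 (hq2.symm.trans ?_)).resolve_right hz
      rw [hq]
    rw [h4, sub_zero] at h1
    rw [h5, sub_zero] at h2
    have h6 : (1 : ℚ) / K < 1 := by rwa [div_lt_one hK0]
    rw [maxNorm, le_max_iff] at h3
    rcases h3 with h3 | h3 <;> linarith
  by_cases hq : q = (0, 0)
  · rw [hq, hq0 hq]; simp
  · have h3 : maxNorm (p.1 - q.1, p.2 - q.2) ≤ 1 / K * (K : ℚ) ^ (keyOf K q).1 := by
      have h4 : (0 : ℚ) ≤ (K : ℚ) ^ (keyOf K q).1 := by positivity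
      have h5 : (rescale K (0, q)).1 = (keyOf K q).1 := rfl
      rw [hp1, hp2, hq1, hq2, hk1, ← sub_mul, ← sub_mul, h5, maxNorm, abs_mul, abs_mul,
        abs_of_nonneg h4]
      exact max_le (mul_le_mul_of_nonneg_right h1.le h4) (mul_le_mul_of_nonneg_right h2.le h4)
    have h4 := (scale_bounds hK (mt maxNorm_eq_zero.1 hq)).1
    have h5 : maxNorm (p.1 - q.1, p.2 - q.2) ≤ 1 / K * maxNorm q :=
      h3.trans (mul_le_mul_of_nonneg_left h4 (by positivity))
    have h6 : (maxNorm (p.1 - q.1, p.2 - q.2) : ℝ) ≤ 1 / K * maxNorm q := by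
      simpa using (Rat.cast_le (K := ℝ)).2 h5
    calc dist (toPlane p) (toPlane q) ≤ 2 * (maxNorm (p.1 - q.1, p.2 - q.2) : ℝ) :=
          dist_le_maxNorm p q
      _ ≤ 2 * (1 / K * maxNorm q) := by linarith
      _ = 2 / K * maxNorm q := by ring
      _ ≤ 2 / K * dist (toPlane (0, 0)) (toPlane q) :=
          mul_le_mul_of_nonneg_left (maxNorm_le_dist_zero q) (by positivity)

/-- A point is much closer to the depot than one whose scale is larger by two. -/
theorem dist_le_of_scale_le {K : ℕ} (hK : 1 < K) {p q : ℚ × ℚ} (hq : maxNorm q ≠ 0)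
    (h : (keyOf K p).1 + 2 ≤ (keyOf K q).1) :
    dist (toPlane (0, 0)) (toPlane p) ≤ 2 / K * dist (toPlane (0, 0)) (toPlane q) := by
  have hK1 : (1 : ℚ) ≤ K := by exact_mod_cast hK.le
  have hK0 : (0 : ℚ) < K := by positivity
  by_cases hp : maxNorm p = 0
  · have := dist_zero_le_maxNorm p
    rw [hp] at this
    refine (this.trans ?_)
    simp only [Rat.cast_zero, mul_zero]
    positivity
  -- A scale spans a full factor `K`, so a gap of two scales guarantees only one factor `K`;
  -- adjacent scales would guarantee none.
  have h1 : maxNorm p ≤ 1 / K * maxNorm q := by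
    calc maxNorm p ≤ (K : ℚ) ^ ((keyOf K p).1 + 1) := (scale_bounds hK hp).2.le
      _ ≤ (K : ℚ) ^ ((keyOf K q).1 - 1) := zpow_le_zpow_right₀ hK1 (by omega)
      _ = 1 / K * (K : ℚ) ^ (keyOf K q).1 := by rw [zpow_sub_one₀ hK0.ne']; ring
      _ ≤ 1 / K * maxNorm q :=
          mul_le_mul_of_nonneg_left (scale_bounds hK hq).1 (by positivity)
  have h2 : (maxNorm p : ℝ) ≤ 1 / K * maxNorm q := by
    simpa using (Rat.cast_le (K := ℝ)).2 h1
  calc _ ≤ 2 * (maxNorm p : ℝ) := dist_zero_le_maxNorm p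
    _ ≤ 2 * (1 / K * maxNorm q) := by linarith
    _ = 2 / K * maxNorm q := by ring
    _ ≤ _ := mul_le_mul_of_nonneg_left (maxNorm_le_dist_zero q) (by positivity)

theorem abs_floor_mul_le {K : ℕ} {x : ℚ} (hx : |x| ≤ K) :
    -((K : ℤ) * K) ≤ ⌊x * K⌋ ∧ ⌊x * K⌋ ≤ (K : ℤ) * K := by
  have h := abs_le.1 hx
  have hK0 : (0 : ℚ) ≤ K := by positivity
  constructor
  · rw [Int.le_floor]
    push_cast
    nlinarith
  · have h1 := Int.floor_le (x * K)
    have h2 : x * K ≤ K * K := by nlinarith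
    have h3 : ((⌊x * K⌋ : ℤ) : ℚ) ≤ ((K * K : ℤ) : ℚ) := by push_cast; linarith
    exact_mod_cast h3

/-- Rescaled coordinates are bounded by `K` and multiplied by `K`, so each scale meets a number of
cells that depends on `K` only. -/
theorem keyOf_bounds {K : ℕ} (hK : 1 < K) (p : ℚ × ℚ) :
    (keyOf K p).2.1 ∈ Finset.Icc (-((K : ℤ) * K)) (K * K) ∧
      (keyOf K p).2.2 ∈ Finset.Icc (-((K : ℤ) * K)) (K * K) := by
  have h : maxNorm (rescale K (0, p)).2 ≤ K := by
    by_cases hp : maxNorm p = 0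
    · have h1 := maxNorm_eq_rescale hK p
      rw [hp, eq_comm, mul_eq_zero] at h1
      have hz : ((K : ℚ) ^ (keyOf K p).1) ≠ 0 := by positivity
      rw [h1.resolve_right hz]
      positivity
    · exact ((rescale_spec hK p).2.2 hp).2.le
  rw [maxNorm, max_le_iff] at h
  rw [Finset.mem_Icc, Finset.mem_Icc]
  exact ⟨abs_floor_mul_le h.1, abs_floor_mul_le h.2⟩

end Geometry

/-! ### Ranks in a finite linear order -/

section Rank

variable {α ι : Type*} [LinearOrder ι] (f : α → ι) (C : Finset α)

theorem card_filter_lt {u v : α} (hu : u ∈ C) (h : f u < f v) :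
    (C.filter fun w => f w < f u).card < (C.filter fun w => f w < f v).card := by
  refine Finset.card_lt_card (Finset.ssubset_iff_of_subset ?_ |>.2 ⟨u, by simp [hu, h], by simp⟩)
  intro w
  simp only [Finset.mem_filter]
  exact fun hw => ⟨hw.1, hw.2.trans h⟩

theorem eq_of_card_filter_eq (hf : Set.InjOn f C) {u v : α} (hu : u ∈ C) (hv : v ∈ C)
    (h : (C.filter fun w => f w < f u).card = (C.filter fun w => f w < f v).card) : u = v := by
  rcases lt_trichotomy (f u) (f v) with h1 | h1 | h1
  · exact absurd h (card_filter_lt f C hu h1).ne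
  · exact hf hu hv h1
  · exact absurd h (card_filter_lt f C hv h1).ne'

/-- Ranks are injective with values below the cardinality, hence every such value is taken. -/
theorem exists_card_filter_eq (hf : Set.InjOn f C) {n : ℕ} (hn : n < C.card) :
    ∃ u ∈ C, (C.filter fun w => f w < f u).card = n := by
  have h1 : C.image (fun u => (C.filter fun w => f w < f u).card) = Finset.range C.card := by
    refine Finset.eq_of_subset_of_card_le ?_ ?_
    · intro m hm
      obtain ⟨u, hu, rfl⟩ := Finset.mem_image.1 hm
      refine Finset.mem_range.2 (Finset.card_lt_card (Finset.filter_ssubset.2 ⟨u, hu, by simp⟩))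
    · rw [Finset.card_range, Finset.card_image_of_injOn]
      intro u hu v hv h
      exact eq_of_card_filter_eq f C hf hu hv h
  have h2 : n ∈ C.image (fun u => (C.filter fun w => f w < f u).card) := by
    rw [h1]; exact Finset.mem_range.2 hn
  simpa using h2

end Rank

end CVRP

/-! ### Ranks, classes and the finite set of types -/

namespace CVRP

open Machine

section Classify

variable {K : ℕ} {l : List Item}

/-- The terminals with their cells. -/
def keyed (K : ℕ) (l : List Item) : List (Key × Item) := l.map fun v => (keyOf K v.2.1, v)

/-- The rank of a terminal in its cell. -/
def itemRank (K : ℕ) (l : List Item) (v : TItem) : ℕ := rank (keyed K l) (v.1.1, v.2)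

def itemClass (K : ℕ) (l : List Item) (κ : Key) : ℕ := classSize K (keyed K l) κ

theorem mem_classify {v : TItem} (hv : v ∈ classify K l) :
    v.2 ∈ l ∧ v.1.1 = keyOf K v.2.2.1 ∧
      v.1.2 = itemRank K l v / max (itemClass K l v.1.1) 1 := by
  rw [classify, List.map_map] at hv
  obtain ⟨u, hu, rfl⟩ := List.mem_map.1 hv
  exact ⟨hu, rfl, rfl⟩

theorem classify_map_snd : (classify K l).map Prod.snd = l := by
  rw [classify, List.map_map, List.map_map]
  exact List.map_id l

theorem classify_nodup (hl : (l.map Prod.fst).Nodup) : (classify K l).Nodup :=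
  List.Nodup.of_map Prod.snd (classify_map_snd.symm ▸ hl.of_map)

/-- The order of the terminals by decreasing demand. -/
def lexOrder (v : TItem) : ℚ ×ₗ ℕ := toLex (-v.2.2.2, v.2.1)

theorem before_iff {w v : TItem} : before w.2 v.2 = true ↔ lexOrder w < lexOrder v := by
  rw [before, lexOrder, lexOrder, Prod.Lex.toLex_lt_toLex]
  simp only [Bool.or_eq_true, Bool.and_eq_true, Bool.not_eq_true', ← Bool.not_eq_true, leB_iff,
    eqB_iff, not_le, Nat.cast_lt, neg_lt_neg_iff, neg_inj]

theorem eq_of_lexOrder_eq (hl : (l.map Prod.fst).Nodup) {u v : TItem} (hu : u ∈ classify K l)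
    (hv : v ∈ classify K l) (h : lexOrder u = lexOrder v) : u = v := by
  have h1 : u.2.1 = v.2.1 := congrArg (fun x : ℚ ×ₗ ℕ => (ofLex x).2) h
  have h2 : ((classify K l).map fun v => v.2.1).Nodup := by
    rw [← classify_map_snd (K := K) (l := l), List.map_map] at hl
    exact hl
  exact List.inj_on_of_nodup_map h2 hu hv h1

/-- The terminals in a cell. -/
def cell (K : ℕ) (l : List Item) (κ : Key) : Finset TItem :=
  ((classify K l).filter fun v => v.1.1 = κ).toFinset

theorem mem_cell {κ : Key} {v : TItem} : v ∈ cell K l κ ↔ v ∈ classify K l ∧ v.1.1 = κ := by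
  simp [cell]

theorem keyed_eq : keyed K l = (classify K l).map fun v => (v.1.1, v.2) := by
  rw [keyed, classify, List.map_map, List.map_map]
  rfl

theorem itemRank_eq (hl : (l.map Prod.fst).Nodup) (v : TItem) :
    itemRank K l v = ((cell K l v.1.1).filter fun w => lexOrder w < lexOrder v).card := by
  rw [itemRank, rank, keyed_eq, List.filter_map, List.length_map,
    ← List.toFinset_card_of_nodup ((classify_nodup hl).filter _)]
  congr 1
  ext w
  simp only [List.mem_toFinset, List.mem_filter, Function.comp_apply, Bool.and_eq_true, keyEq_iff,
    before_iff, Finset.mem_filter, mem_cell, and_assoc]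

theorem card_cell (hl : (l.map Prod.fst).Nodup) (κ : Key) :
    (cell K l κ).card = ((classify K l).filter fun v => v.1.1 = κ).length :=
  List.toFinset_card_of_nodup ((classify_nodup hl).filter _)

theorem itemClass_eq (hl : (l.map Prod.fst).Nodup) (κ : Key) :
    itemClass K l κ = (cell K l κ).card / K := by
  rw [itemClass, classSize, keyed_eq, List.filter_map, List.length_map, card_cell hl]
  congr 3
  ext w
  rw [Bool.eq_iff_iff, decide_eq_true_eq]
  exact keyEq_iff

theorem injOn_lexOrder (hl : (l.map Prod.fst).Nodup) (κ : Key) :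
    Set.InjOn lexOrder (cell K l κ : Set TItem) := fun _ hu _ hv h =>
  eq_of_lexOrder_eq hl (mem_cell.1 hu).1 (mem_cell.1 hv).1 h

theorem itemRank_inj (hl : (l.map Prod.fst).Nodup) {u v : TItem} (hu : u ∈ classify K l)
    (hv : v ∈ classify K l) (hk : u.1.1 = v.1.1) (h : itemRank K l u = itemRank K l v) :
    u = v := by
  rw [itemRank_eq hl, itemRank_eq hl, hk] at h
  exact eq_of_card_filter_eq lexOrder _ (injOn_lexOrder hl _) (mem_cell.2 ⟨hu, hk⟩)
    (mem_cell.2 ⟨hv, rfl⟩) h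

theorem itemRank_lt (hl : (l.map Prod.fst).Nodup) {v : TItem} (hv : v ∈ classify K l) :
    itemRank K l v < (cell K l v.1.1).card := by
  rw [itemRank_eq hl]
  exact Finset.card_lt_card
    (Finset.filter_ssubset.2 ⟨v, mem_cell.2 ⟨hv, rfl⟩, lt_irrefl _⟩)

theorem exists_itemRank_eq (hl : (l.map Prod.fst).Nodup) {v : TItem} (hv : v ∈ classify K l)
    {n : ℕ} (hn : n < itemRank K l v) :
    ∃ u ∈ classify K l, u.1.1 = v.1.1 ∧ itemRank K l u = n := by
  obtain ⟨u, hu, h⟩ := exists_card_filter_eq lexOrder _ (injOn_lexOrder hl v.1.1)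
    (hn.trans (itemRank_lt hl hv))
  obtain ⟨h1, h2⟩ := mem_cell.1 hu
  exact ⟨u, h1, h2, by rw [itemRank_eq hl, h2, h]⟩

theorem demand_le_of_itemRank_le (hl : (l.map Prod.fst).Nodup) {u w : TItem}
    (hw : w ∈ classify K l) (hk : u.1.1 = w.1.1)
    (h : itemRank K l u ≤ itemRank K l w) : w.2.2.2 ≤ u.2.2.2 := by
  by_contra hlt
  have h1 : lexOrder w < lexOrder u := by
    rw [lexOrder, lexOrder, Prod.Lex.toLex_lt_toLex]
    exact .inl (neg_lt_neg (not_le.1 hlt))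
  have h2 := card_filter_lt lexOrder _ (mem_cell.2 ⟨hw, rfl⟩) h1
  rw [itemRank_eq hl, itemRank_eq hl, hk] at h
  omega

/-- For a cell of `n` terminals and `s = n / K`: if `s ≥ 1` then `n < K (s + 1) ≤ 2 K s`, and if `s
= 0` the class is a rank below `n < K`. -/
theorem class_lt (hl : (l.map Prod.fst).Nodup) {v : TItem} (hK : 0 < K)
    (hv : v ∈ classify K l) : v.1.2 < 2 * K := by
  rw [(mem_classify hv).2.2, itemClass_eq hl]
  have h1 := itemRank_lt hl hv
  set n := (cell K l v.1.1).card
  have h2 := Nat.div_add_mod n K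
  have h3 := Nat.mod_lt n hK
  rw [Nat.div_lt_iff_lt_mul (by omega)]
  rcases Nat.eq_zero_or_pos (n / K) with h | h
  · rw [h] at h2 ⊢
    simp only [Nat.mul_zero, Nat.zero_max, Nat.mul_one] at *
    omega
  · rw [max_eq_left h]
    have := Nat.mul_le_mul_left K h
    have h4 : 2 * K * (n / K) = K * (n / K) + K * (n / K) := by ring
    omega

end Classify

section Types

/-- All relative types. -/
noncomputable def allTypes (K : ℕ) : Finset Typ :=
  ((Finset.Icc 0 (K : ℤ)) ×ˢ (Finset.Icc (-((K : ℤ) * K)) (K * K)) ×ˢ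
    (Finset.Icc (-((K : ℤ) * K)) (K * K))) ×ˢ Finset.range (2 * K)

theorem relType_mem {K : ℕ} (hK : 1 < K) (a : ℕ) {l : List Item} (hl : (l.map Prod.fst).Nodup)
    {v : TItem} (hv : v ∈ classify K l) : relType K a v ∈ allTypes K := by
  have h1 := keyOf_bounds hK v.2.2.1
  rw [← (mem_classify hv).2.1] at h1
  have h2 := class_lt hl (by omega) hv
  have h3 := Int.emod_nonneg (v.1.1.1 - a) (show (K : ℤ) ≠ 0 by omega)
  have h4 := Int.emod_lt_of_pos (v.1.1.1 - a) (show (0 : ℤ) < K by omega)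
  simp only [allTypes, Finset.mem_product, relType, Finset.mem_range]
  exact ⟨⟨Finset.mem_Icc.2 ⟨h3, h4.le⟩, h1⟩, h2⟩

/-- Existence suffices, since the list is a constant of the program and is not computed by it. -/
theorem exists_configurations (T : Finset Typ) (k : ℕ) :
    ∃ Cs : List (List Typ), Cs.Nodup ∧ ∀ c : List Typ, c.length ≤ k → (∀ τ ∈ c, τ ∈ T) → c ∈ Cs := by
  have h : ∀ k, ∃ Cs : Finset (List Typ), ∀ c : List Typ, c.length ≤ k → (∀ τ ∈ c, τ ∈ T) →
      c ∈ Cs := by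
    intro k
    induction k with
    | zero => exact ⟨{[]}, fun c hc _ => by simpa using hc⟩
    | succ k ih =>
      obtain ⟨Cs, h⟩ := ih
      refine ⟨insert [] ((T ×ˢ Cs).image fun x => x.1 :: x.2), fun c hc hT => ?_⟩
      cases c with
      | nil => exact Finset.mem_insert_self _ _
      | cons τ c =>
        rw [List.forall_mem_cons] at hT
        exact Finset.mem_insert_of_mem (Finset.mem_image.2 ⟨(τ, c),
          Finset.mem_product.2 ⟨hT.1, h c (by simpa using hc) hT.2⟩, rfl⟩)
  obtain ⟨Cs, h⟩ := h k
  exact ⟨Cs.toList, Cs.nodup_toList, fun c h1 h2 => Finset.mem_toList.2 (h c h1 h2)⟩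

end Types

end CVRP

/-! ### Feasibility of all candidates -/

namespace CVRP

open Machine

/-- The tours of `S` serve each element of `l` once, within the capacity. -/
def Packs (S : List (List TItem)) (l : List TItem) : Prop :=
  S.flatten.Perm l ∧ ∀ t ∈ S, (t.map fun v => v.2.2.2).sum ≤ 1

theorem flatten_map_singleton {α : Type*} (l : List α) : (l.map fun v => [v]).flatten = l := by
  induction l with
  | nil => rfl
  | cons a l ih => simp [ih]

theorem packs_singletons {l : List TItem} (h : ∀ v ∈ l, v.2.2.2 ≤ 1) :
    Packs (l.map fun v => [v]) l := by
  refine ⟨.of_eq (flatten_map_singleton l), fun t ht => ?_⟩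
  obtain ⟨v, hv, rfl⟩ := List.mem_map.1 ht
  simpa using h v hv

theorem Packs.append {S T : List (List TItem)} {l m : List TItem} (h : Packs S l)
    (h' : Packs T m) : Packs (S ++ T) (l ++ m) :=
  ⟨by simpa using h.1.append h'.1, fun t ht => (List.mem_append.1 ht).elim (h.2 t) (h'.2 t)⟩

theorem packs_flatMap {β : Type*} (L : List β) (S : β → List (List TItem)) (l : β → List TItem)
    (h : ∀ b ∈ L, Packs (S b) (l b)) : Packs (L.flatMap S) (L.flatMap l) := by
  induction L with
  | nil => exact ⟨.refl _, by simp⟩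
  | cons b L ih =>
    rw [List.forall_mem_cons] at h
    exact h.1.append (ih h.2)

theorem Packs.perm {S : List (List TItem)} {l m : List TItem} (h : Packs S l) (hlm : l.Perm m) :
    Packs S m := ⟨h.1.trans hlm, h.2⟩

theorem packs_splitTour {t : List TItem} (h : ∀ v ∈ t, v.2.2.2 ≤ 1) : Packs (splitTour t) t := by
  unfold splitTour
  by_cases hc : (t.map fun v => v.2.2.2).sum ≤ 1
  · rw [leB_iff.2 hc, cond_true]
    exact ⟨by simp, by simpa using hc⟩
  · rw [Bool.eq_false_iff.2 (mt leB_iff.1 hc), cond_false]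
    exact packs_singletons h

/-- Enumerated tours may violate the capacity, since types do not determine demands. Splitting those
makes every candidate feasible, independently of the cost analysis. -/
theorem packs_finish {x : List TItem × List (List TItem)} {l : List TItem}
    (hx : (x.2.flatten ++ x.1).Perm l) (h : ∀ v ∈ l, v.2.2.2 ≤ 1) : Packs (finish x) l := by
  have hx' : ∀ v ∈ x.2.flatten ++ x.1, v.2.2.2 ≤ 1 := fun v hv => h v (hx.mem_iff.1 hv)
  refine Packs.perm (.append ?_ ?_) hx
  · have := packs_flatMap x.2 splitTour (fun t => t) fun t ht => packs_splitTour fun v hv =>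
      hx' v (List.mem_append_left _ (List.mem_flatten_of_mem ht hv))
    refine this.perm (.of_eq ?_)
    simp [List.flatMap_def]
  · exact packs_singletons fun v hv => hx' v (List.mem_append_right _ hv)

theorem packs_best {K : ℕ} {S : List (List TItem)} {L : List (List (List TItem))} {l : List TItem}
    (hS : Packs S l) (hL : ∀ T ∈ L, Packs T l) : Packs (best K S L) l := by
  rcases best_mem K S L with h | h
  · rwa [h]
  · exact hL _ h

/-- Approximate costs never underestimate and overestimate by at most the stated factor, so one
selection loses this factor once. -/
theorem totalLength_best_le (K : ℕ) (S : List (List TItem)) {L : List (List (List TItem))}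
    {T : List (List TItem)} (hT : T ∈ L) :
    totalLength (best K S L) ≤ (1 + (1 / 2) ^ K) * totalLength T := by
  have h1 : (approxCost K (best K S L) : ℝ) ≤ approxCost K T := by
    exact_mod_cast (approxCost_best_le K S L).2 T hT
  exact (approxCost_bounds K _).1.trans (h1.trans (approxCost_bounds K T).2)

theorem packs_solveBlock (K a : ℕ) (Cs : List (List Typ)) {l : List TItem}
    (h : ∀ v ∈ l, v.2.2.2 ≤ 1) : Packs (solveBlock K a Cs l) l := by
  refine packs_best (packs_singletons h) fun T hT => ?_
  obtain ⟨x, hx, rfl⟩ := List.mem_map.1 hT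
  exact packs_finish (states_perm hx) h

theorem distinct_spec (l : List ℤ) : (distinct l).Nodup ∧ ∀ z, z ∈ distinct l ↔ z ∈ l := by
  have h : ∀ (l b : List ℤ), b.Nodup →
      (l.foldl (fun b (z : ℤ) =>
        bif leB (b.filter fun y : ℤ => eqB y z).length 0 then z :: b else b) b).Nodup ∧
      ∀ z, z ∈ l.foldl (fun b (z : ℤ) =>
        bif leB (b.filter fun y : ℤ => eqB y z).length 0 then z :: b else b) b ↔
          z ∈ b ∨ z ∈ l := by
    intro l
    induction l with
    | nil => intro b hb; simpa using hb
    | cons x l ih =>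
      intro b hb
      have hx : leB (b.filter fun y : ℤ => eqB y x).length 0 = true ↔ x ∉ b := by
        rw [leB_iff, Nat.cast_nonpos, List.length_eq_zero_iff, List.filter_eq_nil_iff]
        simp only [eqB_iff, Int.cast_inj]
        exact ⟨fun h hxb => h x hxb rfl, fun h y hy hyx => h (hyx ▸ hy)⟩
      rw [List.foldl_cons]
      by_cases hm : x ∈ b
      · rw [Bool.eq_false_iff.2 fun h => hx.1 h hm, cond_false]
        refine ⟨(ih b hb).1, fun z => ((ih b hb).2 z).trans ?_⟩
        rw [List.mem_cons]
        constructor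
        · tauto
        · rintro (h | rfl | h)
          exacts [.inl h, .inl hm, .inr h]
      · rw [hx.2 hm, cond_true]
        have h1 := ih (x :: b) (List.nodup_cons.2 ⟨hm, hb⟩)
        refine ⟨h1.1, fun z => (h1.2 z).trans ?_⟩
        rw [List.mem_cons, List.mem_cons]
        tauto
  have := h l [] List.nodup_nil
  exact ⟨this.1, fun z => (this.2 z).trans (by simp)⟩

theorem flatMap_filter_perm {α : Type*} (f : α → ℤ) {D : List ℤ} (hD : D.Nodup) {m : List α}
    (hm : ∀ v ∈ m, f v ∈ D) : (D.flatMap fun g : ℤ => m.filter fun v => eqB (f v) g).Perm m := by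
  induction D generalizing m with
  | nil =>
    cases m with
    | nil => exact .refl _
    | cons v m => simpa using hm v List.mem_cons_self
  | cons g D ih =>
    rw [List.nodup_cons] at hD
    have h1 := ih hD.2 (m := m.filter fun v => !eqB (f v) g) (by
      intro v hv
      rw [List.mem_filter] at hv
      refine (List.mem_cons.1 (hm v hv.1)).resolve_left fun h => ?_
      have h2 : eqB (f v) g = true := by rw [h, eqB_iff]
      simp [h2] at hv)
    have h2 : (D.flatMap fun g' : ℤ => m.filter fun v => eqB (f v) g') =
        D.flatMap fun g' : ℤ => (m.filter fun v => !eqB (f v) g).filter fun v => eqB (f v) g' := by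
      refine List.flatMap_congr fun g' hg' => ?_
      rw [List.filter_filter]
      refine List.filter_congr fun v _ => ?_
      by_cases h : eqB (f v) g' = true
      · have h3 : ¬ eqB (f v) g = true := by
          rw [eqB_iff] at h ⊢
          rw [h]
          exact fun h4 => hD.1 (Int.cast_injective h4 ▸ hg')
        simp [h, h3]
      · simp [h]
    rw [List.flatMap_cons, h2]
    exact (h1.append_left _).trans (List.filter_append_perm _ _)

theorem filter_blocks (K a : ℕ) (l : List TItem) (g : ℤ) :
    (l.filter fun v => !separates K a v && eqB (blockOf K a v) g) =
      (l.filter fun v => !separates K a v).filter fun v => eqB (blockOf K a v) g := by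
  rw [List.filter_filter]
  exact List.filter_congr fun v _ => Bool.and_comm _ _

theorem blocks_perm (K a : ℕ) (l : List TItem) {m : List TItem} (hm : ∀ v ∈ m, v ∈ l) :
    ((distinct ((l.filter fun v => !separates K a v).map (blockOf K a))).flatMap fun g : ℤ =>
      m.filter fun v => !separates K a v && eqB (blockOf K a v) g).Perm
      (m.filter fun v => !separates K a v) := by
  have h := distinct_spec ((l.filter fun v => !separates K a v).map (blockOf K a))
  simp only [filter_blocks]
  refine flatMap_filter_perm (blockOf K a) h.1 fun v hv => (h.2 _).2 (List.mem_map_of_mem ?_)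
  rw [List.mem_filter] at hv ⊢
  exact ⟨hm v hv.1, hv.2⟩

theorem packs_solveShift (K a : ℕ) (Cs : List (List Typ)) {l : List TItem}
    (h : ∀ v ∈ l, v.2.2.2 ≤ 1) : Packs (solveShift K a Cs l) l := by
  have hsub : ∀ p : TItem → Bool, ∀ v ∈ l.filter p, v.2.2.2 ≤ 1 := fun p v hv =>
    h v (List.mem_filter.1 hv).1
  have h1 := (packs_singletons (hsub fun v => separates K a v)).append
    ((packs_flatMap (distinct ((l.filter fun v => !separates K a v).map (blockOf K a)))
      (fun g => solveBlock K a Cs (l.filter fun v => !separates K a v && eqB (blockOf K a v) g))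
      _ fun g _ => packs_solveBlock K a Cs (hsub _)).perm (blocks_perm K a l fun _ h => h))
  exact h1.perm (List.filter_append_perm _ _)

theorem packs_solve (K : ℕ) (Cs : List (List Typ)) {l : List TItem}
    (h : ∀ v ∈ l, v.2.2.2 ≤ 1) : Packs (solve K Cs l) l := by
  refine packs_best (packs_singletons h) fun T hT => ?_
  obtain ⟨a, -, rfl⟩ := List.mem_map.1 hT
  exact packs_solveShift K a Cs h

end CVRP

/-! ### Cost of the solution in one block -/

namespace CVRP

open Machine

/-- The distance of a terminal from the depot. -/
noncomputable def rad (v : TItem) : ℝ := dist (toPlane (0, 0)) (itemPos v)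

theorem rad_nonneg (v : TItem) : 0 ≤ rad v := dist_nonneg

theorem totalLength_append (S T : List (List TItem)) :
    totalLength (S ++ T) = totalLength S + totalLength T := by simp [totalLength]

theorem tourLength_nil : tourLength [] = 0 := by simp [tourLength, walk_nil]

theorem tourLength_nonneg (t : List TItem) : 0 ≤ tourLength t := walk_nonneg _ _ _

theorem totalLength_nonneg (S : List (List TItem)) : 0 ≤ totalLength S :=
  List.sum_nonneg fun x hx => by
    obtain ⟨t, -, rfl⟩ := List.mem_map.1 hx
    exact tourLength_nonneg t

theorem tourLength_le_sum (t : List TItem) : tourLength t ≤ (t.map fun v => 2 * rad v).sum := by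
  have := walk_le_dist_add_sum (toPlane (0, 0)) (toPlane (0, 0)) (t.map itemPos)
  rw [dist_self, zero_add, List.map_map] at this
  exact this

theorem two_mul_rad_le {v : TItem} {t : List TItem} (h : v ∈ t) : 2 * rad v ≤ tourLength t :=
  two_mul_dist_le_walk (List.mem_map_of_mem h) _

theorem tourLength_sublist {s t : List TItem} (h : s.Sublist t) : tourLength s ≤ tourLength t :=
  walk_sublist (h.map _) _ _

theorem totalLength_singletons (l : List TItem) :
    totalLength (l.map fun v => [v]) = 2 * (l.map rad).sum := by
  rw [totalLength, List.map_map, ← List.sum_map_mul_left]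
  congr 1
  refine List.map_congr_left fun v _ => ?_
  simp only [Function.comp_apply, tourLength, List.map_cons, List.map_nil, walk_cons, walk_nil]
  rw [dist_comm (itemPos v), rad]
  ring

/-- Each of the at most `k` stops forces length `2 * rad`. This turns errors proportional to the sum
of the distances into relative errors. -/
theorem sum_rad_le {k : ℕ} {S : List (List TItem)} (hS : ∀ t ∈ S, t.length ≤ k) :
    2 * (S.flatten.map rad).sum ≤ k * totalLength S := by
  induction S with
  | nil => simp [totalLength]
  | cons t S ih =>
    rw [List.forall_mem_cons] at hS
    have h1 := ih hS.2
    have h2 : (t.map fun v => 2 * rad v).sum ≤ k * tourLength t := by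
      have h3 := List.sum_le_card_nsmul (t.map fun v => 2 * rad v) (tourLength t) (by
        intro x hx
        obtain ⟨v, hv, rfl⟩ := List.mem_map.1 hx
        exact two_mul_rad_le hv)
      rw [List.length_map, nsmul_eq_mul] at h3
      have h4 : (t.length : ℝ) ≤ k := by exact_mod_cast hS.1
      exact h3.trans (mul_le_mul_of_nonneg_right h4 (tourLength_nonneg t))
    rw [List.sum_map_mul_left] at h2
    have h5 : totalLength (t :: S) = tourLength t + totalLength S := by simp [totalLength]
    rw [h5, List.flatten_cons, List.map_append, List.sum_append]
    linarith

section Block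

variable {K : ℕ} {l : List Item}

/-- Quotient and remainder modulo `K` recover the scale. -/
theorem relType_inj {a : ℕ} {u w : TItem} (hb : blockOf K a u = blockOf K a w)
    (h : relType K a u = relType K a w) : u.1 = w.1 := by
  have h1 : (u.1.1.1 - (a : ℤ)) % K = (w.1.1.1 - a) % K := congrArg (fun x : Typ => x.1.1) h
  have h2 : (relType K a u).1.2 = (relType K a w).1.2 := by rw [h]
  have h3 : (relType K a u).2 = (relType K a w).2 := by rw [h]
  have h4 := Int.mul_ediv_add_emod (u.1.1.1 - a) K
  have h5 := Int.mul_ediv_add_emod (w.1.1.1 - a) K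
  unfold blockOf at hb
  rw [hb, h1, h5] at h4
  exact Prod.ext (Prod.ext (by omega) h2) h3

theorem totalLength_finish {x : List TItem × List (List TItem)}
    (h : ∀ t ∈ x.2, (t.map fun v => v.2.2.2).sum ≤ 1) :
    totalLength (finish x) = totalLength x.2 + 2 * (x.1.map rad).sum := by
  rw [finish, totalLength_append, totalLength_singletons]
  congr 2
  have : x.2.flatMap splitTour = x.2.flatMap fun t => [t] :=
    List.flatMap_congr fun t ht => by
      rw [splitTour, leB_iff.2 (h t ht), cond_true]
  rw [this]
  exact List.flatMap_singleton' x.2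

/-- The solution for a block is almost as good as any other one. -/
theorem totalLength_solveBlock_le (hK : 1 < K) (a k : ℕ) {Cs : List (List Typ)} (hCs : Cs.Nodup)
    (hCs' : ∀ c : List Typ, c.length ≤ k → (∀ τ ∈ c, τ ∈ allTypes K) → c ∈ Cs)
    (hl : (l.map Prod.fst).Nodup) (hpos : ∀ v ∈ l, 0 ≤ v.2.2) (g : ℤ) {G : List TItem}
    (hG : G = (classify K l).filter fun v => !separates K a v && eqB (blockOf K a v) g)
    {P : List (List TItem)} (hP : Packs P G) (hPk : ∀ t ∈ P, t.length ≤ k)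
    (hP0 : ∀ t ∈ P, t ≠ []) :
    totalLength (solveBlock K a Cs G) ≤
      (1 + (1 / 2) ^ K) * (totalLength P + 12 / K * (G.map rad).sum) := by
  have hK0 : (0 : ℝ) < K := by positivity
  have hK2 : (2 : ℝ) ≤ K := by exact_mod_cast hK
  have hGL : ∀ v ∈ G, v ∈ classify K l := fun v hv => by
    rw [hG] at hv; exact (List.mem_filter.1 hv).1
  have hblock : ∀ v ∈ G, blockOf K a v = g := fun v hv => by
    rw [hG] at hv
    have := (List.mem_filter.1 hv).2
    rw [Bool.and_eq_true, eqB_iff] at this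
    exact_mod_cast this.2
  -- The block depends on the cell only, so `G` consists of whole cells, and the ranks and class
  -- sizes of the full instance remain valid in it.
  have hsat : ∀ v ∈ G, ∀ u ∈ classify K l, u.1.1 = v.1.1 → u ∈ G := fun v hv u hu h => by
    rw [hG] at hv ⊢
    refine List.mem_filter.2 ⟨hu, ?_⟩
    have := (List.mem_filter.1 hv).2
    rw [← this]
    unfold separates blockOf relType
    rw [h]
  have hnd : G.Nodup := by rw [hG]; exact (classify_nodup hl).filter _
  have hinj : ∀ u ∈ G, ∀ w ∈ G, u.1.1 = w.1.1 → itemRank K l u = itemRank K l w → u = w :=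
    fun u hu w hw => itemRank_inj hl (hGL u hu) (hGL w hw)
  have hdown : ∀ v ∈ G, ∀ n < itemRank K l v,
      ∃ u ∈ G, u.1.1 = v.1.1 ∧ itemRank K l u = n := by
    intro v hv n hn
    obtain ⟨u, hu, h1, h2⟩ := exists_itemRank_eq hl (hGL v hv) hn
    exact ⟨u, hsat v hv u hu h1, h1, h2⟩
  have hs : ∀ v ∈ G, itemClass K l v.1.1 * K ≤ (G.filter fun w => w.1.1 = v.1.1).length := by
    intro v hv
    rw [itemClass_eq hl, card_cell hl]
    refine (Nat.div_mul_le_self _ _).trans (le_of_eq ?_)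
    rw [hG, List.filter_filter]
    congr 1
    refine List.filter_congr fun u hu => ?_
    by_cases h : u.1.1 = v.1.1
    · have := hsat v hv u hu h
      rw [hG] at this
      simp [h, (List.mem_filter.1 this).2]
    · simp [h]
  have hty : ∀ u ∈ G, ∀ w ∈ G, relType K a u = relType K a w → u.1.1 = w.1.1 ∧
      itemRank K l u / max (itemClass K l u.1.1) 1 =
        itemRank K l w / max (itemClass K l w.1.1) 1 := by
    intro u hu w hw h
    have h1 := relType_inj ((hblock u hu).trans (hblock w hw).symm) h
    refine ⟨by rw [h1], ?_⟩
    rw [← (mem_classify (hGL u hu)).2.2, ← (mem_classify (hGL w hw)).2.2, h1]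
  set cf := conf (fun v : TItem => v.1.1) (itemRank K l) (itemClass K l) G (relType K a) with hcf
  have hperm := conf_flatten_perm (s := itemClass K l) hnd hinj hdown (relType K a) hP.1
  have hPG : ∀ t ∈ P, ∀ u ∈ t, u ∈ G := fun t ht u hu =>
    hP.1.mem_iff.1 (List.mem_flatten_of_mem ht hu)
  -- Multiplicities are enumerated only up to the number of terminals; this suffices because the
  -- tours of `P` are nonempty.
  have hlen : (P.map cf).length ≤ G.length := by
    rw [List.length_map, ← hP.1.length_eq, List.length_flatten]
    have : ∀ S : List (List TItem), (∀ t ∈ S, t ≠ []) → S.length ≤ (S.map List.length).sum := by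
      intro S
      induction S with
      | nil => simp
      | cons t S ih =>
        intro h
        rw [List.forall_mem_cons] at h
        have h1 := ih h.2
        have h2 := List.length_pos_iff.2 h.1
        rw [List.length_cons, List.map_cons, List.sum_cons]
        omega
    exact this P hP0
  have hmem : ∀ c ∈ P.map cf, c ∈ Cs := by
    intro c hc
    obtain ⟨t, ht, rfl⟩ := List.mem_map.1 hc
    refine hCs' _ ((List.length_filterMap_le _ _).trans (hPk t ht)) fun τ hτ => ?_
    obtain ⟨u, -, hu⟩ := List.mem_filterMap.1 hτ
    obtain ⟨w, hw, rfl⟩ := Option.map_eq_some_iff.1 hu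
    exact relType_mem hK a hl (hGL w (shiftItem_spec hw).1)
  obtain ⟨x, hx, hxP⟩ := exists_mem_states hCs hmem hlen hperm
  obtain ⟨h1, h2, h3⟩ := replace_bounds hnd hinj hdown hs hty hP.1 (states_perm hx) hxP
    (O := toPlane (0, 0)) (pos := itemPos) (δ := 2 / K) (by positivity)
    (fun u hu w hw h => dist_le_of_keyOf_eq hK (by
      rw [← (mem_classify (hGL u hu)).2.1, ← (mem_classify (hGL w hw)).2.1, h]))
    (dem := fun v => v.2.2.2) (fun u hu => hpos _ (mem_classify (hGL u hu)).1)
    (fun u hu w hw hk hr => demand_le_of_itemRank_le hl (hGL w hw) hk hr) hP.2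
  have hbest := totalLength_best_le K (G.map fun v => [v])
    (L := (states (relType K a) Cs G).map finish) (List.mem_map_of_mem hx)
  refine hbest.trans (mul_le_mul_of_nonneg_left ?_ (by positivity))
  rw [totalLength_finish h2]
  have hr0 : 0 ≤ (G.map rad).sum := List.sum_nonneg fun y hy => by
    obtain ⟨v, -, rfl⟩ := List.mem_map.1 hy
    exact rad_nonneg v
  have h1' : totalLength x.2 ≤ totalLength P + 2 * (2 / K) * (G.map rad).sum := h1
  have h3' : K * (x.1.map rad).sum ≤ (1 + 2 / K) ^ 2 * (G.map rad).sum := h3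
  have h4 : (1 + 2 / (K : ℝ)) ^ 2 ≤ 4 := by
    have : 2 / (K : ℝ) ≤ 1 := by rwa [div_le_one hK0]
    have : 0 ≤ 2 / (K : ℝ) := by positivity
    nlinarith
  have h5 : (x.1.map rad).sum ≤ 4 / K * (G.map rad).sum := by
    rw [div_mul_eq_mul_div, le_div_iff₀ hK0, mul_comm]
    exact h3'.trans (mul_le_mul_of_nonneg_right h4 hr0)
  -- Of the `12`, the displaced stops account for `4` and the single tours through the remainder for
  -- `8`.
  have h6 : 12 / (K : ℝ) * (G.map rad).sum =
      2 * (2 / K) * (G.map rad).sum + 2 * (4 / K * (G.map rad).sum) := by ring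
  linarith

end Block

/-! ### Splitting tours among blocks -/

section Split

variable {K : ℕ} {l : List Item}

theorem rad_le_of_blockOf_ne (hK : 1 < K) (a : ℕ) {u v : TItem} (hu : u ∈ classify K l)
    (hv : v ∈ classify K l) (hus : separates K a u = false) (hvs : separates K a v = false)
    (hne : blockOf K a u ≠ blockOf K a v) (hle : rad u ≤ rad v) : rad u ≤ 2 / K * rad v := by
  have hsep : ∀ w : TItem, separates K a w = false → (w.1.1.1 - (a : ℤ)) % K ≠ 0 := by
    intro w hw h
    rw [← Bool.not_eq_true, separates, eqB_iff] at hw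
    exact hw (by rw [relType]; exact_mod_cast h)
  have hK' : (0 : ℤ) < K := by omega
  -- A separating scale lies between two blocks and contains neither terminal, so the scales differ
  -- by at least two.
  have key : ∀ u v : TItem, separates K a u = false → separates K a v = false →
      blockOf K a u < blockOf K a v → u.1.1.1 + 2 ≤ v.1.1.1 := by
    intro u v hu hv h
    unfold blockOf at h
    have h1 := Int.mul_ediv_add_emod (u.1.1.1 - a) K
    have h2 := Int.mul_ediv_add_emod (v.1.1.1 - a) K
    have h3 := Int.emod_lt_of_pos (u.1.1.1 - a) hK'
    have h4 := Int.emod_nonneg (v.1.1.1 - a) hK'.ne'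
    have h5 := hsep v hv
    have h6 := Int.mul_le_mul_of_nonneg_left (Int.add_one_le_of_lt h) hK'.le
    rw [Int.mul_add, Int.mul_one] at h6
    omega
  have hku := (mem_classify hu).2.1
  have hkv := (mem_classify hv).2.1
  by_cases hv0 : maxNorm v.2.2.1 = 0
  · have h1 : rad v ≤ 2 * (maxNorm v.2.2.1 : ℝ) := dist_zero_le_maxNorm _
    rw [hv0] at h1
    have h2 : rad v = 0 := le_antisymm (by simpa using h1) (rad_nonneg v)
    rw [h2] at hle ⊢
    simpa using hle
  · rcases lt_or_gt_of_ne hne with h | h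
    · exact dist_le_of_scale_le hK hv0 (by rw [← hku, ← hkv]; exact key u v hus hvs h)
    · by_cases hu0 : maxNorm u.2.2.1 = 0
      · have h1 : rad u ≤ 2 * (maxNorm u.2.2.1 : ℝ) := dist_zero_le_maxNorm _
        rw [hu0] at h1
        refine (h1.trans (by simp)).trans (mul_nonneg (by positivity) (rad_nonneg v))
      · have h1 : rad v ≤ 2 / K * rad u :=
          dist_le_of_scale_le hK hu0 (by rw [← hku, ← hkv]; exact key v u hvs hus h)
        have h2 : 2 / (K : ℝ) ≤ 1 := by
          rw [div_le_one (by positivity)]; exact_mod_cast hK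
        have h3 : 2 / (K : ℝ) * rad u ≤ 1 * rad u := mul_le_mul_of_nonneg_right h2 (rad_nonneg u)
        have h4 : rad u = rad v := by linarith
        rw [h4] at h1 ⊢
        exact h1

/-- Splitting a tour among the blocks of scales costs little. -/
theorem sum_tourLength_filter_le (hK : 1 < K) (a k : ℕ) {t : List TItem}
    (ht : ∀ v ∈ t, v ∈ classify K l) (htk : t.length ≤ k) :
    ((distinct (((classify K l).filter fun v => !separates K a v).map (blockOf K a))).map
      fun g : ℤ => tourLength (t.filter fun v => !separates K a v && eqB (blockOf K a v) g)).sum ≤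
      (1 + 2 * k / K) * tourLength t := by
  have hD := distinct_spec (((classify K l).filter fun v => !separates K a v).map (blockOf K a))
  have hperm := blocks_perm K a (classify K l) ht
  set D := distinct (((classify K l).filter fun v => !separates K a v).map (blockOf K a))
  set m := t.filter fun v => !separates K a v with hm
  have hmt : ∀ v ∈ m, v ∈ t ∧ separates K a v = false := by
    intro v hv
    rw [hm, List.mem_filter] at hv
    simpa using hv
  by_cases hm0 : m = []
  · have h0 : ∀ g : ℤ, (t.filter fun v => !separates K a v && eqB (blockOf K a v) g) = [] := by
      intro g
      rw [filter_blocks, ← hm, hm0, List.filter_nil]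
    simp only [h0, tourLength_nil]
    rw [List.sum_eq_zero (by simp)]
    exact mul_nonneg (by positivity) (tourLength_nonneg t)
  -- The block of the farthest terminal `z` is charged the whole tour. Every other terminal outside
  -- it is charged a round trip `2 * rad v ≤ 2 / K * (2 * rad z)`, at most `2 / K` times the tour.
  · obtain ⟨z, hz, hmax⟩ := m.toFinset.exists_max_image rad
      (by simpa [List.toFinset_nonempty_iff] using hm0)
    rw [List.mem_toFinset] at hz
    have hz' := hmt z hz
    let c : TItem → ℝ := fun v => if blockOf K a v = blockOf K a z then 0 else 2 * rad v
    have hc : ∀ v ∈ m, c v ≤ 2 / K * tourLength t := by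
      intro v hv
      have h0 := two_mul_rad_le hz'.1
      have hK0 : (0 : ℝ) ≤ 2 / K := by positivity
      by_cases h : blockOf K a v = blockOf K a z
      · simp only [c, if_pos h]
        exact mul_nonneg hK0 (tourLength_nonneg t)
      · simp only [c, if_neg h]
        have h1 := rad_le_of_blockOf_ne hK a (ht v (hmt v hv).1) (ht z hz'.1) (hmt v hv).2 hz'.2 h
          (hmax v (List.mem_toFinset.2 hv))
        have h2 := mul_le_mul_of_nonneg_left h0 hK0
        linarith
    have hsum : (m.map c).sum ≤ k * (2 / K * tourLength t) := by
      have h1 := List.sum_le_card_nsmul (m.map c) (2 / K * tourLength t) (by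
        intro x hx
        obtain ⟨v, hv, rfl⟩ := List.mem_map.1 hx
        exact hc v hv)
      rw [List.length_map, nsmul_eq_mul] at h1
      have h2 : (m.length : ℝ) ≤ k := by
        exact_mod_cast (List.length_filter_le _ _).trans htk
      exact h1.trans (mul_le_mul_of_nonneg_right h2
        (mul_nonneg (by positivity) (tourLength_nonneg t)))
    have hg : ∀ g : ℤ, tourLength (t.filter fun v => !separates K a v && eqB (blockOf K a v) g) ≤
        (if g = blockOf K a z then tourLength t else 0) +
        ((t.filter fun v => !separates K a v && eqB (blockOf K a v) g).map c).sum := by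
      intro g
      by_cases h : g = blockOf K a z
      · rw [if_pos h]
        have h0 : 0 ≤
            ((t.filter fun v => !separates K a v && eqB (blockOf K a v) g).map c).sum := by
          refine List.sum_nonneg fun x hx => ?_
          obtain ⟨v, -, rfl⟩ := List.mem_map.1 hx
          simp only [c]
          split_ifs
          · exact le_rfl
          · linarith [rad_nonneg v]
        linarith [tourLength_sublist (List.filter_sublist (l := t)
          (p := fun v => !separates K a v && eqB (blockOf K a v) g))]
      · rw [if_neg h, zero_add]
        refine (tourLength_le_sum _).trans (le_of_eq ?_)
        congr 1
        refine List.map_congr_left fun v hv => ?_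
        have h1 := (List.mem_filter.1 hv).2
        rw [Bool.and_eq_true, eqB_iff] at h1
        have h2 : blockOf K a v = g := by exact_mod_cast h1.2
        simp only [c]
        rw [if_neg (by rw [h2]; exact h)]
    have hflat : (D.map fun g : ℤ =>
        ((t.filter fun v => !separates K a v && eqB (blockOf K a v) g).map c).sum).sum =
        (m.map c).sum := by
      rw [← (hperm.map c).sum_eq, List.flatMap_def, List.map_flatten, List.sum_flatten,
        List.map_map, List.map_map]
      rfl
    have hone : ∀ D : List ℤ, D.Nodup →
        (D.map fun g => if g = blockOf K a z then tourLength t else 0).sum ≤ tourLength t := by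
      intro D
      induction D with
      | nil => intro _; simpa using tourLength_nonneg t
      | cons g D ih =>
        intro hD
        rw [List.nodup_cons] at hD
        rw [List.map_cons, List.sum_cons]
        by_cases h : g = blockOf K a z
        · rw [if_pos h, List.sum_eq_zero, add_zero]
          intro x hx
          obtain ⟨y, hy, rfl⟩ := List.mem_map.1 hx
          rw [if_neg]
          rintro rfl
          exact hD.1 (h ▸ hy)
        · rw [if_neg h, zero_add]
          exact ih hD.2
    have h1 := List.sum_le_sum (l := D) fun g _ => hg g
    rw [List.sum_map_add, hflat] at h1
    have h2 := hone D hD.1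
    have h3 : (1 + 2 * k / (K : ℝ)) * tourLength t =
      tourLength t + k * (2 / K * tourLength t) := by ring
    linarith

end Split

end CVRP

/-! ### Combining the blocks and choosing the shift -/

namespace CVRP

open Machine

section Bounds

variable {K : ℕ} {l : List Item}

theorem totalLength_flatMap {β : Type*} (D : List β) (f : β → List (List TItem)) :
    totalLength (D.flatMap f) = (D.map fun g => totalLength (f g)).sum := by
  induction D with
  | nil => rfl
  | cons g D ih => rw [List.flatMap_cons, totalLength_append, ih, List.map_cons, List.sum_cons]

theorem totalLength_filter_ne_nil (S : List (List TItem)) :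
    totalLength (S.filter fun t => !t.isEmpty) = totalLength S := by
  induction S with
  | nil => rfl
  | cons t S ih =>
    have h1 : totalLength (t :: S) = tourLength t + totalLength S := by simp [totalLength]
    cases t with
    | nil =>
      rw [h1, tourLength_nil, zero_add, ← ih]
      rfl
    | cons v t =>
      rw [List.filter_cons_of_pos (by rfl), h1, ← ih]
      simp [totalLength]

theorem flatten_filter_ne_nil {α : Type*} (S : List (List α)) :
    (S.filter fun t => !t.isEmpty).flatten = S.flatten := by
  induction S with
  | nil => rfl
  | cons t S ih => cases t <;> simp [ih]

theorem sum_map_sum_comm {β γ : Type*} (D : List β) (P : List γ) (f : β → γ → ℝ) :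
    (D.map fun g => (P.map (f g)).sum).sum = (P.map fun t => (D.map fun g => f g t).sum).sum := by
  induction D with
  | nil => simp
  | cons g D ih => simp only [List.map_cons, List.sum_cons, ih, List.sum_map_add]

theorem totalLength_solveShift_le (hK : 1 < K) (a k : ℕ) {Cs : List (List Typ)} (hCs : Cs.Nodup)
    (hCs' : ∀ c : List Typ, c.length ≤ k → (∀ τ ∈ c, τ ∈ allTypes K) → c ∈ Cs)
    (hl : (l.map Prod.fst).Nodup) (hpos : ∀ v ∈ l, 0 ≤ v.2.2)
    {P : List (List TItem)} (hP : Packs P (classify K l)) (hPk : ∀ t ∈ P, t.length ≤ k) :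
    totalLength (solveShift K a Cs (classify K l)) ≤
      2 * (((classify K l).filter fun v => separates K a v).map rad).sum +
        (1 + (1 / 2) ^ K) * ((1 + 2 * k / K) * totalLength P +
          12 / K * ((classify K l).map rad).sum) := by
  rw [solveShift, totalLength_append, totalLength_singletons, totalLength_flatMap]
  refine add_le_add le_rfl ?_
  have hPL : ∀ t ∈ P, ∀ v ∈ t, v ∈ classify K l := fun t ht v hv =>
    hP.1.mem_iff.1 (List.mem_flatten_of_mem ht hv)
  have hperm := blocks_perm K a (classify K l) fun _ h => h
  have hsplit : ∀ t ∈ P, _ := fun t ht =>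
    sum_tourLength_filter_le hK a k (hPL t ht) (hPk t ht)
  set D := distinct (((classify K l).filter fun v => !separates K a v).map (blockOf K a))
  let q : ℤ → TItem → Bool := fun g v => !separates K a v && eqB (blockOf K a v) g
  have hg : ∀ g ∈ D, totalLength (solveBlock K a Cs ((classify K l).filter (q g))) ≤
      (1 + (1 / 2) ^ K) * ((P.map fun t => tourLength (t.filter (q g))).sum +
        12 / K * (((classify K l).filter (q g)).map rad).sum) := by
    intro g _
    -- A tour that misses the block becomes empty and is dropped, as the bound for a block needs
    -- nonempty tours.
    have h1 := totalLength_solveBlock_le (P := (P.map (List.filter (q g))).filter fun t => !t.isEmpty)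
      hK a k hCs hCs' hl hpos g rfl ⟨?_, ?_⟩ ?_ ?_
    · rw [totalLength_filter_ne_nil] at h1
      have h2 : totalLength (P.map (List.filter (q g))) =
          (P.map fun t => tourLength (t.filter (q g))).sum := by
        rw [totalLength, List.map_map]; rfl
      rw [h2] at h1
      exact h1
    · rw [flatten_filter_ne_nil, ← List.filter_flatten]
      exact hP.1.filter _
    · intro t ht
      obtain ⟨t, ht', rfl⟩ := List.mem_map.1 (List.mem_filter.1 ht).1
      refine (List.Sublist.sum_le_sum (List.filter_sublist.map _) fun x hx => ?_).trans (hP.2 t ht')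
      obtain ⟨v, hv, rfl⟩ := List.mem_map.1 hx
      exact hpos _ (mem_classify (hPL t ht' v hv)).1
    · intro t ht
      obtain ⟨t, ht', rfl⟩ := List.mem_map.1 (List.mem_filter.1 ht).1
      exact (List.length_filter_le _ _).trans (hPk t ht')
    · intro t ht
      simpa using (List.mem_filter.1 ht).2
  have h1 := List.sum_le_sum hg
  rw [List.sum_map_mul_left, List.sum_map_add, sum_map_sum_comm, List.sum_map_mul_left] at h1
  refine h1.trans (mul_le_mul_of_nonneg_left (add_le_add ?_ ?_) (by positivity))
  · have h2 := List.sum_le_sum hsplit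
    rw [List.sum_map_mul_left] at h2
    exact h2
  · refine mul_le_mul_of_nonneg_left ?_ (by positivity)
    have h2 : (D.map fun g => (((classify K l).filter (q g)).map rad).sum).sum =
        (((classify K l).filter fun v => !separates K a v).map rad).sum := by
      rw [← (hperm.map rad).sum_eq, List.flatMap_def, List.map_flatten, List.sum_flatten,
        List.map_map, List.map_map]
      rfl
    rw [h2]
    refine List.Sublist.sum_le_sum (List.filter_sublist.map _) fun x hx => ?_
    obtain ⟨v, -, rfl⟩ := List.mem_map.1 hx
    exact rad_nonneg v

/-- Some shift separates the blocks at terminals that are close to the depot on average. -/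
theorem exists_shift (hK : 0 < K) (L : List TItem) :
    ∃ a ∈ List.range K, K * ((L.filter fun v => separates K a v).map rad).sum ≤
      (L.map rad).sum := by
  have hsep : ∀ (v : TItem) (a : ℕ), separates K a v = true → (K : ℤ) ∣ v.1.1.1 - a := by
    intro v a h
    rw [separates, eqB_iff] at h
    exact Int.dvd_of_emod_eq_zero (by exact_mod_cast h)
  -- The scale of a terminal is congruent to at most one `a < K`, so each terminal is counted at
  -- most once; some shift is then no worse than the average.
  have h : ∑ a ∈ Finset.range K, ((L.filter fun v => separates K a v).map rad).sum ≤
      (L.map rad).sum := by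
    induction L with
    | nil => simp
    | cons v L ih =>
      have h1 : ∀ a, (((v :: L).filter fun v => separates K a v).map rad).sum =
          (if separates K a v then rad v else 0) +
            ((L.filter fun v => separates K a v).map rad).sum := by
        intro a
        rw [List.filter_cons]
        split_ifs <;> simp
      simp only [h1, Finset.sum_add_distrib, List.map_cons, List.sum_cons]
      refine add_le_add ?_ ih
      by_cases hex : ∃ b ∈ Finset.range K, separates K b v = true
      · obtain ⟨b, hb, hbv⟩ := hex
        rw [Finset.sum_eq_single_of_mem b hb]
        · rw [if_pos hbv]
        · intro a ha hab
          rw [if_neg]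
          intro hav
          have h2 := dvd_sub (hsep v a hav) (hsep v b hbv)
          rw [Finset.mem_range] at ha hb
          have h3 := Int.eq_zero_of_abs_lt_dvd h2 (by rw [abs_lt]; constructor <;> omega)
          omega
      · rw [Finset.sum_eq_zero]
        · exact rad_nonneg v
        · intro a ha
          exact if_neg fun h => hex ⟨a, ha, h⟩
  by_contra! hlt
  have h2 : ∑ a ∈ Finset.range K, (L.map rad).sum <
      ∑ a ∈ Finset.range K, K * ((L.filter fun v => separates K a v).map rad).sum :=
    Finset.sum_lt_sum_of_nonempty ⟨0, Finset.mem_range.2 hK⟩ fun a ha =>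
      hlt a (List.mem_range.2 (Finset.mem_range.1 ha))
  rw [Finset.sum_const, Finset.card_range, nsmul_eq_mul, ← Finset.mul_sum] at h2
  exact absurd (mul_le_mul_of_nonneg_left h (Nat.cast_nonneg K)) (not_le.2 h2)

/-- The `9` is `1` for the separating terminals, `2` for splitting tours among blocks and `6` for
rounding, using `sum_rad_le`. The square stems from two nested selections, of the states and of the
shift. -/
theorem totalLength_solve_le (hK : 1 < K) (k : ℕ) {Cs : List (List Typ)} (hCs : Cs.Nodup)
    (hCs' : ∀ c : List Typ, c.length ≤ k → (∀ τ ∈ c, τ ∈ allTypes K) → c ∈ Cs)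
    (hl : (l.map Prod.fst).Nodup) (hpos : ∀ v ∈ l, 0 ≤ v.2.2)
    {P : List (List TItem)} (hP : Packs P (classify K l)) (hPk : ∀ t ∈ P, t.length ≤ k) :
    totalLength (solve K Cs (classify K l)) ≤
      (1 + (1 / 2) ^ K) ^ 2 * (1 + 9 * k / K) * totalLength P := by
  obtain ⟨a, ha, hsep⟩ := exists_shift (by omega : 0 < K) (classify K l)
  have h1 := totalLength_solveShift_le hK a k hCs hCs' hl hpos hP hPk
  have h2 := totalLength_best_le K ((classify K l).map fun v => [v])
    (L := (List.range K).map fun a => solveShift K a Cs (classify K l))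
    (List.mem_map.2 ⟨a, ha, rfl⟩)
  have h3 := sum_rad_le hPk
  rw [(hP.1.map rad).sum_eq] at h3
  have hK0 : (0 : ℝ) < K := by positivity
  have hη : (0 : ℝ) ≤ (1 / 2) ^ K := by positivity
  set η : ℝ := (1 / 2) ^ K
  set R := ((classify K l).map rad).sum
  set Q := (((classify K l).filter fun v => separates K a v).map rad).sum
  have hT := totalLength_nonneg P
  set T := totalLength P
  have h4 : 2 * Q ≤ k / K * T := by
    rw [div_mul_eq_mul_div, le_div_iff₀ hK0]
    linarith
  have h5 : 12 / K * R ≤ 6 * k / K * T := by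
    have : 12 / K * R = 6 / K * (2 * R) := by ring
    rw [this]
    calc 6 / K * (2 * R) ≤ 6 / K * (k * T) := mul_le_mul_of_nonneg_left h3 (by positivity)
      _ = 6 * k / K * T := by ring
  refine h2.trans ?_
  rw [pow_two, mul_assoc (1 + η), mul_assoc (1 + η)]
  refine mul_le_mul_of_nonneg_left (h1.trans ?_) (by linarith)
  have h6 : 0 ≤ k / K * T := by positivity
  have h7 : k / K * T ≤ (1 + η) * (k / K * T) := by nlinarith
  calc _ ≤ (1 + η) * (k / K * T) + (1 + η) * ((1 + 2 * k / K) * T + 6 * k / K * T) :=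
        add_le_add (h4.trans h7) (mul_le_mul_of_nonneg_left (by linarith) (by linarith))
    _ = _ := by ring

end Bounds

end CVRP

/-! ### Translation between instances and lists of terminals -/

namespace CVRP

open Machine

section Input

theorem enum_append_singleton {α : Type} (l : List α) (x : α) :
    enum (l ++ [x]) = ((enum l).length + 1, x) :: enum l := by
  rw [enum, List.foldl_append]
  rfl

theorem length_enum {α : Type} (l : List α) : (enum l).length = l.length := by
  induction l using List.reverseRecOn with
  | nil => rfl
  | append_singleton l x ih => rw [enum_append_singleton, List.length_cons, ih]; simp

theorem enum_ofFn_perm {α : Type} {n : ℕ} (f : Fin n → α) :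
    (enum (List.ofFn f)).Perm ((List.finRange n).map fun i : Fin n => ((i : ℕ) + 1, f i)) := by
  induction n with
  | zero => simp [enum]
  | succ n ih =>
    rw [List.ofFn_succ_last, enum_append_singleton, length_enum, List.length_ofFn,
      List.finRange_succ_last, List.map_append, List.map_map]
    exact ((ih fun i => f i.castSucc).cons _).trans (List.perm_append_singleton _ _).symm

variable (I : Instance)

/-- The data of an instance. -/
def inputOf : (ℚ × ℚ) × List ((ℚ × ℚ) × ℚ) :=
  (I.depot, List.ofFn fun v => (I.loc v, I.demand v))

theorem encode_eq : I.encode = Enc.enc (inputOf I) := by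
  simp only [Instance.encode, Enc.enc, inputOf, List.map_ofFn]
  rfl

/-- The data of a terminal. -/
def itemOf (i : Fin I.n) : Item :=
  ((i : ℕ) + 1, ((I.loc i).1 - I.depot.1, (I.loc i).2 - I.depot.2), I.demand i)

theorem items_perm : (items (inputOf I)).Perm ((List.finRange I.n).map (itemOf I)) := by
  have := (enum_ofFn_perm fun v => (I.loc v, I.demand v)).map
    fun e : ℕ × (ℚ × ℚ) × ℚ => (e.1, (e.2.1.1 - I.depot.1, e.2.1.2 - I.depot.2), e.2.2)
  rw [List.map_map] at this
  exact this

theorem items_nodup : ((items (inputOf I)).map Prod.fst).Nodup := by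
  rw [((items_perm I).map Prod.fst).nodup_iff, List.map_map]
  refine (List.nodup_finRange I.n).map fun i j h => ?_
  have : (i : ℕ) + 1 = j + 1 := h
  exact Fin.ext (by omega)

theorem mem_items {v : Item} (hv : v ∈ items (inputOf I)) : 0 ≤ v.2.2 ∧ v.2.2 ≤ 1 := by
  obtain ⟨i, -, rfl⟩ := List.mem_map.1 ((items_perm I).mem_iff.1 hv)
  exact ⟨(I.demand_pos i).le, I.demand_le_one i⟩

/-- The terminal `i` with its type. -/
def typedItem (K : ℕ) (i : Fin I.n) : TItem :=
  ((keyOf K (itemOf I i).2.1, rank (keyed K (items (inputOf I)))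
    (keyOf K (itemOf I i).2.1, itemOf I i) /
      max (classSize K (keyed K (items (inputOf I))) (keyOf K (itemOf I i).2.1)) 1), itemOf I i)

theorem classify_perm (K : ℕ) :
    (classify K (items (inputOf I))).Perm ((List.finRange I.n).map (typedItem I K)) := by
  rw [classify, List.map_map]
  have := (items_perm I).map ((fun v => ((v.1, rank (keyed K (items (inputOf I))) v /
      max (classSize K (keyed K (items (inputOf I))) v.1) 1), v.2)) ∘
      fun v : Item => (keyOf K v.2.1, v))
  rw [List.map_map] at this
  exact this

theorem typedItem_injective (K : ℕ) : Function.Injective (typedItem I K) := by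
  intro i j h
  have : (i : ℕ) + 1 = j + 1 := congrArg (fun v : TItem => v.2.1) h
  exact Fin.ext (by omega)

end Input

section Length

variable (I : Instance)

theorem walk_congr {α E F : Type*} [MetricSpace E] [MetricSpace F] {f : α → E} {g : α → F}
    (h : ∀ a b, dist (f a) (f b) = dist (g a) (g b)) (x z : α) (l : List α) :
    walk (f x) (l.map f) (f z) = walk (g x) (l.map g) (g z) := by
  induction l generalizing x with
  | nil => simp [walk_nil, h]
  | cons a l ih => rw [List.map_cons, List.map_cons, walk_cons, walk_cons, ih, h]

theorem tourCost_eq (t : Tour I.n) :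
    I.tourCost t = walk (I.pos none) (t.route.map I.pos) (I.pos none) := by
  simp [Instance.tourCost, walk]

/-- Moving the depot to the origin is an isometry. -/
theorem tourLength_map_typedItem (K : ℕ) (t : List (Fin I.n)) :
    tourLength (t.map (typedItem I K)) =
      walk (I.pos none) ((t.map some).map I.pos) (I.pos none) := by
  let g : Vertex I.n → EuclideanSpace ℝ (Fin 2) := fun v =>
    match v with
    | none => toPlane (0, 0)
    | some i => toPlane (itemOf I i).2.1
  have h : ∀ a b, dist (g a) (g b) = dist (I.pos a) (I.pos b) := by
    intro a b
    cases a <;> cases b <;> simp only [g, Instance.pos, dist_toPlane, itemOf] <;>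
      congr 1 <;> push_cast <;> ring
  rw [← walk_congr h none none (t.map some), List.map_map, tourLength, List.map_map]
  rfl

end Length

section Solutions

variable (I : Instance)

/-- Drop from the route the visits to the depot, repeated visits and the terminals that are not
covered; by `walk_sublist` this does not lengthen the tour. -/
theorem exists_perm_sublist {β : Type*} [DecidableEq β] {route : List (Option β)} {covered : List β}
    (hc : covered.Nodup) (h : ∀ v ∈ covered, some v ∈ route) :
    ∃ t : List β, t.Perm covered ∧ (t.map some).Sublist route := by
  refine ⟨route.reduceOption.dedup.filter fun v => v ∈ covered, ?_, ?_⟩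
  · rw [List.perm_ext_iff_of_nodup ((List.nodup_dedup _).filter _) hc]
    intro v
    simp only [List.mem_filter, List.mem_dedup, List.reduceOption_mem_iff, decide_eq_true_eq]
    exact ⟨fun hv => hv.2, fun hv => ⟨h v hv, hv⟩⟩
  · have h1 : (route.reduceOption.map some).Sublist route := by
      clear h
      induction route with
      | nil => exact .slnil
      | cons a l ih =>
        cases a with
        | none => exact ih.cons none
        | some a => exact ih.cons_cons (some a)
    exact ((List.filter_sublist.trans (List.dedup_sublist _)).map some).trans h1

/-- The tours of a feasible solution as lists of the terminals that they cover. -/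
theorem exists_packs (K : ℕ) {S : Solution I.n} (hS : I.Feasible S) :
    ∃ P : List (List TItem), Packs P (classify K (items (inputOf I))) ∧
      totalLength P ≤ I.cost S := by
  have hnd : (S.flatMap Tour.covered).Nodup :=
    List.nodup_iff_count_le_one.2 fun v => (hS.covers v).le
  have hex : ∀ t : Tour I.n, ∃ u : List (Fin I.n), t ∈ S → u.Perm t.covered ∧
      (u.map some).Sublist t.route := by
    intro t
    by_cases ht : t ∈ S
    · have h1 : t.covered.Nodup :=
        (List.nodup_flatMap.1 hnd).1 t ht
      obtain ⟨u, hu⟩ := exists_perm_sublist h1 (hS.visits t ht)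
      exact ⟨u, fun _ => hu⟩
    · exact ⟨[], fun h => absurd h ht⟩
  choose u hu using hex
  refine ⟨S.map fun t => (u t).map (typedItem I K), ⟨?_, ?_⟩, ?_⟩
  · refine .trans ?_ (classify_perm I K).symm
    have h1 : (S.map fun t => (u t).map (typedItem I K)).flatten =
        (S.flatMap u).map (typedItem I K) := by
      rw [List.flatMap_def, List.map_flatten, List.map_map]; rfl
    rw [h1]
    refine List.Perm.map _ ?_
    have h2 : (S.flatMap u).Perm (S.flatMap Tour.covered) := by
      have : ∀ L : List (Tour I.n), (∀ t ∈ L, t ∈ S) →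
          (L.flatMap u).Perm (L.flatMap Tour.covered) := by
        intro L
        induction L with
        | nil => exact fun _ => .refl _
        | cons t L ih =>
          intro hL
          rw [List.forall_mem_cons] at hL
          rw [List.flatMap_cons, List.flatMap_cons]
          exact (hu t hL.1).1.append (ih hL.2)
      exact this S fun _ h => h
    refine h2.trans ((List.perm_ext_iff_of_nodup hnd (List.nodup_finRange _)).2 fun v => ?_)
    refine ⟨fun _ => List.mem_finRange v, fun _ => List.count_pos_iff.1 ?_⟩
    rw [hS.covers v]
    exact one_pos
  · intro t ht
    obtain ⟨t, ht', rfl⟩ := List.mem_map.1 ht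
    rw [List.map_map]
    refine le_trans (le_of_eq ?_) (hS.capacity t ht')
    exact ((hu t ht').1.map I.demand).sum_eq
  · rw [totalLength, List.map_map, Instance.cost]
    refine List.sum_le_sum fun t ht => ?_
    rw [Function.comp_apply, tourLength_map_typedItem, tourCost_eq]
    exact walk_sublist ((hu t ht).2.map _) _ _

/-- A packing gives a feasible solution. -/
theorem exists_solution (K : ℕ) {P : List (List TItem)}
    (hP : Packs P (classify K (items (inputOf I)))) :
    ∃ S : Solution I.n, I.Feasible S ∧ I.cost S = totalLength P ∧ Solution.encode S =
      Enc.enc (P.map fun t => (t.map fun v => v.2.1, t.map fun v => v.2.1)) := by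
  have hperm := hP.1.trans (classify_perm I K)
  -- Each entry of `P` comes from a terminal, so `P` lifts to lists of indices.
  have h1 : P ∈ Set.range (List.map (List.map (typedItem I K))) := by
    rw [Set.range_list_map]
    intro t ht
    rw [Set.range_list_map]
    intro v hv
    obtain ⟨i, -, h⟩ := List.mem_map.1 (hperm.mem_iff.1 (List.mem_flatten_of_mem ht hv))
    exact ⟨i, h⟩
  obtain ⟨Q, rfl⟩ := h1
  have hQ : Q.flatten.Perm (List.finRange I.n) := by
    rw [← List.map_flatten] at hperm
    exact (List.map_perm_map_iff (typedItem_injective I K)).1 hperm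
  refine ⟨Q.map fun t => ⟨t.map some, t⟩, ⟨?_, ?_, ?_⟩, ?_, ?_⟩
  · intro t ht v hv
    obtain ⟨t, -, rfl⟩ := List.mem_map.1 ht
    exact List.mem_map_of_mem hv
  · intro v
    have h2 : (Q.map fun t => (⟨t.map some, t⟩ : Tour I.n)).flatMap Tour.covered = Q.flatten := by
      rw [List.flatMap_def, List.map_map]
      exact congrArg List.flatten (List.map_id Q)
    rw [h2, hQ.count_eq]
    exact List.count_eq_one_of_mem (List.nodup_finRange _) (List.mem_finRange v)
  · intro t ht
    obtain ⟨t, ht', rfl⟩ := List.mem_map.1 ht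
    have h2 := hP.2 _ (List.mem_map_of_mem ht')
    rw [List.map_map] at h2
    exact h2
  · rw [Instance.cost, totalLength, List.map_map, List.map_map]
    congr 1
    refine List.map_congr_left fun t _ => ?_
    rw [Function.comp_apply, Function.comp_apply, tourCost_eq, tourLength_map_typedItem]
  · simp only [Solution.encode, Enc.enc, List.map_map]
    congr 1
    refine List.map_congr_left fun t _ => ?_
    simp only [Function.comp_apply, Tour.encode, List.map_map]
    rfl

end Solutions

theorem length_le_of_demand {ε : ℝ} {k : ℕ} (hk : 0 < ε) (hkε : 1 / ε ≤ k) {t : List TItem}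
    (ht : ∀ v ∈ t, ε ≤ (v.2.2.2 : ℝ)) (hcap : (t.map fun v => v.2.2.2).sum ≤ 1) :
    t.length ≤ k := by
  have h1 : (t.length : ℝ) * ε ≤ ((t.map fun v => v.2.2.2).sum : ℚ) := by
    clear hcap
    induction t with
    | nil => simp
    | cons v t ih =>
      rw [List.forall_mem_cons] at ht
      have := ih ht.2
      rw [List.map_cons, List.sum_cons, List.length_cons, Rat.cast_add]
      push_cast at this ⊢
      linarith [ht.1]
  have h2 : (((t.map fun v => v.2.2.2).sum : ℚ) : ℝ) ≤ 1 := by exact_mod_cast hcap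
  have h3 : (t.length : ℝ) ≤ k := by
    refine le_trans ?_ hkε
    rw [le_div_iff₀ hk]
    linarith
  exact_mod_cast h3

/-- With `K = 100 k²`, both `2^(-K)` and `k / K` are at most `1 / (100 k)`. The first-order error is
then `11 / (100 k)`, which leaves ample room for the products. -/
theorem constants_bound {k : ℕ} (hk : 0 < k) :
    (1 + (1 / 2 : ℝ) ^ (100 * k ^ 2)) ^ 2 * (1 + 9 * k / ((100 * k ^ 2 : ℕ) : ℝ)) ≤ 1 + 1 / k := by
  have hk1 : (1 : ℝ) ≤ k := by exact_mod_cast hk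
  have hη : (1 / 2 : ℝ) ^ (100 * k ^ 2) ≤ 1 / (100 * k) := by
    rw [one_div_pow]
    refine one_div_le_one_div_of_le (by positivity) ?_
    have h1 : 100 * k < 2 ^ (100 * k ^ 2) := by
      refine lt_of_le_of_lt ?_ Nat.lt_two_pow_self
      have := Nat.le_self_pow two_ne_zero k
      omega
    exact_mod_cast h1.le
  have h0 : (0 : ℝ) ≤ (1 / 2 : ℝ) ^ (100 * k ^ 2) := by positivity
  set x : ℝ := 1 / k with hx
  have hx0 : 0 < x := by positivity
  have hx1 : x ≤ 1 := by rw [hx, div_le_one (by positivity)]; exact hk1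
  have h2 : 1 / (100 * (k : ℝ)) = x / 100 := by rw [hx]; ring
  have h3 : 9 * k / ((100 * k ^ 2 : ℕ) : ℝ) = 9 * x / 100 := by
    rw [hx]; push_cast; field_simp
  rw [h3]
  rw [h2] at hη
  calc _ ≤ (1 + x / 100) ^ 2 * (1 + 9 * x / 100) :=
        mul_le_mul_of_nonneg_right (pow_le_pow_left₀ (by positivity) (by linarith) 2)
          (by positivity)
    _ ≤ 1 + x := by nlinarith [mul_pos hx0 hx0, mul_pos (mul_pos hx0 hx0) hx0,
          mul_le_mul_of_nonneg_left hx1 hx0.le,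
          mul_le_mul_of_nonneg_left hx1 (mul_pos hx0 hx0).le]

end CVRP

/-- For every `ε > 0` there is a polynomial-time `(1 + ε)`-approximation algorithm for the
unsplittable Euclidean capacitated vehicle routing problem on instances all of whose terminals
have demand at least `ε`. -/
theorem theorem2 (ε : ℝ) (hε : 0 < ε) :
    ∃ A : Machine.Program,
      CVRP.IsPolyTimeApproxAlgorithm A (fun I => I.AllBig ε) (1 + ε) := by
  obtain ⟨k, hkε, hk⟩ : ∃ k : ℕ, 1 / ε ≤ k ∧ 0 < k :=
    ⟨⌈1 / ε⌉₊, Nat.le_ceil _, Nat.ceil_pos.2 (by positivity)⟩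
  set K := 100 * k ^ 2 with hKdef
  have hK : 1 < K := by
    have := Nat.pow_pos hk (n := 2)
    omega
  -- `K` and `Cs` depend on `ε` only, so they are fixed in the program before an instance is given.
  obtain ⟨Cs, hCs, hCs'⟩ := CVRP.exists_configurations (CVRP.allTypes K) k
  obtain ⟨A, p, hA⟩ := CVRP.polyTime_algorithm hK Cs
  refine ⟨A, p, fun I hI => ?_⟩
  have hdem : ∀ v ∈ CVRP.classify K (CVRP.items (CVRP.inputOf I)), v.2.2.2 ≤ 1 := fun v hv =>
    (CVRP.mem_items I (CVRP.mem_classify hv).1).2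
  obtain ⟨S, hS, hcost, henc⟩ := CVRP.exists_solution I K (CVRP.packs_solve K Cs hdem)
  obtain ⟨t, ht, htp⟩ := hA (CVRP.inputOf I)
  rw [CVRP.encode_eq]
  refine ⟨S, t, henc ▸ ht, htp, hS, fun S' hS' => ?_⟩
  obtain ⟨P, hP, hPS⟩ := CVRP.exists_packs I K hS'
  have hPk : ∀ t ∈ P, t.length ≤ k := by
    intro t ht
    refine CVRP.length_le_of_demand hε hkε (fun v hv => ?_) (hP.2 t ht)
    obtain ⟨i, -, rfl⟩ := List.mem_map.1 ((hP.1.trans (CVRP.classify_perm I K)).mem_iff.1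
      (List.mem_flatten_of_mem ht hv))
    exact hI i
  have h1 := CVRP.totalLength_solve_le hK k hCs hCs' (CVRP.items_nodup I)
    (fun v hv => (CVRP.mem_items I hv).1) hP hPk
  have h2 : 1 / (k : ℝ) ≤ ε := by
    rw [div_le_iff₀ (by positivity)]
    rwa [div_le_iff₀ hε, mul_comm] at hkε
  have h3 := CVRP.totalLength_nonneg P
  rw [hcost]
  calc _ ≤ _ := h1
    _ ≤ (1 + 1 / k) * CVRP.totalLength P :=
        mul_le_mul_of_nonneg_right (CVRP.constants_bound hk) h3
    _ ≤ (1 + ε) * CVRP.totalLength P := mul_le_mul_of_nonneg_right (by linarith) h3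
    _ ≤ (1 + ε) * I.cost S' := mul_le_mul_of_nonneg_left hPS (by linarith)
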